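/- Theorem (Improved Hardy inequality). Let $d \ge 1$ be an integer and let $p \ge 1$ be real. For $\delta>0$ and a measurable function $u:\mathbb{R}^d\to\mathbb{R}$ set $$I_\delta(u) = \iint_{\{(x,y)\in\mathbb{R}^d\times\mathbb{R}^d:\ |u(x)-u(y)|>\delta\}} \frac{\delta^p}{|x-y|^{d+p}}\,dx\,dy \in [0,\infty].$$ Let $B_\rho$ denote the open ball of radius $\rho$ centred at the origin of $\mathbb{R}^d$, and let $\operatorname{supp} u$ denote the essential support of $u$ (the complement of the largest open set on which $u=0$ almost everywhere). There is a constant $C>0$, depending only on $p$ and $d$, such that for all $0<r<R$, all $\delta>0$ and all real-valued $u\in L^p(\mathbb{R}^d)$ the following hold. i) If $p<d$ and $\operatorname{supp} u\subset B_R$, then $$\int_{\mathbb{R}^d}\frac{|u(x)|^p}{|x|^p}\,dx \le C\left(I_\delta(u)+R^{d-p}\delta^p\right).$$ ii) If $p>d$ and $\operatorname{supp} u\subset \mathbb{R}^d\setminus B_r$, then $$\int_{\mathbb{R}^d}\frac{|u(x)|^p}{|x|^p}\,dx \le C\left(I_\delta(u)+r^{d-p}\delta^p\right).$$ iii) If $p=d\ge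 2$ and $\operatorname{supp} u\subset B_R$, then $$\int_{\mathbb{R}^d\setminus B_r}\frac{|u(x)|^d}{|x|^d\,\ln^d(2R/|x|)}\,dx \le C\left(I_\delta(u)+\ln(2R/r)\,\delta^d\right).$$ iv) If $p=d\ge 2$ and $\operatorname{supp} u\subset \mathbb{R}^d\setminus B_r$, then $$\int_{B_R}\frac{|u(x)|^d}{|x|^d\,\ln^d(2|x|/r)}\,dx \le C\left(I_\delta(u)+\ln(2R/r)\,\delta^d\right).$$ In iii) and iv) the integrands are understood to be $0$ wherever $u=0$. -/

import Mathlib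

open MeasureTheory Topology
open scoped ENNReal

/-- The essential support of a (class of) function(s) `u` on `ℝ^d`: the complement of the largest
open set on which `u` vanishes almost everywhere. -/
def essSupport {d : ℕ} (u : EuclideanSpace ℝ (Fin d) → ℝ) : Set (EuclideanSpace ℝ (Fin d)) :=
  {x | ∀ U ∈ 𝓝 x, ¬ ∀ᵐ y ∂(volume.restrict U), u y = 0}

/-- The nonlocal energy `I_δ(u) = ∬_{|u(x) - u(y)| > δ} δ^p / |x - y|^{d+p} dx dy`,
with values in `[0, ∞]`. -/
noncomputable def Idelta {d : ℕ} (p δ : ℝ) (u : EuclideanSpace ℝ (Fin d) → ℝ) : ℝ≥0∞ :=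
  ∫⁻ x, ∫⁻ y in {y | δ < |u x - u y|},
    ENNReal.ofReal (δ ^ p / ‖x - y‖ ^ ((d : ℝ) + p))

/-! Dividing `u` by `δ` reduces everything to threshold one. The engine is then a Poincaré
inequality on balls, `exists_poincare_ball`: the integral of `|u x - u y| ^ p` over a ball of radius
`ρ` squared is controlled by `ρ ^ (d + p)` times the energy seen from a slightly larger ball, plus
`ρ ^ (2 * d)`. The second term is there because oscillations below the threshold carry no energy; it
is the source of the `δ ^ p` terms in the theorem.

In dimension one (`exists_lintegral_posPart_le`), cut the range of `g` into unit bands `j < g ≤ j +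
1` of length `γ j`, lying below superlevel sets of length `α (j + 1)`. If `8 * γ j ≥ α (j + 1)`, the
distribution function drops by a definite factor, and such levels alone would give exponential
decay. Otherwise the band is thin: finite energy prevents `{g ≤ j}` and `{g > j + 1}` from mixing at
small scales, so bisection finds a window of length at most `8 * γ j` in which both sets and the
band have definite density (`exists_transition_window`). Jumps there cost at least `c * γ j ^ (1 -
p)`. Since the `γ j` sum to at most one, Jensen bounds the `p`-th power of the number of thin bands
by the energy, and the thin bands can only delay the exponential decay by that number. Both tails
about an approximate median give the Poincaré inequality on the interval. Applying it on the
segments between pairs of points of a ball and integrating over the pairs gives the ball version: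
the Jacobian `|s - t| ^ (-d)` turns the kernel of dimension one into that of dimension `d`.

For Hardy, follow the means of `|u| ^ p` over balls `B(s • z, s / 8)` along a geometric sequence of
scales starting where `u` vanishes. Poincaré and convexity compare neighbouring scales with a factor
as close to one as desired (`exists_coneMean_step`), the errors being energies of annuli of bounded
overlap. A discrete Hardy inequality then sums the means: `exists_geometric_hardy` when `p ≠ d`,
going inwards if `p < d` and outwards if `p > d`, and `critical_hardy`, responsible for the
logarithms, when `p = d`. -/

/-! ### Windows on the line and the bisection argument -/

/-- The length of the part of `A` in the window `(a, b]`. -/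
noncomputable def windowLength (A : Set ℝ) (a b : ℝ) : ℝ := volume.real (A ∩ Set.Ioc a b)

lemma windowLength_nonneg (A : Set ℝ) (a b : ℝ) : 0 ≤ windowLength A a b := measureReal_nonneg

lemma volume_window_ne_top (A : Set ℝ) (a b : ℝ) : volume (A ∩ Set.Ioc a b) ≠ ⊤ :=
  ((measure_mono Set.inter_subset_right).trans_lt (by simp)).ne

lemma windowLength_eq_integral {A : Set ℝ} (hA : MeasurableSet A) {a b : ℝ} (hab : a ≤ b) :
    windowLength A a b = ∫ x in a..b, A.indicator 1 x := by
  rw [intervalIntegral.integral_of_le hab, integral_indicator_one hA, windowLength,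
    measureReal_restrict_apply hA]

lemma windowLength_add {A : Set ℝ} (hA : MeasurableSet A) {a b c : ℝ} (hab : a ≤ b)
    (hbc : b ≤ c) : windowLength A a b + windowLength A b c = windowLength A a c := by
  unfold windowLength
  rw [← Set.Ioc_union_Ioc_eq_Ioc hab hbc, Set.inter_union_distrib_left]
  refine (measureReal_union ?_ (hA.inter measurableSet_Ioc) (volume_window_ne_top _ _ _)
    (volume_window_ne_top _ _ _)).symm
  exact (Set.Ioc_disjoint_Ioc_of_le le_rfl).mono Set.inter_subset_right Set.inter_subset_right

lemma windowLength_mono {A : Set ℝ} {a b a' b' : ℝ} (ha : a' ≤ a) (hb : b ≤ b') :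
    windowLength A a b ≤ windowLength A a' b' :=
  measureReal_mono (Set.inter_subset_inter_right _ (Set.Ioc_subset_Ioc ha hb))
    (volume_window_ne_top _ _ _)

lemma windowLength_union {A B : Set ℝ} (hB : MeasurableSet B) (h : Disjoint A B) (a b : ℝ) :
    windowLength (A ∪ B) a b = windowLength A a b + windowLength B a b := by
  unfold windowLength
  rw [Set.union_inter_distrib_right]
  exact measureReal_union (h.mono Set.inter_subset_left Set.inter_subset_left)
    (hB.inter measurableSet_Ioc) (volume_window_ne_top _ _ _) (volume_window_ne_top _ _ _)

lemma windowLength_univ {a b : ℝ} (hab : a ≤ b) : windowLength Set.univ a b = b - a := by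
  simp [windowLength, hab]

lemma continuous_windowLength {A : Set ℝ} (hA : MeasurableSet A) {h : ℝ} (hh : 0 ≤ h) :
    Continuous fun x => windowLength A x (x + h) := by
  have hint : ∀ a b : ℝ, IntervalIntegrable (A.indicator (1 : ℝ → ℝ)) volume a b := by
    intro a b
    rw [intervalIntegrable_iff]
    exact ((integrable_const (μ := volume.restrict (Set.Ioc (min a b) (max a b))) (1 : ℝ)).indicator
      hA :)
  have : (fun x => windowLength A x (x + h)) =
      fun x => (∫ t in (0 : ℝ)..(x + h), A.indicator 1 t) - ∫ t in (0 : ℝ)..x, A.indicator 1 t := by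
    ext x
    rw [windowLength_eq_integral hA (by linarith), intervalIntegral.integral_interval_sub_left
      (hint _ _) (hint _ _)]
  rw [this]
  have hc := intervalIntegral.continuous_primitive hint 0
  exact (hc.comp (by fun_prop : Continuous fun x : ℝ => x + h)).sub hc

/-- A continuous additive window function changing sign between the two halves of a window
vanishes on some window of half the length. -/
lemma exists_balanced_window {L U : Set ℝ} (hL : MeasurableSet L) (hU : MeasurableSet U)
    {a h : ℝ} (hh : 0 ≤ h)
    (hs : windowLength U a (a + h) ≤ windowLength L a (a + h) ∧
        windowLength L (a + h) (a + h + h) ≤ windowLength U (a + h) (a + h + h) ∨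
      windowLength L a (a + h) ≤ windowLength U a (a + h) ∧
        windowLength U (a + h) (a + h + h) ≤ windowLength L (a + h) (a + h + h)) :
    ∃ b, a ≤ b ∧ b + h ≤ a + h + h ∧ windowLength L b (b + h) = windowLength U b (b + h) := by
  have hc : Continuous fun x => windowLength L x (x + h) - windowLength U x (x + h) :=
    (continuous_windowLength hL hh).sub (continuous_windowLength hU hh)
  have hiv := intermediate_value_uIcc (a := a) (b := a + h) hc.continuousOn
  have h0 : (0 : ℝ) ∈ Set.uIcc (windowLength L a (a + h) - windowLength U a (a + h))
      (windowLength L (a + h) (a + h + h) - windowLength U (a + h) (a + h + h)) := by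
    rw [Set.mem_uIcc]
    rcases hs with hs | hs
    · exact Or.inr ⟨by linarith, by linarith⟩
    · exact Or.inl ⟨by linarith, by linarith⟩
  obtain ⟨b, hb, hb0⟩ := hiv h0
  rw [Set.uIcc_of_le (by linarith)] at hb
  exact ⟨b, hb.1, by linarith [hb.2], by simpa [sub_eq_zero] using hb0⟩

/-- If `L`, `G`, `U` partition the line, `L` and `U` do not coexist in equal proportion in small
windows, and `G` is small compared with `U` in `(0, 1]`, then some window sees a definite
proportion of each of the three sets. -/
lemma exists_transition_window {L G U : Set ℝ} (hL : MeasurableSet L) (hG : MeasurableSet G)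
    (hU : MeasurableSet U)
    (hsum : ∀ a b, a ≤ b → windowLength L a b + windowLength G a b + windowLength U a b = b - a)
    (hac : ∀ ε : ℝ, 0 < ε → ∃ η : ℝ, 0 < η ∧ ∀ a b, 0 ≤ a → a < b → b ≤ 1 → b - a < η →
      windowLength L a b * windowLength U a b < ε * (b - a) ^ 2)
    (hUL : windowLength U 0 1 ≤ windowLength L 0 1)
    (hGU : 8 * windowLength G 0 1 < windowLength U 0 1) :
    ∃ a b, 0 ≤ a ∧ a < b ∧ b ≤ 1 ∧ (b - a) / 8 ≤ windowLength G a b ∧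
      3 / 8 * (b - a) ≤ windowLength L a b ∧ 3 / 8 * (b - a) ≤ windowLength U a b := by
  have hpow : ∀ η : ℝ, 0 < η → ∀ h : ℝ, 0 < h → ∃ k : ℕ, h * (1 / 2) ^ k < η := by
    intro η hη h hh
    obtain ⟨k, hk⟩ := exists_pow_lt_of_lt_one (div_pos hη hh) (by norm_num : (1 / 2 : ℝ) < 1)
    exact ⟨k, by rw [lt_div_iff₀ hh] at hk; linarith⟩
  -- First bisection: reach a window where `L` and `U` have equal length and `G` fills at most a
  -- quarter. Otherwise one could halve forever, keeping `U ≤ L` and the density `v` of `U - 8 G`,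
  -- until `L` and `U` coexist in a window too small for `hac`.
  have hbal : ∃ a h, 0 ≤ a ∧ 0 < h ∧ a + h ≤ 1 ∧
      windowLength L a (a + h) = windowLength U a (a + h) ∧ windowLength G a (a + h) ≤ h / 4 := by
    by_contra hno
    set v := windowLength U 0 1 - 8 * windowLength G 0 1 with hv
    have hv0 : 0 < v := by linarith
    have hdesc : ∀ k : ℕ, ∃ a, 0 ≤ a ∧ a + 1 * (1 / 2) ^ k ≤ 1 ∧
        windowLength U a (a + 1 * (1 / 2) ^ k) ≤ windowLength L a (a + 1 * (1 / 2) ^ k) ∧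
        v * (1 * (1 / 2) ^ k) ≤ windowLength U a (a + 1 * (1 / 2) ^ k)
          - 8 * windowLength G a (a + 1 * (1 / 2) ^ k) := by
      intro k
      induction k with
      | zero => exact ⟨0, by simpa using ⟨hUL, hv.le⟩⟩
      | succ k ih =>
        obtain ⟨a, ha0, ha1, hUL', hv'⟩ := ih
        have hp : (0 : ℝ) < 1 * (1 / 2) ^ (k + 1) := by positivity
        rw [show (1 : ℝ) * (1 / 2) ^ k = 1 * (1 / 2) ^ (k + 1) + 1 * (1 / 2) ^ (k + 1) by ring]
          at ha1 hUL' hv'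
        generalize (1 : ℝ) * (1 / 2) ^ (k + 1) = h at *
        rw [← add_assoc] at ha1 hUL' hv'
        have e1 := windowLength_add hL (a := a) (b := a + h) (c := a + h + h) (by linarith)
          (by linarith)
        have e2 := windowLength_add hG (a := a) (b := a + h) (c := a + h + h) (by linarith)
          (by linarith)
        have e3 := windowLength_add hU (a := a) (b := a + h) (c := a + h + h) (by linarith)
          (by linarith)
        have hnb : ¬ (windowLength U a (a + h) ≤ windowLength L a (a + h) ∧
              windowLength L (a + h) (a + h + h) ≤ windowLength U (a + h) (a + h + h) ∨
            windowLength L a (a + h) ≤ windowLength U a (a + h) ∧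
              windowLength U (a + h) (a + h + h) ≤ windowLength L (a + h) (a + h + h)) := by
          -- A sign change between the halves gives a balanced window of length `h`. On the double
          -- window `8 G ≤ U ≤ L` and the three lengths add up to `2 * h`, so `G` is at most `h / 4`
          -- there and a fortiori in the balanced window, against `hno`.
          intro hs
          obtain ⟨b, hb0, hb1, hb⟩ := exists_balanced_window hL hU hp.le hs
          refine hno ⟨b, h, by linarith, hp, by linarith, hb, ?_⟩
          have := windowLength_mono (A := G) hb0 hb1
          have := hsum a (a + h + h) (by linarith)
          have := windowLength_nonneg G a (a + h + h)
          nlinarith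
        -- `U - 8 G` is additive, so one half keeps the density `v`. That half also keeps `U ≤ L`:
        -- were it `L < U`, the other half would have `U ≤ L` by additivity, a sign change.
        rcases le_total (v * h) (windowLength U a (a + h) - 8 * windowLength G a (a + h)) with
          h1 | h1
        · refine ⟨a, ha0, by linarith, ?_, h1⟩
          by_contra! h2
          exact hnb (Or.inr ⟨h2.le, by linarith⟩)
        · refine ⟨a + h, by linarith, by linarith, ?_, by linarith⟩
          by_contra! h2
          exact hnb (Or.inl ⟨by linarith, h2.le⟩)
    obtain ⟨η, hη, hac'⟩ := hac (v ^ 2) (by positivity)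
    obtain ⟨k, hk⟩ := hpow η hη 1 one_pos
    obtain ⟨a, ha0, ha1, hUL', hv'⟩ := hdesc k
    have hp : (0 : ℝ) < 1 * (1 / 2) ^ k := by positivity
    generalize (1 : ℝ) * (1 / 2) ^ k = h at *
    have h1 := hac' a (a + h) ha0 (by linarith) ha1 (by linarith)
    have h2 := windowLength_nonneg G a (a + h)
    have h3 : v * h ≤ windowLength U a (a + h) := by linarith
    have h4 : v * h ≤ windowLength L a (a + h) := by linarith
    have h5 := mul_le_mul h4 h3 (by positivity) (windowLength_nonneg _ _ _)
    rw [add_sub_cancel_left] at h1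
    linarith [show v * h * (v * h) = v ^ 2 * h ^ 2 by ring]
  obtain ⟨a₀, h₀, ha₀, hh₀, hah₀, hLU₀, hG₀⟩ := hbal
  -- Second bisection, through balanced windows. Balance and `G ≤ 1/4` force `L` and `U` to have
  -- density at least `3/8`, so if the conclusion fails then `G` has density below `1/8`. A balanced
  -- subwindow of half the length then has `G` at most `1/4` again, and the descent never stops.
  by_contra! hno
  have hdesc : ∀ k : ℕ, ∃ a, 0 ≤ a ∧ a + h₀ * (1 / 2) ^ k ≤ 1 ∧
      windowLength L a (a + h₀ * (1 / 2) ^ k) = windowLength U a (a + h₀ * (1 / 2) ^ k) ∧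
      windowLength G a (a + h₀ * (1 / 2) ^ k) ≤ h₀ * (1 / 2) ^ k / 4 := by
    intro k
    induction k with
    | zero => exact ⟨a₀, by simpa using ⟨ha₀, hah₀, hLU₀, hG₀⟩⟩
    | succ k ih =>
      obtain ⟨a, ha0, ha1, hLU, hGa⟩ := ih
      have hp : (0 : ℝ) < h₀ * (1 / 2) ^ (k + 1) := by positivity
      rw [show h₀ * (1 / 2) ^ k = h₀ * (1 / 2) ^ (k + 1) + h₀ * (1 / 2) ^ (k + 1) by ring]
        at ha1 hLU hGa
      generalize h₀ * (1 / 2) ^ (k + 1) = h at *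
      rw [← add_assoc] at ha1 hLU hGa
      have e1 := windowLength_add hL (a := a) (b := a + h) (c := a + h + h) (by linarith)
        (by linarith)
      have e3 := windowLength_add hU (a := a) (b := a + h) (c := a + h + h) (by linarith)
        (by linarith)
      have hs := hsum a (a + h + h) (by linarith)
      have hsmall : windowLength G a (a + h + h) < (h + h) / 8 := by
        by_contra! hc
        exact absurd (hno a (a + h + h) ha0 (by linarith) ha1 (by linarith) (by linarith))
          (by linarith)
      obtain ⟨b, hb0, hb1, hb⟩ := exists_balanced_window hL hU hp.le
        (a := a) (by
          rcases le_total (windowLength U a (a + h)) (windowLength L a (a + h)) with h2 | h2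
          · exact Or.inl ⟨h2, by linarith⟩
          · exact Or.inr ⟨h2, by linarith⟩)
      exact ⟨b, by linarith, by linarith, hb, by
        linarith [windowLength_mono (A := G) hb0 hb1]⟩
  -- `9/64` is the square of the density `3/8` of `L` and of `U` in a balanced window.
  obtain ⟨η, hη, hac'⟩ := hac (9 / 64) (by positivity)
  obtain ⟨k, hk⟩ := hpow η hη h₀ hh₀
  obtain ⟨a, ha0, ha1, hLU, hGa⟩ := hdesc k
  have hp : (0 : ℝ) < h₀ * (1 / 2) ^ k := by positivity
  generalize h₀ * (1 / 2) ^ k = h at *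
  have h1 := hac' a (a + h) ha0 (by linarith) ha1 (by linarith)
  have h2 := hsum a (a + h) (by linarith)
  rw [add_sub_cancel_left] at h1 h2
  have h3 : 3 / 8 * h ≤ windowLength L a (a + h) := by linarith
  rw [← hLU] at h1
  nlinarith

/-! ### Energy of jumps on the unit interval and thin bands -/

/-- The one-dimensional energy density `|s - t|^{-1-p}` restricted to jumps larger than one. -/
noncomputable def jumpKernel (p : ℝ) (g : ℝ → ℝ) (s t : ℝ) : ℝ≥0∞ :=
  {z : ℝ × ℝ | 1 < |g z.1 - g z.2|}.indicator
    (fun z => ENNReal.ofReal (|z.1 - z.2| ^ (-(1 + p)))) (s, t)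

lemma measurable_jumpKernel (p : ℝ) {g : ℝ → ℝ} (hg : Measurable g) :
    Measurable fun z : ℝ × ℝ => jumpKernel p g z.1 z.2 := by
  unfold jumpKernel
  refine Measurable.indicator (by fun_prop) ?_
  exact measurableSet_lt measurable_const (by fun_prop)

/-- The energy of the jumps of `g` inside `(0, 1]`. -/
noncomputable def jumpEnergy (p : ℝ) (g : ℝ → ℝ) : ℝ≥0∞ :=
  ∫⁻ s in Set.Ioc 0 1, ∫⁻ t in Set.Ioc 0 1, jumpKernel p g s t

/-- Two points of the window are at distance at most `b - a`, and every pair in `A × B` jumps by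
more than one, so the kernel is at least `(b - a) ^ (-(1 + p))` on that product. -/
lemma windowLength_mul_le_lintegral {p : ℝ} (hp : 1 ≤ p) {g : ℝ → ℝ} {A B : Set ℝ}
    (hB : MeasurableSet B) (hA : MeasurableSet A)
    (hAB : ∀ s ∈ A, ∀ t ∈ B, 1 < |g s - g t|) {a b : ℝ} (hab : a < b) :
    ENNReal.ofReal (windowLength A a b * windowLength B a b * (b - a) ^ (-(1 + p))) ≤
      ∫⁻ s in A ∩ Set.Ioc a b, ∫⁻ t in Set.Ioc a b, jumpKernel p g s t := by
  have hA' : volume (A ∩ Set.Ioc a b) = ENNReal.ofReal (windowLength A a b) :=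
    (ofReal_measureReal (volume_window_ne_top A a b)).symm
  have hB' : volume (B ∩ Set.Ioc a b) = ENNReal.ofReal (windowLength B a b) :=
    (ofReal_measureReal (volume_window_ne_top B a b)).symm
  calc ENNReal.ofReal (windowLength A a b * windowLength B a b * (b - a) ^ (-(1 + p)))
    _ = ∫⁻ s in A ∩ Set.Ioc a b, ∫⁻ t in B ∩ Set.Ioc a b,
        ENNReal.ofReal ((b - a) ^ (-(1 + p))) := by
        simp only [setLIntegral_const, hA', hB']
        have h1 : 0 ≤ (b - a) ^ (-(1 + p)) := Real.rpow_nonneg (by linarith) _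
        rw [← ENNReal.ofReal_mul h1, ← ENNReal.ofReal_mul
          (mul_nonneg h1 (windowLength_nonneg _ _ _))]
        congr 1
        ring
    _ ≤ ∫⁻ s in A ∩ Set.Ioc a b, ∫⁻ t in B ∩ Set.Ioc a b, jumpKernel p g s t := by
        refine setLIntegral_mono' (hA.inter measurableSet_Ioc) fun s hs => ?_
        refine setLIntegral_mono' (hB.inter measurableSet_Ioc) fun t ht => ?_
        have h1 := hAB s hs.1 t ht.1
        rw [jumpKernel, Set.indicator_of_mem (by exact h1)]
        refine ENNReal.ofReal_le_ofReal (Real.rpow_le_rpow_of_nonpos ?_ ?_ (by linarith))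
        · rw [abs_pos, sub_ne_zero]
          intro h
          replace h : s = t := h
          rw [h, sub_self, abs_zero] at h1
          linarith
        · obtain ⟨h2, h3⟩ := hs.2
          obtain ⟨h4, h5⟩ := ht.2
          rw [abs_le]
          dsimp only
          constructor <;> linarith
    _ ≤ _ := by
        refine lintegral_mono fun s => ?_
        exact lintegral_mono_set Set.inter_subset_right

/-- Absolute continuity of the integral: a finite energy gives small squares small energy, while
coexistence of `L` and `U` would keep it bounded below, since `(b - a) ^ (-(1 + p))` is at least `(b
- a) ^ (-2)`. This provides the non-mixing hypothesis of `exists_transition_window`. -/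
lemma exists_small_window {p : ℝ} (hp : 1 ≤ p) {g : ℝ → ℝ} (hg : Measurable g)
    (hE : jumpEnergy p g ≠ ⊤) {L U : Set ℝ} (hL : MeasurableSet L) (hU : MeasurableSet U)
    (hLU : ∀ s ∈ L, ∀ t ∈ U, 1 < |g s - g t|) (ε : ℝ) (hε : 0 < ε) :
    ∃ η : ℝ, 0 < η ∧ ∀ a b, 0 ≤ a → a < b → b ≤ 1 → b - a < η →
      windowLength L a b * windowLength U a b < ε * (b - a) ^ 2 := by
  set μ := (volume.restrict (Set.Ioc (0 : ℝ) 1)).prod (volume.restrict (Set.Ioc (0 : ℝ) 1))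
  have hE' : ∫⁻ z, jumpKernel p g z.1 z.2 ∂μ ≠ ⊤ := by
    rwa [lintegral_prod _ (measurable_jumpKernel p hg).aemeasurable]
  obtain ⟨η, hη, h⟩ := exists_pos_setLIntegral_lt_of_measure_lt hE'
    (ε := ENNReal.ofReal ε) (by simpa using hε)
  obtain ⟨η', hη', hηη'⟩ := ENNReal.lt_iff_exists_real_btwn.1 hη
  refine ⟨min η' 1, by simp at hηη' ⊢; exact hηη'.1, fun a b ha hab hb hlt => ?_⟩
  have hsub : Set.Ioc a b ⊆ Set.Ioc 0 1 := Set.Ioc_subset_Ioc ha hb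
  have hr : volume.restrict (Set.Ioc (0 : ℝ) 1) (Set.Ioc a b) = ENNReal.ofReal (b - a) := by
    rw [Measure.restrict_apply measurableSet_Ioc, Set.inter_eq_left.2 hsub, Real.volume_Ioc]
  have hr2 : (volume.restrict (Set.Ioc (0 : ℝ) 1)).restrict (Set.Ioc a b) =
      volume.restrict (Set.Ioc a b) := by
    rw [Measure.restrict_restrict measurableSet_Ioc, Set.inter_eq_left.2 hsub]
  have hS : μ (Set.Ioc a b ×ˢ Set.Ioc a b) < η := by
    rw [Measure.prod_prod, hr, ← ENNReal.ofReal_mul (by linarith)]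
    refine lt_of_le_of_lt (ENNReal.ofReal_le_ofReal ?_) hηη'.2
    have := lt_min_iff.1 hlt
    nlinarith
  have h1 := h _ hS
  rw [← Measure.prod_restrict, hr2,
    lintegral_prod _ (measurable_jumpKernel p hg).aemeasurable] at h1
  have h2 := (windowLength_mul_le_lintegral hp hU hL hLU hab).trans
    (lintegral_mono_set Set.inter_subset_right)
  have h3 := (ENNReal.ofReal_lt_ofReal_iff hε).1 (h2.trans_lt h1)
  have h4 : (b - a) ^ (-(1 + p)) ≥ ((b - a) ^ 2)⁻¹ := by
    rw [← Real.rpow_natCast, ← Real.rpow_neg (by linarith)]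
    refine Real.rpow_le_rpow_of_exponent_ge (by linarith) (by linarith) (by push_cast; linarith)
  have h5 : windowLength L a b * windowLength U a b * ((b - a) ^ 2)⁻¹ < ε :=
    lt_of_le_of_lt (mul_le_mul_of_nonneg_left h4 (mul_nonneg (windowLength_nonneg _ _ _)
      (windowLength_nonneg _ _ _))) h3
  have : 0 < b - a := by linarith
  rwa [← div_eq_mul_inv, div_lt_iff₀ (by positivity)] at h5

/-- A level band of `g` which is small compared to the set above it carries a definite amount of
energy. -/
lemma energy_of_thin_band {p : ℝ} (hp : 1 ≤ p) {g : ℝ → ℝ} (hg : Measurable g)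
    (hE : jumpEnergy p g ≠ ⊤) (l : ℝ)
    (hUL : windowLength {s | l + 1 < g s} 0 1 ≤ windowLength {s | g s ≤ l} 0 1)
    (hGU : 8 * windowLength {s | l < g s ∧ g s ≤ l + 1} 0 1 <
      windowLength {s | l + 1 < g s} 0 1) :
    0 < windowLength {s | l < g s ∧ g s ≤ l + 1} 0 1 ∧
    ENNReal.ofReal (3 / 128 * (8 * windowLength {s | l < g s ∧ g s ≤ l + 1} 0 1) ^ (1 - p)) ≤
      ∫⁻ s in {s | l - 1 < g s ∧ g s ≤ l + 1} ∩ Set.Ioc 0 1, ∫⁻ t in Set.Ioc 0 1,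
        jumpKernel p g s t := by
  set L := {s | g s ≤ l} with hL
  set G := {s | l < g s ∧ g s ≤ l + 1} with hG
  set U := {s | l + 1 < g s} with hU
  have mL : MeasurableSet L := measurableSet_le hg measurable_const
  have mU : MeasurableSet U := measurableSet_lt measurable_const hg
  have mG : MeasurableSet G :=
    (measurableSet_lt measurable_const hg).inter (measurableSet_le hg measurable_const)
  have hLU : ∀ s ∈ L, ∀ t ∈ U, 1 < |g s - g t| := by
    intro s hs t ht
    simp only [hL, hU, Set.mem_ofPred_eq] at hs ht
    rw [lt_abs]
    right; linarith
  have hsum : ∀ a b, a ≤ b →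
      windowLength L a b + windowLength G a b + windowLength U a b = b - a := by
    intro a b hab
    rw [← windowLength_union mG, ← windowLength_union mU, ← windowLength_univ hab]
    · congr 1
      ext s
      simp only [hL, hG, hU, Set.mem_union, Set.mem_ofPred_eq, Set.mem_univ, iff_true]
      by_cases h1 : g s ≤ l <;> by_cases h2 : g s ≤ l + 1 <;> grind
    · rw [Set.disjoint_left]
      intro s
      simp only [hL, hG, hU, Set.mem_union, Set.mem_ofPred_eq]
      grind
    · rw [Set.disjoint_left]
      intro s
      simp only [hL, hG, Set.mem_ofPred_eq]
      grind
  obtain ⟨a, b, ha, hab, hb, hGJ, hLJ, hUJ⟩ := exists_transition_window mL mG mU hsum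
    (exists_small_window hp hg hE mL mU hLU) hUL hGU
  have hGm := windowLength_mono (A := G) ha hb
  have hba : 0 < b - a := by linarith
  refine ⟨by linarith, ?_⟩
  -- Jumps from `L` to `U` exceed one, but `L` is unbounded below, and the energies of different
  -- levels must barely overlap. Hence the dichotomy on `L`: either its top layer `B` is large and
  -- jumps to `U`, or the rest `A` is large and `G` jumps to it. In both cases the jumps start in
  -- `(l - 1, l + 1]`.
  set B := {s | l - 1 < g s ∧ g s ≤ l} with hB
  set A := {s | g s ≤ l - 1} with hA
  have mA : MeasurableSet A := measurableSet_le hg measurable_const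
  have mB : MeasurableSet B :=
    (measurableSet_lt measurable_const hg).inter (measurableSet_le hg measurable_const)
  have hAB : windowLength A a b + windowLength B a b = windowLength L a b := by
    rw [← windowLength_union mB]
    · congr 1
      ext s
      simp only [hA, hB, hL, Set.mem_union, Set.mem_ofPred_eq]
      grind
    · rw [Set.disjoint_left]
      intro s
      simp only [hA, hB, Set.mem_ofPred_eq]
      grind
  -- The constant is `3/128 = 1/8 * 3/16`, the product of the densities of `G` and `A`; the pair
  -- `B`, `U` does better. The window has length at most `8 * windowLength G 0 1`, and `1 - p` is
  -- nonpositive.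
  have hkey : ∀ S T : Set ℝ, MeasurableSet S → MeasurableSet T →
      (∀ s ∈ S, ∀ t ∈ T, 1 < |g s - g t|) → S ⊆ {s | l - 1 < g s ∧ g s ≤ l + 1} →
      3 / 128 * (b - a) ^ 2 ≤ windowLength S a b * windowLength T a b →
      ENNReal.ofReal (3 / 128 * (8 * windowLength G 0 1) ^ (1 - p)) ≤
      ∫⁻ s in {s | l - 1 < g s ∧ g s ≤ l + 1} ∩ Set.Ioc 0 1, ∫⁻ t in Set.Ioc 0 1,
        jumpKernel p g s t := by
    intro S T mS mT hST hS hle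
    have hI : Set.Ioc a b ⊆ Set.Ioc 0 1 := Set.Ioc_subset_Ioc ha hb
    calc _ ≤ ENNReal.ofReal (windowLength S a b * windowLength T a b * (b - a) ^ (-(1 + p))) := by
          refine ENNReal.ofReal_le_ofReal ?_
          calc 3 / 128 * (8 * windowLength G 0 1) ^ (1 - p)
              ≤ 3 / 128 * (b - a) ^ (1 - p) := by
                refine mul_le_mul_of_nonneg_left ?_ (by norm_num)
                exact Real.rpow_le_rpow_of_nonpos hba (by linarith) (by linarith)
            _ = 3 / 128 * (b - a) ^ 2 * (b - a) ^ (-(1 + p)) := by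
                rw [mul_assoc, ← Real.rpow_natCast, ← Real.rpow_add hba]
                congr 2; push_cast; ring
            _ ≤ _ := mul_le_mul_of_nonneg_right hle (by positivity)
      _ ≤ _ := windowLength_mul_le_lintegral hp mT mS hST hab
      _ ≤ ∫⁻ s in S ∩ Set.Ioc a b, ∫⁻ t in Set.Ioc 0 1, jumpKernel p g s t :=
          lintegral_mono fun s => lintegral_mono_set hI
      _ ≤ _ := lintegral_mono_set (Set.inter_subset_inter hS hI)
  rcases le_total (3 / 16 * (b - a)) (windowLength B a b) with hc | hc
  · refine hkey B U mB mU ?_ ?_ ?_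
    · intro s hs t ht
      simp only [hB, hU, Set.mem_ofPred_eq] at hs ht
      rw [lt_abs]
      right; linarith
    · intro s hs
      simp only [hB, Set.mem_ofPred_eq] at hs ⊢
      exact ⟨hs.1, by linarith⟩
    · nlinarith
  · refine hkey G A mG mA ?_ ?_ ?_
    · intro s hs t ht
      simp only [hA, hG, Set.mem_ofPred_eq] at hs ht
      rw [lt_abs]
      left; linarith
    · intro s hs
      simp only [hG, Set.mem_ofPred_eq] at hs ⊢
      exact ⟨by linarith, by linarith⟩
    · have : 3 / 16 * (b - a) ≤ windowLength A a b := by linarith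
      nlinarith

/-! ### Counting thin bands and geometric decay of the tails -/

lemma one_add_le_rpow_of_nonpos {x q : ℝ} (hx : 0 < x) (hq : q ≤ 0) :
    1 + q * (x - 1) ≤ x ^ q := by
  rw [Real.rpow_def_of_pos hx]
  have h1 := Real.add_one_le_exp (Real.log x * q)
  have h2 := Real.log_le_sub_one_of_pos hx
  nlinarith

/-- Jensen's inequality for the power `1 - p`, on finitely many numbers of sum at most one. -/
lemma card_rpow_le_sum_rpow {ι : Type*} (S : Finset ι) (γ : ι → ℝ) {p : ℝ} (hp : 1 ≤ p)
    (hγ : ∀ i ∈ S, 0 < γ i) (hsum : ∑ i ∈ S, γ i ≤ 1) :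
    (S.card : ℝ) ^ p ≤ ∑ i ∈ S, γ i ^ (1 - p) := by
  rcases S.eq_empty_or_nonempty with rfl | hS
  · simp [Real.zero_rpow (by linarith : p ≠ 0)]
  have hn : (0 : ℝ) < S.card := by exact_mod_cast hS.card_pos
  -- Tangent line of the convex function `x ^ (1 - p)` at `x = 1`, taken at `x = S.card * γ i`. The
  -- linear terms have a nonnegative sum because the `γ i` sum to at most one and `1 - p ≤ 0`.
  have h1 : ∀ i ∈ S, (S.card : ℝ) ^ (p - 1) * (1 + (1 - p) * (S.card * γ i - 1)) ≤
      γ i ^ (1 - p) := by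
    intro i hi
    have := one_add_le_rpow_of_nonpos (mul_pos hn (hγ i hi)) (by linarith : 1 - p ≤ 0)
    calc _ ≤ (S.card : ℝ) ^ (p - 1) * (S.card * γ i) ^ (1 - p) := by gcongr
      _ = _ := by
        rw [Real.mul_rpow hn.le (hγ i hi).le, ← mul_assoc, ← Real.rpow_add hn]
        simp
  refine le_trans ?_ (Finset.sum_le_sum h1)
  rw [← Finset.mul_sum, Finset.sum_add_distrib, ← Finset.mul_sum, Finset.sum_sub_distrib,
    ← Finset.mul_sum]
  simp only [Finset.sum_const, nsmul_eq_mul, mul_one]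
  calc (S.card : ℝ) ^ p = (S.card : ℝ) ^ (p - 1) * S.card := by
        rw [← Real.rpow_add_one hn.ne']; simp
    _ ≤ _ := by
        gcongr
        have : (1 - p) * (S.card * ∑ i ∈ S, γ i - S.card) ≥ 0 := by
          apply mul_nonneg_of_nonpos_of_nonpos (by linarith)
          nlinarith
        linarith

/-- The number of `j < J` at which a tail sequence drops by a definite factor. -/
noncomputable def dropCount (α γ : ℕ → ℝ) (J : ℕ) : ℕ :=
  ∑ j ∈ Finset.range J, if α (j + 1) ≤ 8 * γ j then 1 else 0

/-- The left-hand side is a potential, nonincreasing in `J`. At a drop the ratio `17/16` and the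
factor `17/8` are tuned so that the required inequality is exactly `α (J + 1) ≤ 8 * γ J`; elsewhere
the exponent does not move and `17/8 ≥ 1` suffices. -/
lemma sum_pow_dropCount_le {α γ : ℕ → ℝ} (hγ : ∀ j, 0 ≤ γ j)
    (h : ∀ j, α j = γ j + α (j + 1)) (J : ℕ) :
    ∑ j ∈ Finset.range J, (17 / 16 : ℝ) ^ dropCount α γ (j + 1) * γ j +
      17 / 8 * (17 / 16 : ℝ) ^ dropCount α γ J * α J ≤ 17 / 8 * α 0 := by
  induction J with
  | zero => simp [dropCount]
  | succ J ih =>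
    rw [Finset.sum_range_succ]
    have hs : dropCount α γ (J + 1) =
        dropCount α γ J + if α (J + 1) ≤ 8 * γ J then 1 else 0 := by
      rw [dropCount, Finset.sum_range_succ, dropCount]
    have hpos : (0 : ℝ) < (17 / 16) ^ dropCount α γ J := by positivity
    refine le_trans ?_ ih
    rw [hs, h J]
    split_ifs with hc
    · rw [pow_succ]
      generalize (17 / 16 : ℝ) ^ dropCount α γ J = P at *
      nlinarith [mul_nonneg hpos.le (hγ J), mul_le_mul_of_nonneg_left hc hpos.le]
    · rw [add_zero]
      nlinarith [mul_nonneg hpos.le (hγ J)]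

lemma exists_rpow_le_mul_pow (p : ℝ) (hp : 0 ≤ p) :
    ∃ C : ℝ, 0 < C ∧ ∀ n : ℕ, (n : ℝ) ^ p ≤ C * (17 / 16 : ℝ) ^ n := by
  obtain ⟨m, hm⟩ := exists_nat_ge p
  have ht := tendsto_pow_const_div_const_pow_of_one_lt m (by norm_num : (1 : ℝ) < 17 / 16)
  obtain ⟨C, hC⟩ := ht.bddAbove_range
  refine ⟨max C 1, by positivity, fun n => ?_⟩
  have h1 : (n : ℝ) ^ m / (17 / 16) ^ n ≤ C := hC ⟨n, rfl⟩
  rw [div_le_iff₀ (by positivity)] at h1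
  rcases n.eq_zero_or_pos with rfl | hn
  · rcases hp.eq_or_lt with rfl | hp
    · simp
    · simp [Real.zero_rpow hp.ne']
  · have h2 : (n : ℝ) ^ p ≤ (n : ℝ) ^ m := by
      rw [← Real.rpow_natCast]
      exact Real.rpow_le_rpow_of_exponent_le (by exact_mod_cast hn) hm
    calc _ ≤ _ := h2.trans h1
      _ ≤ _ := by gcongr; exact le_max_left _ _

lemma add_rpow_le_two_rpow_mul {a b p : ℝ} (ha : 0 ≤ a) (hb : 0 ≤ b) (hp : 0 ≤ p) :
    (a + b) ^ p ≤ 2 ^ p * (a ^ p + b ^ p) := by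
  have h1 : (a + b) ^ p ≤ (2 * max a b) ^ p := by
    refine Real.rpow_le_rpow (by positivity) ?_ hp
    linarith [le_max_left a b, le_max_right a b]
  rw [Real.mul_rpow (by norm_num) (by positivity)] at h1
  refine h1.trans (mul_le_mul_of_nonneg_left ?_ (by positivity))
  have := Real.rpow_nonneg ha p
  have := Real.rpow_nonneg hb p
  rcases max_choice a b with h | h <;> rw [h] <;> linarith

/-- Each of the levels `0, …, j` is either a drop or a thin band, so `j + 1` is at most the drop
count plus the number `n` of thin bands. The power `p` of the drop count is absorbed by `(17/16) ^
dropCount`, which the potential controls, and `n ^ p` multiplies a sum of `γ` that is at most one.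
-/
lemma exists_sum_level_le (p : ℝ) (hp : 0 ≤ p) :
    ∃ C : ℝ, 0 < C ∧ ∀ α γ : ℕ → ℝ, (∀ j, 0 ≤ α j) → (∀ j, 0 ≤ γ j) →
      (∀ j, α j = γ j + α (j + 1)) → α 0 ≤ 1 → ∀ J : ℕ,
      ∑ j ∈ Finset.range J, ((j : ℝ) + 1) ^ p * γ j ≤
        C * (1 + (((Finset.range J).filter fun j => 8 * γ j < α (j + 1)).card : ℝ) ^ p) := by
  obtain ⟨C, hC, hCn⟩ := exists_rpow_le_mul_pow p hp
  refine ⟨2 ^ p * (C * (17 / 8) + 1), by positivity, fun α γ hα hγ h h0 J => ?_⟩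
  set n := ((Finset.range J).filter fun j => 8 * γ j < α (j + 1)).card with hn
  have hcount : ∀ j < J, j + 1 ≤ dropCount α γ (j + 1) + n := by
    intro j hj
    have h1 : j + 1 = dropCount α γ (j + 1) +
        ((Finset.range (j + 1)).filter fun j => 8 * γ j < α (j + 1)).card := by
      have := Finset.card_filter_add_card_filter_not (s := Finset.range (j + 1))
        (fun j => α (j + 1) ≤ 8 * γ j)
      simp only [not_le, Finset.card_range] at this
      rw [dropCount, ← Finset.card_filter, this]
    have h2 : ((Finset.range (j + 1)).filter fun j => 8 * γ j < α (j + 1)).card ≤ n :=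
      Finset.card_le_card (Finset.filter_subset_filter _
        (Finset.range_subset_range.2 (by omega)))
    omega
  have hγs : ∀ J, ∑ j ∈ Finset.range J, γ j + α J = α 0 := by
    intro J
    induction J with
    | zero => simp
    | succ J ih => rw [Finset.sum_range_succ, ← ih, h J]; ring
  have hs := sum_pow_dropCount_le hγ h J
  have hpot : 0 ≤ 17 / 8 * (17 / 16 : ℝ) ^ dropCount α γ J * α J :=
    mul_nonneg (by positivity) (hα J)
  clear h
  calc ∑ j ∈ Finset.range J, ((j : ℝ) + 1) ^ p * γ j
      ≤ ∑ j ∈ Finset.range J, 2 ^ p * (C * ((17 / 16 : ℝ) ^ dropCount α γ (j + 1) * γ j)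
          + (n : ℝ) ^ p * γ j) := by
        refine Finset.sum_le_sum fun j hj => ?_
        have h1 : ((j : ℝ) + 1) ≤ dropCount α γ (j + 1) + n := by
          exact_mod_cast hcount j (Finset.mem_range.1 hj)
        have h2 := (Real.rpow_le_rpow (by positivity) h1 hp).trans
          (add_rpow_le_two_rpow_mul (by positivity) (by positivity) hp)
        have h3 := hCn (dropCount α γ (j + 1))
        calc _ ≤ 2 ^ p * (C * (17 / 16 : ℝ) ^ dropCount α γ (j + 1) + (n : ℝ) ^ p) * γ j := by
              refine mul_le_mul_of_nonneg_right (h2.trans ?_) (hγ j)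
              gcongr
          _ = _ := by ring
    _ = 2 ^ p * (C * ∑ j ∈ Finset.range J, (17 / 16 : ℝ) ^ dropCount α γ (j + 1) * γ j
          + (n : ℝ) ^ p * ∑ j ∈ Finset.range J, γ j) := by
        rw [Finset.mul_sum, Finset.mul_sum, ← Finset.sum_add_distrib, Finset.mul_sum]
    _ ≤ 2 ^ p * (C * (17 / 8) + (n : ℝ) ^ p * 1) := by
        gcongr
        · linarith
        · linarith [hγs J, hα J]
    _ ≤ _ := by
        have : (0 : ℝ) ≤ (n : ℝ) ^ p := by positivity
        rw [mul_assoc]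
        gcongr
        nlinarith [mul_nonneg hC.le this]

/-! ### The Poincaré inequality on the unit interval -/

/-- Integrability of the positive part of a function which is nonpositive on at least half of
`(0, 1]`, controlled by the energy of its jumps. -/
lemma exists_lintegral_posPart_le (p : ℝ) (hp : 1 ≤ p) :
    ∃ C : ℝ, 0 < C ∧ ∀ g : ℝ → ℝ, Measurable g → 1 / 2 ≤ windowLength {s | g s ≤ 0} 0 1 →
      ∫⁻ s in Set.Ioc 0 1, ENNReal.ofReal (max (g s) 0 ^ p) ≤
        ENNReal.ofReal C * (jumpEnergy p g + 1) := by
  obtain ⟨C, hC, hCJ⟩ := exists_sum_level_le p (by linarith)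
  set c : ℝ := 3 / 128 * 8 ^ (1 - p) with hc
  have hc0 : 0 < c := by positivity
  refine ⟨C * (1 + 2 / c), by positivity, fun g hg hmed => ?_⟩
  by_cases hE : jumpEnergy p g = ⊤
  · rw [hE, top_add, ENNReal.mul_top]
    · exact le_top
    · simp; positivity
  have hp0 : 0 < p := by linarith
  set G : ℕ → Set ℝ := fun j => {s | (j : ℝ) < g s ∧ g s ≤ (j : ℝ) + 1} with hG
  have mG : ∀ j, MeasurableSet (G j) := fun j =>
    (measurableSet_lt measurable_const hg).inter (measurableSet_le hg measurable_const)
  set γ : ℕ → ℝ := fun j => windowLength (G j) 0 1 with hγ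
  set α : ℕ → ℝ := fun j => windowLength {s | (j : ℝ) < g s} 0 1 with hα
  have hγ0 : ∀ j, 0 ≤ γ j := fun j => windowLength_nonneg _ _ _
  have hα0 : ∀ j, 0 ≤ α j := fun j => windowLength_nonneg _ _ _
  have hαγ : ∀ j, α j = γ j + α (j + 1) := by
    intro j
    simp only [hα, hγ]
    rw [← windowLength_union (measurableSet_lt measurable_const hg)]
    · congr 1
      ext s
      simp only [hG, Set.mem_union, Set.mem_ofPred_eq]
      push_cast
      grind
    · rw [Set.disjoint_left]
      intro s
      simp only [hG, Set.mem_ofPred_eq]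
      push_cast
      grind
  have hL : ∀ j : ℕ, windowLength {s | g s ≤ (j : ℝ)} 0 1 + α j = 1 := by
    intro j
    simp only [hα]
    rw [← windowLength_union (measurableSet_lt measurable_const hg)]
    · have h1 := windowLength_univ (zero_le_one (α := ℝ))
      rw [sub_zero] at h1
      rw [← h1]
      congr 1
      ext s
      simp only [Set.mem_union, Set.mem_ofPred_eq, Set.mem_univ, iff_true]
      exact le_or_gt _ _
    · rw [Set.disjoint_left]
      intro s
      simp only [Set.mem_ofPred_eq]
      grind
  have hanti : ∀ j, α j ≤ 1 / 2 := by
    intro j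
    have h0 := hL 0
    induction j with
    | zero => simp only [Nat.cast_zero] at h0; linarith
    | succ j ih => linarith [hαγ j, hγ0 j]
  -- the energy seen from a band
  set e : ℕ → ℝ≥0∞ := fun j => ∫⁻ s in {s | (j : ℝ) - 1 < g s ∧ g s ≤ (j : ℝ)} ∩ Set.Ioc 0 1,
    ∫⁻ t in Set.Ioc 0 1, jumpKernel p g s t with he
  have hesum : ∀ J, ∑ j ∈ Finset.range J, e j ≤ jumpEnergy p g := by
    intro J
    simp only [he]
    rw [← lintegral_biUnion_finset]
    · exact lintegral_mono_set (Set.iUnion₂_subset fun j _ => Set.inter_subset_right)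
    · intro i _ j _ hij
      rw [Function.onFun, Set.disjoint_left]
      rintro s ⟨⟨h1, h2⟩, -⟩ ⟨⟨h3, h4⟩, -⟩
      have h5 : (i : ℝ) < j + 1 := by linarith
      have h6 : (j : ℝ) < i + 1 := by linarith
      have : i < j + 1 := by exact_mod_cast h5
      have : j < i + 1 := by exact_mod_cast h6
      omega
    · exact fun j _ => ((measurableSet_lt measurable_const hg).inter
        (measurableSet_le hg measurable_const)).inter measurableSet_Ioc
  -- The jumps produced by a thin band `j` start in `(j - 1, j + 1]`, which meets only the bands
  -- counted by `e j` and `e (j + 1)`; summing over `j` counts the energy at most twice.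
  have hband : ∀ j, 8 * γ j < α (j + 1) → 0 < γ j ∧
      ENNReal.ofReal (c * γ j ^ (1 - p)) ≤ e j + e (j + 1) := by
    intro j hj
    have h1 := hanti (j + 1)
    have h2 := hL j
    have h3 := hanti j
    simp only [hα, Nat.cast_add, Nat.cast_one] at h1
    simp only [hα, hγ, Nat.cast_add, Nat.cast_one] at hj
    obtain ⟨h4, h5⟩ := energy_of_thin_band hp hg hE (j : ℝ) (by linarith) hj
    refine ⟨h4, ?_⟩
    rw [Real.mul_rpow (by norm_num) h4.le, ← mul_assoc] at h5
    refine h5.trans (le_trans (lintegral_mono_set ?_) (lintegral_union_le _ _ _))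
    rintro s ⟨⟨h6, h7⟩, h8⟩
    rcases le_or_gt (g s) j with h9 | h9
    · exact Or.inl ⟨⟨h6, h9⟩, h8⟩
    · exact Or.inr ⟨⟨by push_cast; linarith, by push_cast; linarith⟩, h8⟩
  have hn : ∀ J, (((Finset.range J).filter fun j => 8 * γ j < α (j + 1)).card : ℝ) ^ p ≤
      2 / c * (jumpEnergy p g).toReal := by
    intro J
    set S := (Finset.range J).filter fun j => 8 * γ j < α (j + 1) with hS
    have hγs : ∀ J, ∑ j ∈ Finset.range J, γ j + α J = α 0 := by
      intro J
      induction J with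
      | zero => simp
      | succ J ih => rw [Finset.sum_range_succ, ← ih, hαγ J]; ring
    have h1 := card_rpow_le_sum_rpow S γ hp
      (fun i hi => (hband i (Finset.mem_filter.1 hi).2).1) (by
        refine (Finset.sum_le_sum_of_subset_of_nonneg (Finset.filter_subset _ _)
          fun i _ _ => hγ0 i).trans ?_
        linarith [hγs J, hα0 J, hanti 0])
    have h2 : ENNReal.ofReal (c * ∑ i ∈ S, γ i ^ (1 - p)) ≤
        ENNReal.ofReal (2 * (jumpEnergy p g).toReal) := by
      rw [Finset.mul_sum, ENNReal.ofReal_sum_of_nonneg, ENNReal.ofReal_mul (by norm_num),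
        ENNReal.ofReal_toReal hE]
      · calc _ ≤ ∑ i ∈ S, (e i + e (i + 1)) :=
              Finset.sum_le_sum fun i hi => (hband i (Finset.mem_filter.1 hi).2).2
          _ ≤ ∑ i ∈ Finset.range J, (e i + e (i + 1)) :=
              Finset.sum_le_sum_of_subset (Finset.filter_subset _ _)
          _ ≤ jumpEnergy p g + jumpEnergy p g := by
              rw [Finset.sum_add_distrib]
              refine add_le_add (hesum J) (le_trans ?_ (hesum (J + 1)))
              rw [Finset.sum_range_succ']
              exact le_self_add
          _ = _ := by simp [two_mul]
      · exact fun i _ => mul_nonneg hc0.le (Real.rpow_nonneg (hγ0 i) _)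
    rw [ENNReal.ofReal_le_ofReal_iff (by positivity)] at h2
    rw [div_mul_eq_mul_div, le_div_iff₀ hc0]
    nlinarith
  have hsum : ∀ J, ∑ j ∈ Finset.range J, ENNReal.ofReal (((j : ℝ) + 1) ^ p * γ j) ≤
      ENNReal.ofReal (C * (1 + 2 / c)) * (jumpEnergy p g + 1) := by
    intro J
    rw [← ENNReal.ofReal_sum_of_nonneg fun j _ => mul_nonneg (by positivity) (hγ0 j)]
    rw [← ENNReal.ofReal_toReal hE, ← ENNReal.ofReal_one,
      ← ENNReal.ofReal_add ENNReal.toReal_nonneg zero_le_one, ← ENNReal.ofReal_mul (by positivity)]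
    refine ENNReal.ofReal_le_ofReal ((hCJ α γ hα0 hγ0 hαγ (by linarith [hanti 0]) J).trans ?_)
    rw [mul_assoc]
    refine mul_le_mul_of_nonneg_left ?_ hC.le
    have := hn J
    have h2 : (0 : ℝ) ≤ (jumpEnergy p g).toReal := ENNReal.toReal_nonneg
    have h3 : 0 < 2 / c := by positivity
    nlinarith
  calc ∫⁻ s in Set.Ioc 0 1, ENNReal.ofReal (max (g s) 0 ^ p)
      ≤ ∫⁻ s in {s | g s ≤ 0} ∪ ⋃ j, (G j ∩ Set.Ioc 0 1), ENNReal.ofReal (max (g s) 0 ^ p) := by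
        refine lintegral_mono_set fun s hs => ?_
        rcases le_or_gt (g s) 0 with h | h
        · exact Or.inl h
        · right
          obtain ⟨n, hn⟩ : ∃ n : ℕ, ⌈g s⌉₊ = n + 1 :=
            Nat.exists_eq_succ_of_ne_zero (by simpa using (Nat.ceil_pos.2 h).ne')
          refine Set.mem_iUnion.2 ⟨n, ⟨?_, ?_⟩, hs⟩
          · exact Nat.lt_ceil.1 (by omega)
          · have := Nat.le_ceil (g s)
            rw [hn] at this
            exact_mod_cast this
    _ ≤ (∫⁻ s in {s | g s ≤ 0}, ENNReal.ofReal (max (g s) 0 ^ p)) +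
          ∫⁻ s in ⋃ j, (G j ∩ Set.Ioc 0 1), ENNReal.ofReal (max (g s) 0 ^ p) :=
        lintegral_union_le _ _ _
    _ ≤ 0 + ∑' j : ℕ, ENNReal.ofReal (((j : ℝ) + 1) ^ p * γ j) := by
        refine add_le_add (le_of_eq ?_) ((lintegral_iUnion_le _ _).trans
          (ENNReal.tsum_le_tsum fun j => ?_))
        · refine (setLIntegral_congr_fun (measurableSet_le hg measurable_const)
            (g := fun _ => 0) fun s hs => ?_).trans (by simp)
          have : g s ≤ 0 := hs
          simp [max_eq_right this, Real.zero_rpow hp0.ne']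
        · calc _ ≤ ∫⁻ s in G j ∩ Set.Ioc 0 1, ENNReal.ofReal (((j : ℝ) + 1) ^ p) := by
                refine setLIntegral_mono' ((mG j).inter measurableSet_Ioc) fun s hs => ?_
                refine ENNReal.ofReal_le_ofReal (Real.rpow_le_rpow (by positivity) ?_ hp0.le)
                exact max_le hs.1.2 (by positivity)
            _ = _ := by
                rw [setLIntegral_const, ENNReal.ofReal_mul (by positivity), ← ofReal_measureReal
                  (volume_window_ne_top (G j) 0 1)]
                rfl
    _ ≤ _ := by
        rw [zero_add]
        exact ENNReal.tsum_le_of_sum_range_le hsum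

/-- The least integer at which the distribution function reaches `1/2`. An error of one unit in the
median is harmless, since it is of the size of the threshold. -/
lemma exists_approx_median {g : ℝ → ℝ} (hg : Measurable g) :
    ∃ m : ℝ, 1 / 2 ≤ windowLength {s | g s ≤ m} 0 1 ∧
      1 / 2 ≤ windowLength {s | m - 1 ≤ g s} 0 1 := by
  set μ : Measure ℝ := volume.restrict (Set.Ioc (0 : ℝ) 1)
  have hμ : IsProbabilityMeasure μ := ⟨by simp [μ]⟩
  have hν : IsProbabilityMeasure (μ.map g) := Measure.isProbabilityMeasure_map hg.aemeasurable
  have hF : ∀ a, ProbabilityTheory.cdf (μ.map g) a = windowLength {s | g s ≤ a} 0 1 := by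
    intro a
    rw [ProbabilityTheory.cdf_eq_real, map_measureReal_apply hg measurableSet_Iic,
      measureReal_restrict_apply (hg measurableSet_Iic)]
    rfl
  obtain ⟨b, hb⟩ := ((ProbabilityTheory.tendsto_cdf_atBot (μ.map g)).eventually
    (gt_mem_nhds (by norm_num : (0 : ℝ) < 1 / 2))).exists
  obtain ⟨c, hc⟩ := ((ProbabilityTheory.tendsto_cdf_atTop (μ.map g)).eventually
    (lt_mem_nhds (by norm_num : (1 / 2 : ℝ) < 1))).exists
  have hmono := ProbabilityTheory.monotone_cdf (μ.map g)
  obtain ⟨m, hm, hleast⟩ := Int.exists_least_of_bdd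
    (P := fun z : ℤ => 1 / 2 ≤ ProbabilityTheory.cdf (μ.map g) (z : ℝ))
    ⟨⌊b⌋, fun z hz => by
      by_contra! h
      have h1 : (z : ℝ) ≤ b := (by exact_mod_cast h.le : (z : ℝ) ≤ (⌊b⌋ : ℤ)).trans
        (Int.floor_le b)
      linarith [hmono h1]⟩
    ⟨⌈c⌉, hc.le.trans (hmono (Int.le_ceil c))⟩
  refine ⟨m, by rw [← hF]; exact hm, ?_⟩
  have h1 : ProbabilityTheory.cdf (μ.map g) ((m : ℝ) - 1) < 1 / 2 := by
    by_contra! h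
    have := hleast (m - 1) (by push_cast; exact h)
    omega
  rw [hF] at h1
  have h2 : windowLength {s | g s ≤ (m : ℝ) - 1} 0 1 + windowLength {s | (m : ℝ) - 1 < g s} 0 1 =
      1 := by
    have h3 := windowLength_univ (zero_le_one (α := ℝ))
    rw [sub_zero] at h3
    rw [← h3, ← windowLength_union (measurableSet_lt measurable_const hg)]
    · congr 1
      ext s
      simp only [Set.mem_union, Set.mem_ofPred_eq, Set.mem_univ, iff_true]
      exact le_or_gt _ _
    · rw [Set.disjoint_left]
      intro s
      simp only [Set.mem_ofPred_eq]
      grind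
  have h4 : windowLength {s | (m : ℝ) - 1 < g s} 0 1 ≤ windowLength {s | (m : ℝ) - 1 ≤ g s} 0 1 :=
    measureReal_mono (Set.inter_subset_inter_left _ fun s (hs : (m : ℝ) - 1 < g s) => hs.le)
      (volume_window_ne_top _ _ _)
  linarith

lemma jumpEnergy_congr {p : ℝ} {g h : ℝ → ℝ} (H : ∀ s t, |g s - g t| = |h s - h t|) :
    jumpEnergy p g = jumpEnergy p h := by
  simp only [jumpEnergy, jumpKernel, Set.indicator, Set.mem_ofPred_eq, H]

/-- The Poincaré inequality on the unit interval for the energy of jumps. -/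
lemma exists_poincare_unitInterval (p : ℝ) (hp : 1 ≤ p) :
    ∃ C : ℝ, 0 < C ∧ ∀ g : ℝ → ℝ, Measurable g →
      ∫⁻ s in Set.Ioc 0 1, ∫⁻ t in Set.Ioc 0 1, ENNReal.ofReal (|g s - g t| ^ p) ≤
        ENNReal.ofReal C * (jumpEnergy p g + 1) := by
  obtain ⟨C, hC, hpos⟩ := exists_lintegral_posPart_le p hp
  have hp0 : 0 ≤ p := by linarith
  refine ⟨2 * 2 ^ p * (2 ^ p * (2 ^ p * (2 * C) + 1)), by positivity, fun g hg => ?_⟩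
  obtain ⟨m, hm1, hm2⟩ := exists_approx_median hg
  set A : ℝ → ℝ := fun s => max (g s - m) 0 with hA
  set B : ℝ → ℝ := fun s => max (m - 1 - g s) 0 with hB
  have hA0 : ∀ s, 0 ≤ A s := fun s => le_max_right _ _
  have hB0 : ∀ s, 0 ≤ B s := fun s => le_max_right _ _
  have mA : Measurable A := by fun_prop
  have mB : Measurable B := by fun_prop
  -- `A` and `B` are the tails above `m` and below `m - 1`; the summand `1` covers the gap between
  -- them.
  set h : ℝ → ℝ := fun s => A s + B s + 1 with hh
  have mh : Measurable h := by fun_prop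
  have hh0 : ∀ s, 0 ≤ h s := fun s => by have := hA0 s; have := hB0 s; simp only [hh]; linarith
  have hgm : ∀ s, |g s - m| ≤ h s := by
    intro s
    have h1 := le_max_left (g s - m) 0
    have h2 := le_max_left (m - 1 - g s) 0
    have h3 := hA0 s
    have h4 := hB0 s
    simp only [hA, hB, hh] at *
    rw [abs_le]
    constructor <;> linarith
  have hAi : ∫⁻ s in Set.Ioc 0 1, ENNReal.ofReal (A s ^ p) ≤
      ENNReal.ofReal C * (jumpEnergy p g + 1) := by
    have := hpos (fun s => g s - m) (by fun_prop) (by simpa using hm1)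
    rwa [jumpEnergy_congr (h := g) (by intro s t; congr 1; ring)] at this
  have hBi : ∫⁻ s in Set.Ioc 0 1, ENNReal.ofReal (B s ^ p) ≤
      ENNReal.ofReal C * (jumpEnergy p g + 1) := by
    have := hpos (fun s => m - 1 - g s) (by fun_prop) (by
      have h1 : {s | m - 1 - g s ≤ 0} = {s | m - 1 ≤ g s} := by ext s; simp
      rwa [h1])
    rwa [jumpEnergy_congr (h := g) (by intro s t; rw [abs_sub_comm]; congr 1; ring)] at this
  have hone : ∫⁻ _ in Set.Ioc (0 : ℝ) 1, (1 : ℝ≥0∞) = 1 := by simp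
  have hhi : ∫⁻ s in Set.Ioc 0 1, ENNReal.ofReal (h s ^ p) ≤
      ENNReal.ofReal (2 ^ p * (2 ^ p * (2 * C) + 1)) * (jumpEnergy p g + 1) := by
    calc _ ≤ ∫⁻ s in Set.Ioc 0 1, (ENNReal.ofReal (2 ^ p) * (ENNReal.ofReal (2 ^ p) *
          (ENNReal.ofReal (A s ^ p) + ENNReal.ofReal (B s ^ p)) + 1)) := by
          refine lintegral_mono fun s => ?_
          have hAp := Real.rpow_nonneg (hA0 s) p
          have hBp := Real.rpow_nonneg (hB0 s) p
          rw [← ENNReal.ofReal_add hAp hBp, ← ENNReal.ofReal_mul (by positivity),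
            ← ENNReal.ofReal_one, ← ENNReal.ofReal_add (by positivity) zero_le_one,
            ← ENNReal.ofReal_mul (by positivity)]
          refine ENNReal.ofReal_le_ofReal ?_
          have h1 := add_rpow_le_two_rpow_mul (add_nonneg (hA0 s) (hB0 s)) zero_le_one hp0
          have h2 := add_rpow_le_two_rpow_mul (hA0 s) (hB0 s) hp0
          rw [Real.one_rpow] at h1
          exact h1.trans (by gcongr)
      _ = ENNReal.ofReal (2 ^ p) * (ENNReal.ofReal (2 ^ p) *
          ((∫⁻ s in Set.Ioc 0 1, ENNReal.ofReal (A s ^ p)) +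
            ∫⁻ s in Set.Ioc 0 1, ENNReal.ofReal (B s ^ p)) + 1) := by
          rw [lintegral_const_mul _ (by fun_prop), lintegral_add_left (by fun_prop), hone,
            lintegral_const_mul _ (by fun_prop), lintegral_add_left (by fun_prop)]
      _ ≤ ENNReal.ofReal (2 ^ p) * (ENNReal.ofReal (2 ^ p) *
          (ENNReal.ofReal C * (jumpEnergy p g + 1) + ENNReal.ofReal C * (jumpEnergy p g + 1)) +
            (jumpEnergy p g + 1)) := by
          gcongr
          exact le_add_self
      _ = _ := by
          rw [ENNReal.ofReal_mul (by positivity), ENNReal.ofReal_add (by positivity) (by norm_num),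
            ENNReal.ofReal_mul (by positivity), ENNReal.ofReal_mul (by positivity : (0:ℝ) ≤ 2)]
          simp
          ring
  calc _ ≤ ∫⁻ s in Set.Ioc 0 1, ∫⁻ t in Set.Ioc 0 1,
        ENNReal.ofReal (2 ^ p) * (ENNReal.ofReal (h s ^ p) + ENNReal.ofReal (h t ^ p)) := by
        refine lintegral_mono fun s => lintegral_mono fun t => ?_
        have h1 := Real.rpow_nonneg (hh0 s) p
        have h2 := Real.rpow_nonneg (hh0 t) p
        rw [← ENNReal.ofReal_add h1 h2, ← ENNReal.ofReal_mul (by positivity)]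
        refine ENNReal.ofReal_le_ofReal (le_trans (Real.rpow_le_rpow (abs_nonneg _) ?_ hp0)
          (add_rpow_le_two_rpow_mul (hh0 s) (hh0 t) hp0))
        have h3 := abs_sub_le (g s) m (g t)
        rw [abs_sub_comm m] at h3
        linarith [hgm s, hgm t]
    _ = ENNReal.ofReal (2 ^ p) * ((∫⁻ s in Set.Ioc 0 1, ENNReal.ofReal (h s ^ p)) +
          ∫⁻ s in Set.Ioc 0 1, ENNReal.ofReal (h s ^ p)) := by
        have h1 : ∀ s, ∫⁻ t in Set.Ioc 0 1,
            ENNReal.ofReal (2 ^ p) * (ENNReal.ofReal (h s ^ p) + ENNReal.ofReal (h t ^ p)) =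
            ENNReal.ofReal (2 ^ p) * (ENNReal.ofReal (h s ^ p) +
              ∫⁻ t in Set.Ioc 0 1, ENNReal.ofReal (h t ^ p)) := by
          intro s
          rw [lintegral_const_mul _ (by fun_prop), lintegral_add_left (by fun_prop)]
          simp
        simp only [h1]
        rw [lintegral_const_mul _ (by fun_prop), lintegral_add_left (by fun_prop)]
        simp
    _ ≤ ENNReal.ofReal (2 ^ p) *
        (ENNReal.ofReal (2 ^ p * (2 ^ p * (2 * C) + 1)) * (jumpEnergy p g + 1) +
        ENNReal.ofReal (2 ^ p * (2 ^ p * (2 * C) + 1)) * (jumpEnergy p g + 1)) := by gcongr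
    _ = _ := by
        generalize 2 ^ p * (2 ^ p * (2 * C) + 1) = D
        rw [ENNReal.ofReal_mul (by positivity : (0 : ℝ) ≤ 2 * 2 ^ p),
          ENNReal.ofReal_mul (zero_le_two (α := ℝ))]
        simp
        ring

/-! ### From segments to balls -/

/-- The pair of points at parameters `w.1` and `w.2` of the segment from `z.1` to `z.2`. -/
noncomputable def segmentPair {d : ℕ} (w : ℝ × ℝ)
    (z : EuclideanSpace ℝ (Fin d) × EuclideanSpace ℝ (Fin d)) :
    EuclideanSpace ℝ (Fin d) × EuclideanSpace ℝ (Fin d) :=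
  (z.1 + w.1 • (z.2 - z.1), z.1 + w.2 • (z.2 - z.1))

/-- In the variables `x` and `h = y - x`, translating `x` by `w.1 • h` leaves only the dilation of
`h` by `w.2 - w.1`, whose Jacobian is `|w.1 - w.2| ^ d`. -/
lemma lintegral_comp_segmentPair {d : ℕ} {w : ℝ × ℝ} (hw : w.1 ≠ w.2)
    {F : EuclideanSpace ℝ (Fin d) × EuclideanSpace ℝ (Fin d) → ℝ≥0∞} (hF : Measurable F) :
    ∫⁻ z, F (segmentPair w z) = ENNReal.ofReal ((|w.1 - w.2| ^ d)⁻¹) * ∫⁻ z, F z := by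
  have hne : w.2 - w.1 ≠ 0 := sub_ne_zero.2 hw.symm
  have hscale : ∀ x : EuclideanSpace ℝ (Fin d), ∫⁻ h, F (x, x + (w.2 - w.1) • h) =
      ENNReal.ofReal ((|w.1 - w.2| ^ d)⁻¹) * ∫⁻ y, F (x, y) := by
    intro x
    have h1 : ∫⁻ h, F (x, x + (w.2 - w.1) • h) =
        ∫⁻ h, F (x, x + h) ∂(Measure.map ((w.2 - w.1) • ·) volume) := by
      rw [lintegral_map (by fun_prop) (by fun_prop)]
    rw [h1, Measure.map_addHaar_smul _ hne, lintegral_smul_measure, finrank_euclideanSpace_fin,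
      abs_inv, abs_pow, abs_sub_comm, smul_eq_mul]
    congr 1
    simp_rw [add_comm x]
    exact lintegral_add_right_eq_self (fun y => F (x, y)) x
  calc ∫⁻ z, F (segmentPair w z)
      = ∫⁻ x, ∫⁻ y, F (x + w.1 • (y - x), x + w.2 • (y - x)) := by
        rw [Measure.volume_eq_prod, lintegral_prod]
        · rfl
        · unfold segmentPair; fun_prop
    _ = ∫⁻ x, ∫⁻ h, F (x + w.1 • h, x + w.2 • h) := by
        refine lintegral_congr fun x => ?_
        exact lintegral_sub_right_eq_self (fun h => F (x + w.1 • h, x + w.2 • h)) x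
    _ = ∫⁻ h, ∫⁻ x, F (x + w.1 • h, x + w.2 • h) :=
        lintegral_lintegral_swap (by unfold Function.uncurry; fun_prop)
    _ = ∫⁻ h, ∫⁻ x, F (x, x + (w.2 - w.1) • h) := by
        refine lintegral_congr fun h => ?_
        rw [← lintegral_add_right_eq_self (fun x => F (x, x + (w.2 - w.1) • h)) (w.1 • h)]
        refine lintegral_congr fun x => ?_
        congr 2
        module
    _ = ∫⁻ x, ∫⁻ h, F (x, x + (w.2 - w.1) • h) :=
        lintegral_lintegral_swap (by unfold Function.uncurry; fun_prop)
    _ = ENNReal.ofReal ((|w.1 - w.2| ^ d)⁻¹) * ∫⁻ x, ∫⁻ y, F (x, y) := by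
        simp_rw [hscale]
        rw [lintegral_const_mul _ hF.lintegral_prod_right']
    _ = _ := by rw [Measure.volume_eq_prod, lintegral_prod _ hF.aemeasurable]

lemma lintegral_abs_rpow_tail_le {q τ : ℝ} (hq : 0 < q) (hτ : 0 < τ) :
    ∫⁻ t in {t : ℝ | τ ≤ |t|}, ENNReal.ofReal (|t| ^ (-(1 + q))) ≤
      ENNReal.ofReal (2 / q * τ ^ (-q)) := by
  have hpos : ∫⁻ t in Set.Ici τ, ENNReal.ofReal (|t| ^ (-(1 + q))) =
      ENNReal.ofReal (1 / q * τ ^ (-q)) := by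
    rw [setLIntegral_congr (Ioi_ae_eq_Ici (a := τ)).symm]
    rw [setLIntegral_congr_fun measurableSet_Ioi
      (g := fun t => ENNReal.ofReal (t ^ (-(1 + q)))) (by
        intro t ht
        simp only
        rw [abs_of_pos (hτ.trans ht)])]
    rw [← ofReal_integral_eq_lintegral_ofReal (integrableOn_Ioi_rpow_of_lt (by linarith) hτ)]
    · rw [integral_Ioi_rpow_of_lt (by linarith) hτ]
      congr 1
      rw [show -(1 + q) + 1 = -q by ring]
      field_simp
    · filter_upwards [ae_restrict_mem measurableSet_Ioi] with t ht
      exact Real.rpow_nonneg (hτ.trans ht).le _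
  have hneg : ∫⁻ t in Set.Iic (-τ), ENNReal.ofReal (|t| ^ (-(1 + q))) =
      ENNReal.ofReal (1 / q * τ ^ (-q)) := by
    rw [← hpos, ← lintegral_indicator measurableSet_Iic, ← lintegral_indicator measurableSet_Ici,
      ← lintegral_neg_eq_self]
    refine lintegral_congr fun t => ?_
    simp [Set.indicator]
  have hset : {t : ℝ | τ ≤ |t|} ⊆ Set.Ici τ ∪ Set.Iic (-τ) := by
    intro t ht
    rcases le_abs.1 (show τ ≤ |t| from ht) with h | h
    · exact Or.inl h
    · exact Or.inr (by simp only [Set.mem_Iic]; linarith)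
  refine (lintegral_mono_set hset).trans ((lintegral_union_le _ _ _).trans ?_)
  rw [hpos, hneg, ← ENNReal.ofReal_add (by positivity) (by positivity)]
  exact ENNReal.ofReal_le_ofReal (by ring_nf; rfl)

/-- For fixed `s`, enlarge the `t`-interval to the whole line and translate by `s`. With `q = d + p`
this turns the kernel in the parameters into the kernel in space. -/
lemma lintegral_unitSquare_tail_le {q τ : ℝ} (hq : 0 < q) (hτ : 0 < τ) :
    ∫⁻ w in Set.Ioc (0 : ℝ) 1 ×ˢ Set.Ioc (0 : ℝ) 1, {w : ℝ × ℝ | τ ≤ |w.1 - w.2|}.indicator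
      (fun w => ENNReal.ofReal (|w.1 - w.2| ^ (-(1 + q)))) w ≤
      ENNReal.ofReal (2 / q * τ ^ (-q)) := by
  have hm : Measurable ({w : ℝ × ℝ | τ ≤ |w.1 - w.2|}.indicator
      (fun w => ENNReal.ofReal (|w.1 - w.2| ^ (-(1 + q))))) :=
    Measurable.indicator (by fun_prop) (measurableSet_le measurable_const (by fun_prop))
  rw [Measure.volume_eq_prod, setLIntegral_prod _ hm.aemeasurable]
  calc _ ≤ ∫⁻ _ in Set.Ioc (0 : ℝ) 1, ENNReal.ofReal (2 / q * τ ^ (-q)) := by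
        refine lintegral_mono fun s => ?_
        refine (setLIntegral_le_lintegral _ _).trans ?_
        refine le_trans (le_of_eq ?_) (lintegral_abs_rpow_tail_le hq hτ)
        rw [← lintegral_indicator (measurableSet_le measurable_const (by fun_prop)),
          ← lintegral_sub_right_eq_self (fun t => {t : ℝ | τ ≤ |t|}.indicator
            (fun t => ENNReal.ofReal (|t| ^ (-(1 + q)))) t) s]
        refine lintegral_congr fun t => ?_
        simp only [Set.indicator, Set.mem_ofPred_eq, abs_sub_comm s]
    _ = _ := by simp

/-- The parameters are within `1/8` of the endpoints and at least `3/4` apart, so `‖y - x‖ < 8/3 *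
ρ` and each endpoint is moved by at most `ρ / 3`. -/
lemma mem_ball_of_segmentPair {d : ℕ} {c : EuclideanSpace ℝ (Fin d)} {ρ : ℝ} {w : ℝ × ℝ}
    (hw : w ∈ Set.Ioc (0 : ℝ) (1 / 8) ×ˢ Set.Ioc (7 / 8 : ℝ) 1)
    {z : EuclideanSpace ℝ (Fin d) × EuclideanSpace ℝ (Fin d)}
    (h : segmentPair w z ∈ Metric.ball c ρ ×ˢ Metric.ball c ρ) :
    z ∈ Metric.ball c (3 / 2 * ρ) ×ˢ Metric.ball c (3 / 2 * ρ) := by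
  obtain ⟨⟨h1, h2⟩, h3, h4⟩ := hw
  obtain ⟨h5, h6⟩ := h
  simp only [segmentPair, mem_ball_iff_norm] at h5 h6
  set x := z.1
  set y := z.2
  set X := x + w.1 • (y - x) with hX
  set Y := x + w.2 • (y - x) with hY
  have hXY : Y - X = (w.2 - w.1) • (y - x) := by rw [hX, hY]; module
  have hd : (3 / 4) * ‖y - x‖ ≤ ‖Y - X‖ := by
    rw [hXY, norm_smul, Real.norm_eq_abs]
    gcongr
    rw [le_abs]
    left; linarith
  have hYX : ‖Y - X‖ < 2 * ρ := by
    have : Y - X = (Y - c) - (X - c) := by abel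
    rw [this]
    linarith [norm_sub_le (Y - c) (X - c)]
  have hn := norm_nonneg (y - x)
  constructor
  · rw [mem_ball_iff_norm]
    have : x - c = (X - c) - w.1 • (y - x) := by rw [hX]; module
    calc ‖x - c‖ ≤ ‖X - c‖ + ‖w.1 • (y - x)‖ := by rw [this]; exact norm_sub_le _ _
      _ < _ := by
        rw [norm_smul, Real.norm_eq_abs, abs_of_pos h1]
        nlinarith
  · rw [mem_ball_iff_norm]
    have : y - c = (Y - c) + (1 - w.2) • (y - x) := by rw [hY]; module
    calc ‖y - c‖ ≤ ‖Y - c‖ + ‖(1 - w.2) • (y - x)‖ := by rw [this]; exact norm_add_le _ _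
      _ < _ := by
        rw [norm_smul, Real.norm_eq_abs, abs_of_nonneg (by linarith)]
        nlinarith

lemma segmentPair_mem_ball {d : ℕ} {c : EuclideanSpace ℝ (Fin d)} {ρ : ℝ} {w : ℝ × ℝ}
    (hw : w ∈ Set.Ioc (0 : ℝ) 1 ×ˢ Set.Ioc (0 : ℝ) 1)
    {z : EuclideanSpace ℝ (Fin d) × EuclideanSpace ℝ (Fin d)}
    (h : z ∈ Metric.ball c ρ ×ˢ Metric.ball c ρ) :
    (segmentPair w z).1 ∈ Metric.ball c ρ ∧
      ‖(segmentPair w z).1 - (segmentPair w z).2‖ ≤ 2 * ρ * |w.1 - w.2| := by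
  obtain ⟨⟨h1, h2⟩, h3, h4⟩ := hw
  constructor
  · exact (convex_ball c ρ).add_smul_sub_mem h.1 h.2 ⟨h1.le, h2⟩
  · have h5 := h.1
    have h6 := h.2
    rw [mem_ball_iff_norm] at h5 h6
    have : (segmentPair w z).1 - (segmentPair w z).2 = (w.1 - w.2) • ((z.2 - c) - (z.1 - c)) := by
      simp only [segmentPair]; module
    rw [this, norm_smul, Real.norm_eq_abs, mul_comm]
    gcongr
    linarith [norm_sub_le (z.2 - c) (z.1 - c)]

lemma exists_poincare_unitSquare (p : ℝ) (hp : 1 ≤ p) :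
    ∃ C : ℝ, 0 < C ∧ ∀ g : ℝ → ℝ, Measurable g →
      ∫⁻ w in Set.Ioc (0 : ℝ) 1 ×ˢ Set.Ioc (0 : ℝ) 1, ENNReal.ofReal (|g w.1 - g w.2| ^ p) ≤
        ENNReal.ofReal C *
          ((∫⁻ w in Set.Ioc (0 : ℝ) 1 ×ˢ Set.Ioc (0 : ℝ) 1, jumpKernel p g w.1 w.2) + 1) := by
  obtain ⟨C, hC, h⟩ := exists_poincare_unitInterval p hp
  refine ⟨C, hC, fun g hg => ?_⟩
  have := h g hg
  rw [jumpEnergy] at this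
  rwa [Measure.volume_eq_prod, setLIntegral_prod _ (by fun_prop),
    setLIntegral_prod _ (measurable_jumpKernel p hg).aemeasurable]

/-- For each `w` in a square of area `1/64`, a pair in the ball is a `segmentPair` of two endpoints
in the larger ball, with inverse Jacobian at least one. Averaging over that square, then enlarging
it to the unit square, puts the pairs on full segments, where the inequality on the interval
applies. -/
lemma lintegral_ball_le_of_square {d : ℕ} {p : ℝ} {u : EuclideanSpace ℝ (Fin d) → ℝ}
    (hu : Measurable u) (c : EuclideanSpace ℝ (Fin d)) (ρ : ℝ) :
    (∫⁻ z in Metric.ball c ρ ×ˢ Metric.ball c ρ, ENNReal.ofReal (|u z.1 - u z.2| ^ p)) ≤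
      64 * ∫⁻ w in Set.Ioc (0 : ℝ) 1 ×ˢ Set.Ioc (0 : ℝ) 1,
        ∫⁻ z in Metric.ball c (3 / 2 * ρ) ×ˢ Metric.ball c (3 / 2 * ρ),
          ENNReal.ofReal (|u (segmentPair w z).1 - u (segmentPair w z).2| ^ p) := by
  set P := ∫⁻ z in Metric.ball c ρ ×ˢ Metric.ball c ρ, ENNReal.ofReal (|u z.1 - u z.2| ^ p)
    with hP
  have mb : MeasurableSet (Metric.ball c ρ ×ˢ Metric.ball c ρ) :=
    measurableSet_ball.prod measurableSet_ball
  have mB : MeasurableSet (Metric.ball c (3 / 2 * ρ) ×ˢ Metric.ball c (3 / 2 * ρ)) :=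
    measurableSet_ball.prod measurableSet_ball
  have mS : MeasurableSet (Set.Ioc (0 : ℝ) (1 / 8) ×ˢ Set.Ioc (7 / 8 : ℝ) 1) :=
    measurableSet_Ioc.prod measurableSet_Ioc
  have hmP : Measurable ((Metric.ball c ρ ×ˢ Metric.ball c ρ).indicator
      fun z => ENNReal.ofReal (|u z.1 - u z.2| ^ p)) := Measurable.indicator (by fun_prop) mb
  have hw : ∀ w ∈ Set.Ioc (0 : ℝ) (1 / 8) ×ˢ Set.Ioc (7 / 8 : ℝ) 1,
      P ≤ ∫⁻ z in Metric.ball c (3 / 2 * ρ) ×ˢ Metric.ball c (3 / 2 * ρ),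
          ENNReal.ofReal (|u (segmentPair w z).1 - u (segmentPair w z).2| ^ p) := by
    intro w hw
    have h1 : 3 / 4 < |w.1 - w.2| := by
      rw [lt_abs]; right; linarith [hw.1.2, hw.2.1]
    have h2 : |w.1 - w.2| ≤ 1 := by
      rw [abs_le]; constructor <;> linarith [hw.1.1, hw.1.2, hw.2.1, hw.2.2]
    have h3 : w.1 ≠ w.2 := by
      intro h; rw [h, sub_self, abs_zero] at h1; linarith
    have h4 := lintegral_comp_segmentPair h3 hmP
    rw [lintegral_indicator mb, ← hP] at h4
    have h5 : P ≤ ENNReal.ofReal ((|w.1 - w.2| ^ d)⁻¹) * P := by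
      refine le_mul_of_one_le_left zero_le ?_
      rw [ENNReal.one_le_ofReal]
      exact (one_le_inv₀ (by positivity)).2 (pow_le_one₀ (by positivity) h2)
    refine h5.trans (h4.symm.le.trans ?_)
    rw [← lintegral_indicator mB]
    refine lintegral_mono fun z => ?_
    by_cases hz : segmentPair w z ∈ Metric.ball c ρ ×ˢ Metric.ball c ρ
    · rw [Set.indicator_of_mem hz, Set.indicator_of_mem (mem_ball_of_segmentPair hw hz)]
    · rw [Set.indicator_of_notMem hz]
      exact zero_le
  have hvol : volume (Set.Ioc (0 : ℝ) (1 / 8) ×ˢ Set.Ioc (7 / 8 : ℝ) 1) =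
      ENNReal.ofReal (1 / 64) := by
    rw [Measure.volume_eq_prod, Measure.prod_prod, Real.volume_Ioc, Real.volume_Ioc,
      ← ENNReal.ofReal_mul (by norm_num)]
    norm_num
  calc P = 64 * (∫⁻ _ in Set.Ioc (0 : ℝ) (1 / 8) ×ˢ Set.Ioc (7 / 8 : ℝ) 1, P) := by
        rw [setLIntegral_const, hvol, mul_comm P, ← mul_assoc,
          show (64 : ℝ≥0∞) = ENNReal.ofReal 64 by simp, ← ENNReal.ofReal_mul (by norm_num)]
        norm_num
    _ ≤ 64 * ∫⁻ w in Set.Ioc (0 : ℝ) (1 / 8) ×ˢ Set.Ioc (7 / 8 : ℝ) 1,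
        ∫⁻ z in Metric.ball c (3 / 2 * ρ) ×ˢ Metric.ball c (3 / 2 * ρ),
          ENNReal.ofReal (|u (segmentPair w z).1 - u (segmentPair w z).2| ^ p) := by
        gcongr 64 * ?_
        exact setLIntegral_mono' mS hw
    _ ≤ _ := by
        gcongr 64 * ?_
        refine lintegral_mono_set (Set.prod_mono ?_ ?_)
        · exact Set.Ioc_subset_Ioc le_rfl (by norm_num)
        · exact Set.Ioc_subset_Ioc (by norm_num) le_rfl

/-- The Jacobian `|w.1 - w.2| ^ (-d)` raises the kernel exponent from `1 + p` to `1 + (d + p)`. The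
endpoints are at most `2 * ρ` apart, so the two points of the segment are within `2 * ρ * |w.1 -
w.2|`: this is the cutoff in `w` that makes the later `w`-integral finite. -/
lemma lintegral_jumpKernel_segment_le {d : ℕ} {p : ℝ} {u : EuclideanSpace ℝ (Fin d) → ℝ}
    (hu : Measurable u) (c : EuclideanSpace ℝ (Fin d)) (ρ : ℝ) {w : ℝ × ℝ}
    (hw : w ∈ Set.Ioc (0 : ℝ) 1 ×ˢ Set.Ioc (0 : ℝ) 1) :
    ∫⁻ z in Metric.ball c ρ ×ˢ Metric.ball c ρ,
        jumpKernel p (fun s => u (z.1 + s • (z.2 - z.1))) w.1 w.2 ≤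
      ∫⁻ z, {z : EuclideanSpace ℝ (Fin d) × EuclideanSpace ℝ (Fin d) |
        z.1 ∈ Metric.ball c ρ ∧ 1 < |u z.1 - u z.2|}.indicator
        (fun z => {w : ℝ × ℝ | ‖z.1 - z.2‖ / (2 * ρ) ≤ |w.1 - w.2|}.indicator
          (fun w => ENNReal.ofReal (|w.1 - w.2| ^ (-(1 + ((d : ℝ) + p))))) w) z := by
  have mB : MeasurableSet (Metric.ball c ρ ×ˢ Metric.ball c ρ) :=
    measurableSet_ball.prod measurableSet_ball
  rcases eq_or_ne w.1 w.2 with h | h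
  · have : ∀ z : EuclideanSpace ℝ (Fin d) × EuclideanSpace ℝ (Fin d),
        jumpKernel p (fun s => u (z.1 + s • (z.2 - z.1))) w.1 w.2 = 0 := by
      intro z
      rw [jumpKernel, Set.indicator_of_notMem]
      simp only [Set.mem_ofPred_eq, h, sub_self, abs_zero]
      norm_num
    simp [this]
  have ha : 0 < |w.1 - w.2| := abs_pos.2 (sub_ne_zero.2 h)
  set S := {z : EuclideanSpace ℝ (Fin d) × EuclideanSpace ℝ (Fin d) |
    (z.1 ∈ Metric.ball c ρ ∧ 1 < |u z.1 - u z.2|) ∧ ‖z.1 - z.2‖ / (2 * ρ) ≤ |w.1 - w.2|} with hS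
  have mj : MeasurableSet {z : EuclideanSpace ℝ (Fin d) × EuclideanSpace ℝ (Fin d) |
      1 < |u z.1 - u z.2|} := measurableSet_lt measurable_const (by fun_prop)
  have mn : MeasurableSet {z : EuclideanSpace ℝ (Fin d) × EuclideanSpace ℝ (Fin d) |
      ‖z.1 - z.2‖ / (2 * ρ) ≤ |w.1 - w.2|} := measurableSet_le (by fun_prop) measurable_const
  have mS : MeasurableSet S := ((measurable_fst measurableSet_ball).inter mj).inter mn
  have hF : Measurable (S.indicator fun _ => ENNReal.ofReal (|w.1 - w.2| ^ (-(1 + p)))) :=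
    Measurable.indicator measurable_const mS
  have h1 := lintegral_comp_segmentPair h hF
  calc _ ≤ ∫⁻ z, S.indicator (fun _ => ENNReal.ofReal (|w.1 - w.2| ^ (-(1 + p))))
        (segmentPair w z) := by
        rw [← lintegral_indicator mB]
        refine lintegral_mono fun z => ?_
        by_cases hz : z ∈ Metric.ball c ρ ×ˢ Metric.ball c ρ
        · rw [Set.indicator_of_mem hz, jumpKernel]
          by_cases hj : 1 < |u (z.1 + w.1 • (z.2 - z.1)) - u (z.1 + w.2 • (z.2 - z.1))|
          · have h2 := segmentPair_mem_ball hw hz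
            have hρ : 0 < ρ := Metric.pos_of_mem_ball hz.1
            have h3 : segmentPair w z ∈ S := by
              refine ⟨⟨h2.1, hj⟩, ?_⟩
              rw [div_le_iff₀ (by positivity)]
              linarith [h2.2]
            rw [Set.indicator_of_mem h3, Set.indicator_of_mem (by exact hj)]
          · rw [Set.indicator_of_notMem (by exact hj)]
            exact zero_le
        · rw [Set.indicator_of_notMem hz]
          exact zero_le
    _ = _ := h1
    _ = ∫⁻ z, S.indicator (fun _ => ENNReal.ofReal (|w.1 - w.2| ^ (-(1 + ((d : ℝ) + p))))) z := by
        rw [lintegral_indicator mS, lintegral_indicator mS, setLIntegral_const,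
          setLIntegral_const, ← mul_assoc, ← ENNReal.ofReal_mul (by positivity),
          ← Real.rpow_natCast, ← Real.rpow_neg ha.le, ← Real.rpow_add ha]
        congr 3
        ring
    _ = _ := by
        refine lintegral_congr fun z => ?_
        have hmem : z ∈ S ↔ (z.1 ∈ Metric.ball c ρ ∧ 1 < |u z.1 - u z.2|) ∧
          ‖z.1 - z.2‖ / (2 * ρ) ≤ |w.1 - w.2| := Iff.rfl
        simp only [Set.indicator, Set.mem_ofPred_eq]
        split_ifs <;> first | rfl | (exfalso; tauto)

/-- The Poincaré inequality on balls for the nonlocal energy of jumps larger than one. -/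
lemma exists_poincare_ball (d : ℕ) (p : ℝ) (hp : 1 ≤ p) :
    ∃ C : ℝ, 0 < C ∧ ∀ u : EuclideanSpace ℝ (Fin d) → ℝ, Measurable u →
      ∀ (c : EuclideanSpace ℝ (Fin d)) (ρ : ℝ), 0 < ρ →
      ∫⁻ z in Metric.ball c ρ ×ˢ Metric.ball c ρ, ENNReal.ofReal (|u z.1 - u z.2| ^ p) ≤
        ENNReal.ofReal C * (ENNReal.ofReal (ρ ^ ((d : ℝ) + p)) *
          (∫⁻ x in Metric.ball c (3 / 2 * ρ), ∫⁻ y in {y | 1 < |u x - u y|},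
            ENNReal.ofReal (1 ^ p / ‖x - y‖ ^ ((d : ℝ) + p))) + ENNReal.ofReal (ρ ^ (2 * d))) := by
  obtain ⟨C, hC, h1D⟩ := exists_poincare_unitSquare p hp
  set q : ℝ := (d : ℝ) + p with hq
  have hq0 : 0 < q := by positivity
  set κ : ℝ := (volume (Metric.ball (0 : EuclideanSpace ℝ (Fin d)) 1)).toReal with hκ
  set C' : ℝ := 2 / q * 3 ^ q + (3 / 2) ^ (2 * d) * κ ^ 2 with hC'
  have hκ0 : 0 ≤ κ := ENNReal.toReal_nonneg
  have hC'0 : 0 < C' := by positivity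
  refine ⟨64 * (C * C'), by positivity, fun u hu c ρ hρ => ?_⟩
  set I := Set.Ioc (0 : ℝ) 1 ×ˢ Set.Ioc (0 : ℝ) 1 with hI
  set B := Metric.ball c (3 / 2 * ρ) ×ˢ Metric.ball c (3 / 2 * ρ) with hB
  set J := ∫⁻ x in Metric.ball c (3 / 2 * ρ), ∫⁻ y in {y | 1 < |u x - u y|},
    ENNReal.ofReal (1 ^ p / ‖x - y‖ ^ q) with hJ
  have mI : MeasurableSet I := measurableSet_Ioc.prod measurableSet_Ioc
  have mB : MeasurableSet B := measurableSet_ball.prod measurableSet_ball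
  have hvolB : volume B = ENNReal.ofReal ((3 / 2) ^ (2 * d) * κ ^ 2 * ρ ^ (2 * d)) := by
    have h1 : volume (Metric.ball c (3 / 2 * ρ)) = ENNReal.ofReal ((3 / 2 * ρ) ^ d * κ) := by
      rw [Measure.addHaar_ball_of_pos _ _ (by positivity), finrank_euclideanSpace_fin,
        ENNReal.ofReal_mul (by positivity), hκ, ENNReal.ofReal_toReal measure_ball_lt_top.ne]
    rw [hB, Measure.volume_eq_prod, Measure.prod_prod, h1, ← ENNReal.ofReal_mul (by positivity)]
    congr 1
    rw [two_mul, pow_add, pow_add, mul_pow]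
    ring
  -- the energy of the slices
  have hjump : ∫⁻ w in I, ∫⁻ z in B, jumpKernel p (fun s => u (z.1 + s • (z.2 - z.1))) w.1 w.2 ≤
      ENNReal.ofReal (2 / q * 3 ^ q) * (ENNReal.ofReal (ρ ^ q) * J) := by
    set S : Set (EuclideanSpace ℝ (Fin d) × EuclideanSpace ℝ (Fin d)) :=
      {z | z.1 ∈ Metric.ball c (3 / 2 * ρ) ∧ 1 < |u z.1 - u z.2|} with hS
    have mj : MeasurableSet {z : EuclideanSpace ℝ (Fin d) × EuclideanSpace ℝ (Fin d) |
        1 < |u z.1 - u z.2|} := measurableSet_lt measurable_const (by fun_prop)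
    have mS : MeasurableSet S := (measurable_fst measurableSet_ball).inter mj
    set T : Set ((ℝ × ℝ) × (EuclideanSpace ℝ (Fin d) × EuclideanSpace ℝ (Fin d))) :=
      {x | ‖x.2.1 - x.2.2‖ / (2 * (3 / 2 * ρ)) ≤ |x.1.1 - x.1.2|} with hT
    have mT : MeasurableSet T := measurableSet_le (by fun_prop) (by fun_prop)
    have hm : Measurable fun x : (ℝ × ℝ) × (EuclideanSpace ℝ (Fin d) × EuclideanSpace ℝ (Fin d)) =>
        S.indicator (fun z => {w : ℝ × ℝ | ‖z.1 - z.2‖ / (2 * (3 / 2 * ρ)) ≤ |w.1 - w.2|}.indicator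
          (fun w => ENNReal.ofReal (|w.1 - w.2| ^ (-(1 + q)))) x.1) x.2 := by
      have : Measurable (((Prod.snd ⁻¹' S) ∩ T).indicator fun x =>
          ENNReal.ofReal (|x.1.1 - x.1.2| ^ (-(1 + q)))) :=
        Measurable.indicator (by fun_prop) ((measurable_snd mS).inter mT)
      convert! this using 1
      ext x
      have hmem : x ∈ Prod.snd ⁻¹' S ∩ T ↔ x.2 ∈ S ∧
        ‖x.2.1 - x.2.2‖ / (2 * (3 / 2 * ρ)) ≤ |x.1.1 - x.1.2| := Iff.rfl
      simp only [Set.indicator, Set.mem_ofPred_eq]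
      split_ifs <;> first | rfl | (exfalso; tauto)
    calc _ ≤ ∫⁻ w in I, ∫⁻ z, S.indicator
          (fun z => {w : ℝ × ℝ | ‖z.1 - z.2‖ / (2 * (3 / 2 * ρ)) ≤ |w.1 - w.2|}.indicator
          (fun w => ENNReal.ofReal (|w.1 - w.2| ^ (-(1 + q)))) w) z :=
          setLIntegral_mono' mI fun w hw => lintegral_jumpKernel_segment_le hu c _ hw
      _ = ∫⁻ z, ∫⁻ w in I, S.indicator
          (fun z => {w : ℝ × ℝ | ‖z.1 - z.2‖ / (2 * (3 / 2 * ρ)) ≤ |w.1 - w.2|}.indicator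
          (fun w => ENNReal.ofReal (|w.1 - w.2| ^ (-(1 + q)))) w) z :=
          lintegral_lintegral_swap hm.aemeasurable
      _ ≤ ∫⁻ z, S.indicator (fun z => ENNReal.ofReal (2 / q * 3 ^ q * ρ ^ q) *
          ENNReal.ofReal (1 ^ p / ‖z.1 - z.2‖ ^ q)) z := by
          -- Integrating in `w` first, with cutoff `τ = ‖z.1 - z.2‖ / (3 * ρ)`, yields `τ ^ (-q)`,
          -- that is, the spatial kernel times `(3 * ρ) ^ q`.
          refine lintegral_mono fun z => ?_
          by_cases hz : z ∈ S
          · simp only [Set.indicator_of_mem hz]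
            have hne : 0 < ‖z.1 - z.2‖ := by
              rw [norm_pos_iff, sub_ne_zero]
              intro h
              have := hz.2
              rw [h, sub_self, abs_zero] at this
              linarith
            refine (lintegral_unitSquare_tail_le hq0 (by positivity)).trans (le_of_eq ?_)
            rw [← ENNReal.ofReal_mul (by positivity)]
            congr 1
            rw [show 2 * (3 / 2 * ρ) = 3 * ρ by ring, Real.div_rpow hne.le (by positivity),
              Real.mul_rpow (by norm_num) hρ.le, Real.rpow_neg hne.le, Real.rpow_neg hρ.le,
              Real.rpow_neg (by norm_num), Real.one_rpow]
            field_simp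
          · simp only [Set.indicator_of_notMem hz]
            simp
      _ = ENNReal.ofReal (2 / q * 3 ^ q * ρ ^ q) *
          ∫⁻ z, S.indicator (fun z => ENNReal.ofReal (1 ^ p / ‖z.1 - z.2‖ ^ q)) z := by
          rw [lintegral_indicator mS, lintegral_indicator mS, lintegral_const_mul _ (by fun_prop)]
      _ = ENNReal.ofReal (2 / q * 3 ^ q * ρ ^ q) * J := by
          congr 1
          rw [Measure.volume_eq_prod, lintegral_prod _
            (Measurable.indicator (by fun_prop) mS).aemeasurable, hJ,
            ← lintegral_indicator measurableSet_ball]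
          refine lintegral_congr fun x => ?_
          by_cases hx : x ∈ Metric.ball c (3 / 2 * ρ)
          · rw [Set.indicator_of_mem hx, ← lintegral_indicator
              (measurableSet_lt measurable_const (by fun_prop))]
            refine lintegral_congr fun y => ?_
            simp only [Set.indicator, hS, Set.mem_ofPred_eq, hx, true_and]
          · have hn : ∀ y, (x, y) ∉ S := fun y hy => hx hy.1
            simp only [Set.indicator, hn, hx, if_false, lintegral_zero]
      _ = _ := by
          rw [ENNReal.ofReal_mul (by positivity), mul_assoc]
  have hswap1 : ∫⁻ w in I, ∫⁻ z in B,
        ENNReal.ofReal (|u (segmentPair w z).1 - u (segmentPair w z).2| ^ p) =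
      ∫⁻ z in B, ∫⁻ w in I,
        ENNReal.ofReal (|u (segmentPair w z).1 - u (segmentPair w z).2| ^ p) := by
    refine lintegral_lintegral_swap ?_
    unfold Function.uncurry segmentPair
    fun_prop
  have hmj : Measurable fun x : (EuclideanSpace ℝ (Fin d) × EuclideanSpace ℝ (Fin d)) × (ℝ × ℝ) =>
      jumpKernel p (fun s => u (x.1.1 + s • (x.1.2 - x.1.1))) x.2.1 x.2.2 := by
    unfold jumpKernel
    have : Measurable ({x : (EuclideanSpace ℝ (Fin d) × EuclideanSpace ℝ (Fin d)) × (ℝ × ℝ) |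
        1 < |u (x.1.1 + x.2.1 • (x.1.2 - x.1.1)) - u (x.1.1 + x.2.2 • (x.1.2 - x.1.1))|}.indicator
        fun x => ENNReal.ofReal (|x.2.1 - x.2.2| ^ (-(1 + p)))) :=
      Measurable.indicator (by fun_prop) (measurableSet_lt measurable_const (by fun_prop))
    exact this
  have hswap2 : ∫⁻ z in B, ∫⁻ w in I,
        jumpKernel p (fun s => u (z.1 + s • (z.2 - z.1))) w.1 w.2 =
      ∫⁻ w in I, ∫⁻ z in B, jumpKernel p (fun s => u (z.1 + s • (z.2 - z.1))) w.1 w.2 :=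
    lintegral_lintegral_swap hmj.aemeasurable
  calc _ ≤ _ := lintegral_ball_le_of_square hu c ρ
    _ = 64 * ∫⁻ z in B, ∫⁻ w in I,
        ENNReal.ofReal (|u (segmentPair w z).1 - u (segmentPair w z).2| ^ p) := by rw [hswap1]
    _ ≤ 64 * ∫⁻ z in B, ENNReal.ofReal C *
        ((∫⁻ w in I, jumpKernel p (fun s => u (z.1 + s • (z.2 - z.1))) w.1 w.2) + 1) := by
        gcongr with z
        exact h1D (fun s => u (z.1 + s • (z.2 - z.1))) (by fun_prop)
    _ = 64 * (ENNReal.ofReal C * ((∫⁻ w in I, ∫⁻ z in B,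
          jumpKernel p (fun s => u (z.1 + s • (z.2 - z.1))) w.1 w.2) + volume B)) := by
        rw [lintegral_const_mul', lintegral_add_right _ measurable_const, hswap2]
        · simp
        · exact ENNReal.ofReal_ne_top
    _ ≤ 64 * (ENNReal.ofReal C * (ENNReal.ofReal (2 / q * 3 ^ q) * (ENNReal.ofReal (ρ ^ q) * J) +
          ENNReal.ofReal ((3 / 2) ^ (2 * d) * κ ^ 2) * ENNReal.ofReal (ρ ^ (2 * d)))) := by
        rw [hvolB, ← ENNReal.ofReal_mul (by positivity)]
        gcongr
    _ ≤ 64 * (ENNReal.ofReal C * (ENNReal.ofReal C' * (ENNReal.ofReal (ρ ^ q) * J) +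
          ENNReal.ofReal C' * ENNReal.ofReal (ρ ^ (2 * d)))) := by
        gcongr
        · simp only [hC']; linarith [show 0 ≤ (3 / 2 : ℝ) ^ (2 * d) * κ ^ 2 by positivity]
        · simp only [hC']; linarith [show 0 ≤ 2 / q * (3 : ℝ) ^ q by positivity]
    _ = _ := by
        rw [ENNReal.ofReal_mul (by norm_num), ENNReal.ofReal_mul hC.le]
        simp
        ring

/-! ### Discrete Hardy inequalities -/

/-- A sequence starting at zero and growing by at most a factor arbitrarily close to one, up to
an error: discrete Hardy inequality with geometric weights. -/
lemma exists_geometric_hardy (p ρ : ℝ) (hρ : 0 < ρ) (hρ1 : ρ < 1) :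
    ∃ C : ℝ, 0 < C ∧ ∀ m e : ℕ → ℝ, (∀ i, 0 ≤ m i) → m 0 = 0 →
      (∀ i, ∀ l : ℝ, 0 < l → l < 1 → m (i + 1) ≤ (1 - l) ^ (1 - p) * m i + l ^ (1 - p) * e i) →
      ∀ n, ∑ i ∈ Finset.range n, ρ ^ i * m i ≤ C * ∑ i ∈ Finset.range n, ρ ^ i * e i := by
  -- As `l` tends to `0`, the ratio `ρ * (1 - l) ^ (1 - p)` tends to `ρ < 1`, so one fixed `l` keeps
  -- it below `(1 + ρ) / 2`. The sum of the `m` terms is then absorbed into the left-hand side.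
  obtain ⟨l, hl0, hl1, hl⟩ : ∃ l : ℝ, 0 < l ∧ l < 1 ∧ ρ * (1 - l) ^ (1 - p) < (1 + ρ) / 2 := by
    have hc : ContinuousAt (fun l : ℝ => ρ * (1 - l) ^ (1 - p)) 0 := by
      refine continuousAt_const.mul (ContinuousAt.rpow_const (by fun_prop) (Or.inl (by norm_num)))
    have h1 : ∀ᶠ l in 𝓝 (0 : ℝ), ρ * (1 - l) ^ (1 - p) < (1 + ρ) / 2 := by
      refine hc.eventually (gt_mem_nhds ?_)
      simp only [sub_zero, Real.one_rpow, mul_one]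
      linarith
    obtain ⟨ε, hε, h2⟩ := Metric.eventually_nhds_iff.1 h1
    refine ⟨min (ε / 2) (1 / 2), by positivity, ?_, h2 ?_⟩
    · exact (min_le_right _ _).trans_lt (by norm_num)
    · rw [Real.dist_0_eq_abs, abs_of_pos (by positivity)]
      exact (min_le_left _ _).trans_lt (by linarith)
  set a := (1 - l) ^ (1 - p)
  have hb : 0 < l ^ (1 - p) := by positivity
  set b := l ^ (1 - p)
  refine ⟨2 * ρ * b / (1 - ρ), div_pos (by positivity) (by linarith),
    fun m e hm hm0 h n => ?_⟩
  set S := ∑ i ∈ Finset.range n, ρ ^ i * m i with hS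
  set E := ∑ i ∈ Finset.range n, ρ ^ i * e i with hE
  have hS0 : 0 ≤ S := Finset.sum_nonneg fun i _ => mul_nonneg (by positivity) (hm i)
  have h1 : S ≤ ∑ i ∈ Finset.range n, ρ ^ (i + 1) * m (i + 1) := by
    have h2 := Finset.sum_range_succ (fun i => ρ ^ i * m i) n
    have h3 := Finset.sum_range_succ' (fun i => ρ ^ i * m i) n
    simp only [hm0, mul_zero, add_zero] at h3
    have : 0 ≤ ρ ^ n * m n := mul_nonneg (by positivity) (hm n)
    linarith
  have h2 : ∑ i ∈ Finset.range n, ρ ^ (i + 1) * m (i + 1) ≤ ρ * a * S + ρ * b * E := by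
    rw [hS, hE, Finset.mul_sum, Finset.mul_sum, ← Finset.sum_add_distrib]
    refine Finset.sum_le_sum fun i _ => ?_
    calc ρ ^ (i + 1) * m (i + 1) ≤ ρ ^ (i + 1) * (a * m i + b * e i) :=
          mul_le_mul_of_nonneg_left (h i l hl0 hl1) (by positivity)
      _ = _ := by ring
  have h3 : ρ * a * S ≤ (1 + ρ) / 2 * S := mul_le_mul_of_nonneg_right hl.le hS0
  rw [div_mul_eq_mul_div, le_div_iff₀ (by linarith)]
  nlinarith

/-- The gap `x ^ (-p) / 3` is what pays for each term of the critical Hardy sum. After factoring out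
`x ^ (-p)` the claim is `x ^ 2 ≤ (x - 1/3) * (x + 1/2)`, which holds exactly from `x = 1` on when
`x` is positive. -/
lemma rpow_add_half_le {p x : ℝ} (hp : 2 ≤ p) (hx : 1 ≤ x) :
    (x + 1 / 2) ^ (1 - p) ≤ x ^ (1 - p) - x ^ (-p) / 3 := by
  have hx0 : 0 < x := by linarith
  have h1 : (x + 1 / 2) ^ (1 - p) = (x + 1 / 2) ^ (2 - p) / (x + 1 / 2) := by
    rw [← Real.rpow_sub_one (by positivity)]
    congr 1; ring
  have h2 : (x + 1 / 2) ^ (2 - p) ≤ x ^ (2 - p) :=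
    Real.rpow_le_rpow_of_nonpos hx0 (by linarith) (by linarith)
  have h3 : x ^ (2 - p) = x ^ (-p) * x ^ 2 := by
    rw [← Real.rpow_natCast, ← Real.rpow_add hx0]
    congr 1; push_cast; ring
  have h4 : x ^ (1 - p) = x ^ (-p) * x := by
    rw [← Real.rpow_add_one hx0.ne']
    congr 1; ring
  have h5 : 0 < x ^ (-p) := by positivity
  rw [h1, div_le_iff₀ (by positivity), h4]
  refine h2.trans ?_
  rw [h3]
  nlinarith

/-- Discrete Hardy inequality in the critical case. -/
lemma critical_hardy {p : ℝ} (hp : 2 ≤ p) {m e : ℕ → ℝ} (hm : ∀ i, 0 ≤ m i) (hm0 : m 0 = 0)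
    (h : ∀ i, ∀ l : ℝ, 0 < l → l < 1 →
      m (i + 1) ≤ (1 - l) ^ (1 - p) * m i + l ^ (1 - p) * e i) (n : ℕ) :
    ∑ i ∈ Finset.range (n + 1), ((i : ℝ) + 1) ^ (-p) * m (i + 1) ≤
      3 * 2 ^ (p - 1) * ∑ i ∈ Finset.range (n + 1), e i := by
  have hstep : ∀ i : ℕ, ((i : ℝ) + 1) ^ (1 - p) * m (i + 1) ≤
      ((i : ℝ) + 1 / 2) ^ (1 - p) * m i + 2 ^ (p - 1) * e i := by
    intro i
    have hi : (0 : ℝ) < (i : ℝ) + 1 := by positivity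
    -- With this `l`, `(i + 1) * (1 - l) = i + 1/2` and `(i + 1) * l = 1/2`: the weights telescope
    -- up to a gain, while the error coefficient does not depend on `i`.
    have h1 := h i (1 / (2 * ((i : ℝ) + 1))) (by positivity) (by
      rw [div_lt_one (by positivity)]
      have : (0 : ℝ) ≤ i := by positivity
      linarith)
    have e1 : ((i : ℝ) + 1) ^ (1 - p) * (1 - 1 / (2 * ((i : ℝ) + 1))) ^ (1 - p) =
        ((i : ℝ) + 1 / 2) ^ (1 - p) := by
      rw [← Real.mul_rpow hi.le]
      · congr 1
        field_simp
        ring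
      · rw [sub_nonneg, div_le_one (by positivity)]
        have : (0 : ℝ) ≤ i := by positivity
        linarith
    have e2 : ((i : ℝ) + 1) ^ (1 - p) * (1 / (2 * ((i : ℝ) + 1))) ^ (1 - p) = 2 ^ (p - 1) := by
      rw [← Real.mul_rpow hi.le (by positivity)]
      rw [show ((i : ℝ) + 1) * (1 / (2 * ((i : ℝ) + 1))) = 2⁻¹ by field_simp]
      rw [Real.inv_rpow (by norm_num), ← Real.rpow_neg (by norm_num)]
      congr 1; ring
    calc _ ≤ ((i : ℝ) + 1) ^ (1 - p) * ((1 - 1 / (2 * ((i : ℝ) + 1))) ^ (1 - p) * m i +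
          (1 / (2 * ((i : ℝ) + 1))) ^ (1 - p) * e i) :=
          mul_le_mul_of_nonneg_left h1 (by positivity)
      _ = _ := by rw [mul_add, ← mul_assoc, e1, ← mul_assoc, e2]
  have hpot : ∀ n : ℕ, ((n : ℝ) + 1) ^ (1 - p) * m (n + 1) +
      (1 / 3) * ∑ i ∈ Finset.range n, ((i : ℝ) + 1) ^ (-p) * m (i + 1) ≤
      2 ^ (p - 1) * ∑ i ∈ Finset.range (n + 1), e i := by
    intro n
    induction n with
    | zero =>
      have := hstep 0
      rw [hm0] at this
      simpa using this
    | succ n ih =>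
      have h1 := hstep (n + 1)
      have h2 := mul_le_mul_of_nonneg_right
        (rpow_add_half_le hp (x := (n : ℝ) + 1) (by linarith [n.cast_nonneg (α := ℝ)]))
        (hm (n + 1))
      rw [Finset.sum_range_succ, Finset.sum_range_succ _ (n + 1)]
      push_cast at h1 ⊢
      linarith
  have h1 := hpot n
  rw [Finset.sum_range_succ]
  have h2 : ((n : ℝ) + 1) ^ (-p) * m (n + 1) ≤ ((n : ℝ) + 1) ^ (1 - p) * m (n + 1) := by
    refine mul_le_mul_of_nonneg_right ?_ (hm _)
    exact Real.rpow_le_rpow_of_exponent_le (by linarith [n.cast_nonneg (α := ℝ)]) (by linarith)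
  have h3 : 0 ≤ ((n : ℝ) + 1) ^ (1 - p) * m (n + 1) := mul_nonneg (by positivity) (hm _)
  linarith

/-- Convexity applied to `|b| / (1 - l)` and `|a - b| / l` with weights `1 - l` and `l`. The factor
on `|b| ^ p` can be made as close to one as desired, so that losses do not accumulate along a chain
of scales. -/
lemma abs_rpow_le_convex {p l : ℝ} (hp : 1 ≤ p) (hl0 : 0 < l) (hl1 : l < 1) (a b : ℝ) :
    |a| ^ p ≤ (1 - l) ^ (1 - p) * |b| ^ p + l ^ (1 - p) * |a - b| ^ p := by
  have hl : 0 < 1 - l := by linarith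
  have h1 := (convexOn_rpow hp).2 (x := |b| / (1 - l)) (y := |a - b| / l)
    (by simp only [Set.mem_Ici]; positivity) (by simp only [Set.mem_Ici]; positivity)
    hl.le hl0.le (by ring)
  simp only [smul_eq_mul] at h1
  rw [mul_div_cancel₀ _ hl.ne', mul_div_cancel₀ _ hl0.ne',
    Real.div_rpow (abs_nonneg _) hl.le, Real.div_rpow (abs_nonneg _) hl0.le] at h1
  have h2 : |a| ≤ |b| + |a - b| := by
    have := abs_add_le b (a - b)
    rwa [add_sub_cancel] at this
  refine (Real.rpow_le_rpow (abs_nonneg _) h2 (by linarith)).trans (h1.trans (le_of_eq ?_))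
  rw [Real.rpow_sub hl, Real.rpow_sub hl0, Real.rpow_one, Real.rpow_one]
  ring

lemma lintegral_biUnion_finset_le {α ι : Type*} [MeasurableSpace α] {μ : Measure α}
    (s : Finset ι) (A : ι → Set α) (f : α → ℝ≥0∞) :
    ∫⁻ x in ⋃ i ∈ s, A i, f x ∂μ ≤ ∑ i ∈ s, ∫⁻ x in A i, f x ∂μ := by
  rw [← Finset.sum_coe_sort, ← tsum_fintype (L := .unconditional _)]
  refine le_trans (le_of_eq ?_) (lintegral_iUnion_le (fun i : s => A i) f)
  congr 2
  ext x
  simp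

/-! ### Shells, cone means and the comparison of neighbouring scales -/

/-- The dyadic shell `t ≤ ‖x‖ < 2t`. -/
def shell (d : ℕ) (t : ℝ) : Set (EuclideanSpace ℝ (Fin d)) := {x | t ≤ ‖x‖ ∧ ‖x‖ < 2 * t}

lemma measurableSet_shell (d : ℕ) (t : ℝ) : MeasurableSet (shell d t) :=
  (measurableSet_le measurable_const measurable_norm).inter
    (measurableSet_lt measurable_norm measurable_const)

/-- The part of the energy carried by the points of a neighbourhood of the shell of size `t`. -/
noncomputable def shellEnergy {d : ℕ} (p : ℝ) (u : EuclideanSpace ℝ (Fin d) → ℝ) (t : ℝ) :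
    ℝ≥0∞ :=
  ∫⁻ x in {x | t / 4 ≤ ‖x‖ ∧ ‖x‖ < 8 * t}, ∫⁻ y in {y | 1 < |u x - u y|},
    ENNReal.ofReal (1 ^ p / ‖x - y‖ ^ ((d : ℝ) + p))

lemma shellEnergy_le_Idelta {d : ℕ} (p : ℝ) (u : EuclideanSpace ℝ (Fin d) → ℝ) (t : ℝ) :
    shellEnergy p u t ≤ Idelta p 1 u := setLIntegral_le_lintegral _ _

/-- The normalized integral of `|u| ^ p` on the ball of radius `s / 8` centred at `s • z`. -/
noncomputable def coneMean {d : ℕ} (p : ℝ) (u : EuclideanSpace ℝ (Fin d) → ℝ)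
    (z : EuclideanSpace ℝ (Fin d)) (s : ℝ) : ℝ :=
  (∫⁻ x in Metric.ball (s • z) (s / 8), ENNReal.ofReal (|u x| ^ p)).toReal / s ^ d

lemma coneMean_nonneg {d : ℕ} (p : ℝ) (u : EuclideanSpace ℝ (Fin d) → ℝ)
    (z : EuclideanSpace ℝ (Fin d)) {s : ℝ} (hs : 0 ≤ s) : 0 ≤ coneMean p u z s :=
  div_nonneg ENNReal.toReal_nonneg (by positivity)

/-- Puts the balls of two neighbouring scales inside a single ball: the centre moves by at most `t *
‖z‖ / 2`, and the radius is at most `t / 4 ≤ t * ‖z‖ / 4`. -/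
lemma ball_subset_middle_ball {d : ℕ} {z : EuclideanSpace ℝ (Fin d)} (hz1 : 1 ≤ ‖z‖)
    {t s : ℝ} (hts : t ≤ s) (hst : s ≤ 2 * t) :
    Metric.ball (s • z) (s / 8) ⊆ Metric.ball ((3 / 2 * t) • z) (3 / 4 * t * ‖z‖) := by
  refine Metric.ball_subset_ball' ?_
  have ht : 0 ≤ t := by linarith
  rw [dist_eq_norm, ← sub_smul, norm_smul, Real.norm_eq_abs]
  have : |s - 3 / 2 * t| ≤ t / 2 := by
    rw [abs_le]; constructor <;> linarith
  nlinarith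

/-- Even enlarged by the `3/2` of the Poincaré inequality, the middle ball has radius `9/8 * t *
‖z‖`, less than the norm of its centre, so it stays away from the origin and the energy used is that
of an annulus. -/
lemma middle_ball_subset {d : ℕ} {z : EuclideanSpace ℝ (Fin d)} (hz1 : 1 ≤ ‖z‖) (hz2 : ‖z‖ ≤ 2)
    {t : ℝ} (ht : 0 < t) :
    Metric.ball ((3 / 2 * t) • z) (3 / 2 * (3 / 4 * t * ‖z‖)) ⊆
      {x | t / 4 ≤ ‖x‖ ∧ ‖x‖ < 8 * t} := by
  intro x hx
  rw [mem_ball_iff_norm] at hx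
  have h1 : ‖(3 / 2 * t) • z‖ = 3 / 2 * t * ‖z‖ := by
    rw [norm_smul, Real.norm_of_nonneg (by positivity)]
  have h2 := norm_sub_norm_le ((3 / 2 * t) • z) x
  have h3 := norm_sub_norm_le x ((3 / 2 * t) • z)
  rw [norm_sub_rev] at h2
  rw [h1] at h2 h3
  constructor <;> nlinarith

/-- Integrate `abs_rpow_le_convex` over the product of the two balls and bound the difference term
by Poincaré on the middle ball. Dividing `t ^ (d + p) * J + t ^ (2 * d)` by the volumes, of order `t
^ (2 * d)`, leaves `t ^ (p - d) * J + 1`. -/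
lemma exists_coneMean_step (d : ℕ) (p : ℝ) (hp : 1 ≤ p) :
    ∃ C : ℝ, 0 < C ∧ ∀ u : EuclideanSpace ℝ (Fin d) → ℝ, Measurable u →
      ∫⁻ x, ENNReal.ofReal (|u x| ^ p) ≠ ⊤ → Idelta p 1 u ≠ ⊤ →
      ∀ z : EuclideanSpace ℝ (Fin d), 1 ≤ ‖z‖ → ‖z‖ ≤ 2 → ∀ t s s' : ℝ, 0 < t →
      t ≤ s → s ≤ 2 * t → t ≤ s' → s' ≤ 2 * t → ∀ l : ℝ, 0 < l → l < 1 →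
      coneMean p u z s ≤ (1 - l) ^ (1 - p) * coneMean p u z s' +
        l ^ (1 - p) * (C * (t ^ (p - d) * (shellEnergy p u t).toReal + 1)) := by
  obtain ⟨C, hC, hball⟩ := exists_poincare_ball d p hp
  set κ : ℝ := (volume (Metric.ball (0 : EuclideanSpace ℝ (Fin d)) (1 / 8))).toReal with hκ
  have hκ0 : 0 < κ := ENNReal.toReal_pos (Metric.measure_ball_pos _ _ (by norm_num)).ne'
    measure_ball_lt_top.ne
  set A : ℝ := (3 / 2) ^ ((d : ℝ) + p) + (3 / 2) ^ (2 * d) with hA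
  have hA0 : 0 < A := by positivity
  refine ⟨C * A / κ, by positivity, ?_⟩
  intro u hu hfin hI z hz1 hz2 t s s' ht hts hst hts' hst' l hl0 hl1
  have hs : 0 < s := by linarith
  have hs' : 0 < s' := by linarith
  set B := Metric.ball (s • z) (s / 8) with hB
  set B' := Metric.ball (s' • z) (s' / 8) with hB'
  set U := ∫⁻ x in B, ENNReal.ofReal (|u x| ^ p) with hU
  set U' := ∫⁻ x in B', ENNReal.ofReal (|u x| ^ p) with hU'
  have hUf : U ≠ ⊤ := ((setLIntegral_le_lintegral _ _).trans_lt hfin.lt_top).ne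
  have hUf' : U' ≠ ⊤ := ((setLIntegral_le_lintegral _ _).trans_lt hfin.lt_top).ne
  have hJf : shellEnergy p u t ≠ ⊤ := ((shellEnergy_le_Idelta p u t).trans_lt hI.lt_top).ne
  set J := (shellEnergy p u t).toReal with hJ
  have hJ0 : 0 ≤ J := ENNReal.toReal_nonneg
  have hvol : ∀ (x : EuclideanSpace ℝ (Fin d)) (r : ℝ), 0 < r →
      volume (Metric.ball x (r / 8)) = ENNReal.ofReal (κ * r ^ d) := by
    intro x r hr
    rw [show r / 8 = r * (1 / 8) by ring, Measure.addHaar_ball_mul_of_pos _ _ hr,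
      finrank_euclideanSpace_fin, mul_comm κ, ENNReal.ofReal_mul (by positivity), hκ,
      ENNReal.ofReal_toReal measure_ball_lt_top.ne]
  have ha0 : 0 < (1 - l) ^ (1 - p) := Real.rpow_pos_of_pos (by linarith) _
  have hb0 : 0 < l ^ (1 - p) := by positivity
  have hconv := fun x y => abs_rpow_le_convex hp hl0 hl1 (u x) (u y)
  set a := (1 - l) ^ (1 - p)
  set b := l ^ (1 - p)
  set ρ := 3 / 4 * t * ‖z‖ with hρ
  have hρ0 : 0 < ρ := by positivity
  have hρt : ρ ≤ 3 / 2 * t := by rw [hρ]; nlinarith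
  set D := ∫⁻ w in B ×ˢ B', ENNReal.ofReal (|u w.1 - u w.2| ^ p) with hD
  have hDle : D ≤ ENNReal.ofReal (C * A * (t ^ ((d : ℝ) + p) * J + t ^ (2 * d))) := by
    calc D ≤ ∫⁻ w in Metric.ball ((3 / 2 * t) • z) ρ ×ˢ Metric.ball ((3 / 2 * t) • z) ρ,
          ENNReal.ofReal (|u w.1 - u w.2| ^ p) :=
          lintegral_mono_set (Set.prod_mono (ball_subset_middle_ball hz1 hts hst)
            (ball_subset_middle_ball hz1 hts' hst'))
      _ ≤ _ := hball u hu _ ρ hρ0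
      _ ≤ ENNReal.ofReal C * (ENNReal.ofReal (ρ ^ ((d : ℝ) + p)) * shellEnergy p u t +
            ENNReal.ofReal (ρ ^ (2 * d))) := by
          gcongr
          exact lintegral_mono_set (middle_ball_subset hz1 hz2 ht)
      _ = ENNReal.ofReal (C * (ρ ^ ((d : ℝ) + p) * J + ρ ^ (2 * d))) := by
          rw [ENNReal.ofReal_mul hC.le, ENNReal.ofReal_add (by positivity) (by positivity),
            ENNReal.ofReal_mul (by positivity), hJ, ENNReal.ofReal_toReal hJf]
      _ ≤ _ := by
          refine ENNReal.ofReal_le_ofReal ?_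
          rw [mul_assoc]
          refine mul_le_mul_of_nonneg_left ?_ hC.le
          have h1 : ρ ^ ((d : ℝ) + p) ≤ A * t ^ ((d : ℝ) + p) := by
            calc _ ≤ (3 / 2 * t) ^ ((d : ℝ) + p) :=
                  Real.rpow_le_rpow hρ0.le hρt (by positivity)
              _ = (3 / 2) ^ ((d : ℝ) + p) * t ^ ((d : ℝ) + p) :=
                  Real.mul_rpow (by norm_num) ht.le
              _ ≤ _ := by gcongr; rw [hA]; linarith [show (0 : ℝ) ≤ (3 / 2) ^ (2 * d) by positivity]
          have h2 : ρ ^ (2 * d) ≤ A * t ^ (2 * d) := by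
            calc _ ≤ (3 / 2 * t) ^ (2 * d) := by gcongr
              _ = (3 / 2) ^ (2 * d) * t ^ (2 * d) := mul_pow _ _ _
              _ ≤ _ := by
                gcongr; rw [hA]
                linarith [show (0 : ℝ) ≤ (3 / 2) ^ ((d : ℝ) + p) by positivity]
          calc _ ≤ A * t ^ ((d : ℝ) + p) * J + A * t ^ (2 * d) := by gcongr
            _ = _ := by ring
  have hmain : ENNReal.ofReal (κ * s' ^ d) * U ≤
      ENNReal.ofReal a * (ENNReal.ofReal (κ * s ^ d) * U') + ENNReal.ofReal b * D := by
    have mB : MeasurableSet B := measurableSet_ball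
    have mB' : MeasurableSet B' := measurableSet_ball
    have e1 : ∫⁻ w in B ×ˢ B', ENNReal.ofReal (|u w.1| ^ p) = ENNReal.ofReal (κ * s' ^ d) * U := by
      rw [Measure.volume_eq_prod, setLIntegral_prod _ (by fun_prop)]
      simp only [setLIntegral_const]
      rw [lintegral_mul_const _ (by fun_prop), hB', hvol _ _ hs', mul_comm]
    have e2 : ∫⁻ w in B ×ˢ B', ENNReal.ofReal (|u w.2| ^ p) = ENNReal.ofReal (κ * s ^ d) * U' := by
      rw [Measure.volume_eq_prod, setLIntegral_prod _ (by fun_prop)]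
      simp only [setLIntegral_const]
      rw [hB, hvol _ _ hs, mul_comm]
    rw [← e1, ← e2, hD, ← lintegral_const_mul _ (by fun_prop), ← lintegral_const_mul _ (by fun_prop),
      ← lintegral_add_left (by fun_prop)]
    refine lintegral_mono fun w => ?_
    rw [← ENNReal.ofReal_mul ha0.le, ← ENNReal.ofReal_mul hb0.le,
      ← ENNReal.ofReal_add (by positivity) (by positivity)]
    exact ENNReal.ofReal_le_ofReal (hconv w.1 w.2)
  have hreal : κ * s' ^ d * U.toReal ≤ a * (κ * s ^ d * U'.toReal) +
      b * (C * A * (t ^ ((d : ℝ) + p) * J + t ^ (2 * d))) := by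
    have h1 := hmain.trans (add_le_add_right (mul_le_mul_right hDle _) _)
    rw [← ENNReal.ofReal_toReal hUf, ← ENNReal.ofReal_toReal hUf',
      ← ENNReal.ofReal_mul (by positivity), ← ENNReal.ofReal_mul (by positivity),
      ← ENNReal.ofReal_mul (by positivity), ← ENNReal.ofReal_mul (by positivity),
      ← ENNReal.ofReal_add (by positivity) (by positivity),
      ENNReal.ofReal_le_ofReal_iff (by positivity)] at h1
    exact h1
  have ht2 : t ^ ((d : ℝ) + p) = t ^ (2 * d) * t ^ (p - d) := by
    rw [← Real.rpow_natCast, ← Real.rpow_add ht]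
    congr 1; push_cast; ring
  have hss : t ^ (2 * d) ≤ s ^ d * s' ^ d := by
    rw [two_mul, pow_add]
    gcongr
  rw [ht2] at hreal
  set e := t ^ (p - (d : ℝ)) * J + 1 with he
  have he0 : 0 ≤ e := by positivity
  have hreal2 : κ * s' ^ d * U.toReal ≤ a * (κ * s ^ d * U'.toReal) +
      b * (C * A * (s ^ d * s' ^ d * e)) := by
    refine hreal.trans ?_
    gcongr
    calc _ = t ^ (2 * d) * e := by rw [he]; ring
      _ ≤ _ := by gcongr
  have hP : 0 < κ * s ^ d * s' ^ d := by positivity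
  unfold coneMean
  rw [← mul_le_mul_iff_of_pos_left hP]
  calc _ = κ * s' ^ d * U.toReal := by
        change κ * s ^ d * s' ^ d * (U.toReal / s ^ d) = _
        field_simp
    _ ≤ _ := hreal2
    _ = _ := by
        change _ = κ * s ^ d * s' ^ d * (a * (U'.toReal / s' ^ d) + b * (C * A / κ * e))
        field_simp

/-- Scales any two of which differ by a factor at least two. -/
def IsLacunary (t : ℕ → ℝ) : Prop := ∀ i j, i < j → 2 * t i ≤ t j ∨ 2 * t j ≤ t i

lemma isLacunary_geometric {T b : ℝ} (hT : 0 < T) (hb : b = 2 ∨ b = 1 / 2) :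
    IsLacunary fun i => T * b ^ i := by
  intro i j hij
  obtain ⟨k, rfl⟩ := Nat.exists_eq_add_of_lt hij
  rcases hb with rfl | rfl
  · left
    have : (1 : ℝ) ≤ 2 ^ k := one_le_pow₀ (by norm_num)
    have h2 : 0 < T * 2 ^ i := by positivity
    calc 2 * (T * 2 ^ i) = T * 2 ^ i * 2 * 1 := by ring
      _ ≤ T * 2 ^ i * 2 * 2 ^ k := by gcongr
      _ = _ := by ring
  · right
    have : (1 / 2 : ℝ) ^ k ≤ 1 := pow_le_one₀ (by norm_num) (by norm_num)
    calc 2 * (T * (1 / 2) ^ (i + k + 1)) = T * (1 / 2) ^ i * (1 / 2) ^ k := by ring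
      _ ≤ T * (1 / 2) ^ i * 1 := by gcongr
      _ = _ := by ring

lemma sum_lintegral_shell_le {d : ℕ} {t : ℕ → ℝ} (ht : IsLacunary t)
    (F : EuclideanSpace ℝ (Fin d) → ℝ≥0∞) (n : ℕ) :
    ∑ i ∈ Finset.range n, ∫⁻ x in shell d (t i), F x ≤ ∫⁻ x, F x := by
  rw [← lintegral_biUnion_finset]
  · exact setLIntegral_le_lintegral _ _
  · intro i _ j _ hij
    rw [Function.onFun, Set.disjoint_left]
    rintro x ⟨h1, h2⟩ ⟨h3, h4⟩
    rcases lt_or_gt_of_ne hij with h | h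
    · rcases ht i j h with h5 | h5 <;> linarith
    · rcases ht j i h with h5 | h5 <;> linarith
  · exact fun i _ => measurableSet_shell d _

/-- The annulus from `t / 4` to `8 * t` consists of five dyadic shells. For each of the five
positions, the shells of a lacunary sequence are disjoint. -/
lemma sum_shellEnergy_le {d : ℕ} (p : ℝ) (u : EuclideanSpace ℝ (Fin d) → ℝ) {t : ℕ → ℝ}
    (ht : IsLacunary t) (n : ℕ) :
    ∑ i ∈ Finset.range n, shellEnergy p u (t i) ≤ 5 * Idelta p 1 u := by
  set F : EuclideanSpace ℝ (Fin d) → ℝ≥0∞ := fun x => ∫⁻ y in {y | 1 < |u x - u y|},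
    ENNReal.ofReal (1 ^ p / ‖x - y‖ ^ ((d : ℝ) + p))
  have hcover : ∀ r : ℝ, {x : EuclideanSpace ℝ (Fin d) | r / 4 ≤ ‖x‖ ∧ ‖x‖ < 8 * r} ⊆
      ⋃ k ∈ Finset.range 5, shell d (2 ^ k / 4 * r) := by
    rintro r x ⟨h1, h2⟩
    have : ∃ k < 5, 2 ^ k / 4 * r ≤ ‖x‖ ∧ ‖x‖ < 2 * (2 ^ k / 4 * r) := by
      by_contra! hno
      have h3 := hno 0 (by norm_num) (by linarith)
      have h4 := hno 1 (by norm_num) (by linarith)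
      have h5 := hno 2 (by norm_num) (by linarith)
      have h6 := hno 3 (by norm_num) (by linarith)
      have h7 := hno 4 (by norm_num) (by linarith)
      linarith
    obtain ⟨k, hk, h⟩ := this
    simp only [Set.mem_iUnion]
    exact ⟨k, Finset.mem_range.2 hk, h⟩
  have hscale : ∀ k : ℕ, IsLacunary fun i => (2 : ℝ) ^ k / 4 * t i := by
    intro k i j hij
    have : (0 : ℝ) < 2 ^ k / 4 := by positivity
    rcases ht i j hij with h | h
    · left; nlinarith
    · right; nlinarith
  calc _ ≤ ∑ i ∈ Finset.range n, ∑ k ∈ Finset.range 5, ∫⁻ x in shell d (2 ^ k / 4 * t i), F x := by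
        refine Finset.sum_le_sum fun i _ => ?_
        refine (lintegral_mono_set (hcover (t i))).trans 
          (lintegral_biUnion_finset_le _ _ _)
    _ = ∑ k ∈ Finset.range 5, ∑ i ∈ Finset.range n, ∫⁻ x in shell d (2 ^ k / 4 * t i), F x :=
        Finset.sum_comm
    _ ≤ ∑ k ∈ Finset.range 5, Idelta p 1 u :=
        Finset.sum_le_sum fun k _ => sum_lintegral_shell_le (hscale k) F n
    _ = _ := by simp

/-- Compactness of the closed annulus of radii `1` and `2`, then homogeneity: the same centres serve
every scale. -/
lemma exists_finite_cover_shell (d : ℕ) :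
    ∃ Z : Finset (EuclideanSpace ℝ (Fin d)), (∀ z ∈ Z, 1 ≤ ‖z‖ ∧ ‖z‖ ≤ 2) ∧
      ∀ t : ℝ, 0 < t → shell d t ⊆ ⋃ z ∈ Z, Metric.ball (t • z) (t / 8) := by
  have hK : IsCompact {x : EuclideanSpace ℝ (Fin d) | 1 ≤ ‖x‖ ∧ ‖x‖ ≤ 2} := by
    refine Metric.isCompact_of_isClosed_isBounded ?_ ?_
    · exact (isClosed_le continuous_const continuous_norm).inter
        (isClosed_le continuous_norm continuous_const)
    · exact (Metric.isBounded_closedBall (x := 0) (r := 2)).subset fun x hx => by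
        simpa using hx.2
  obtain ⟨Z, hZ, hfin, hcov⟩ := hK.finite_cover_balls (e := 1 / 8) (by norm_num)
  refine ⟨hfin.toFinset, fun z hz => hZ (hfin.mem_toFinset.1 hz), fun t ht x hx => ?_⟩
  have hy : t⁻¹ • x ∈ {x : EuclideanSpace ℝ (Fin d) | 1 ≤ ‖x‖ ∧ ‖x‖ ≤ 2} := by
    simp only [Set.mem_ofPred_eq, norm_smul, norm_inv, Real.norm_of_nonneg ht.le]
    rw [inv_mul_eq_div, le_div_iff₀ ht, div_le_iff₀ ht]
    exact ⟨by linarith [hx.1], hx.2.le⟩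
  have := hcov hy
  simp only [Set.mem_iUnion] at this ⊢
  obtain ⟨z, hz, hzx⟩ := this
  refine ⟨z, hfin.mem_toFinset.2 hz, ?_⟩
  rw [mem_ball_iff_norm] at hzx ⊢
  have h1 : x - t • z = t • (t⁻¹ • x - z) := by
    rw [smul_sub, smul_inv_smul₀ ht.ne']
  rw [h1, norm_smul, Real.norm_of_nonneg ht.le]
  nlinarith

lemma lintegral_le_tsum_coneMean {d : ℕ} {p : ℝ} {u : EuclideanSpace ℝ (Fin d) → ℝ}
    (hfin : ∫⁻ x, ENNReal.ofReal (|u x| ^ p) ≠ ⊤)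
    {Z : Finset (EuclideanSpace ℝ (Fin d))}
    (hZ : ∀ t : ℝ, 0 < t → shell d t ⊆ ⋃ z ∈ Z, Metric.ball (t • z) (t / 8))
    {ι : Type*} [Countable ι] {t w : ι → ℝ} (ht : ∀ i, 0 < t i) (hw : ∀ i, 0 ≤ w i)
    {S : Set (EuclideanSpace ℝ (Fin d))} (mS : MeasurableSet S) (hS : S ⊆ ⋃ i, shell d (t i))
    {F : EuclideanSpace ℝ (Fin d) → ℝ≥0∞}
    (hF : ∀ i, ∀ x ∈ S ∩ shell d (t i), F x ≤ ENNReal.ofReal (w i * |u x| ^ p)) :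
    ∫⁻ x in S, F x ≤ ∑' i, ENNReal.ofReal (w i * t i ^ d * ∑ z ∈ Z, coneMean p u z (t i)) := by
  have hS' : S ⊆ ⋃ i, S ∩ shell d (t i) := by
    rw [← Set.inter_iUnion]
    exact Set.subset_inter subset_rfl hS
  refine (lintegral_mono_set hS').trans ((lintegral_iUnion_le _ _).trans
    (ENNReal.tsum_le_tsum fun i => ?_))
  calc ∫⁻ x in S ∩ shell d (t i), F x
      ≤ ∫⁻ x in S ∩ shell d (t i), ENNReal.ofReal (w i * |u x| ^ p) :=
        setLIntegral_mono' (mS.inter (measurableSet_shell d _)) (hF i)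
    _ ≤ ∫⁻ x in ⋃ z ∈ Z, Metric.ball (t i • z) (t i / 8), ENNReal.ofReal (w i * |u x| ^ p) :=
        lintegral_mono_set (Set.inter_subset_right.trans (hZ _ (ht i)))
    _ ≤ ∑ z ∈ Z, ∫⁻ x in Metric.ball (t i • z) (t i / 8), ENNReal.ofReal (w i * |u x| ^ p) :=
        lintegral_biUnion_finset_le _ _ _
    _ = ∑ z ∈ Z, ENNReal.ofReal (w i * t i ^ d * coneMean p u z (t i)) := by
        refine Finset.sum_congr rfl fun z _ => ?_
        have hf : ∫⁻ x in Metric.ball (t i • z) (t i / 8), ENNReal.ofReal (|u x| ^ p) ≠ ⊤ :=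
          ((setLIntegral_le_lintegral _ _).trans_lt hfin.lt_top).ne
        simp only [ENNReal.ofReal_mul (hw i)]
        rw [lintegral_const_mul' _ _ ENNReal.ofReal_ne_top, mul_assoc,
          ENNReal.ofReal_mul (hw i), coneMean, mul_div_cancel₀ _ (pow_pos (ht i) d).ne',
          ENNReal.ofReal_toReal hf]
    _ = _ := by
        rw [Finset.mul_sum, ENNReal.ofReal_sum_of_nonneg]
        intro z _
        exact mul_nonneg (mul_nonneg (hw i) (pow_nonneg (ht i).le d))
          (coneMean_nonneg p u z (ht i).le)

/-! ### Summation over a chain of scales -/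

/-- The chain of comparisons between neighbouring scales of a geometric sequence. -/
lemma exists_scale_chain (d : ℕ) (p : ℝ) (hp : 1 ≤ p) :
    ∃ C : ℝ, 0 < C ∧ ∀ u : EuclideanSpace ℝ (Fin d) → ℝ, Measurable u →
      ∫⁻ x, ENNReal.ofReal (|u x| ^ p) ≠ ⊤ → Idelta p 1 u ≠ ⊤ →
      ∀ T b : ℝ, 0 < T → b = 2 ∨ b = 1 / 2 → ∃ τ : ℕ → ℝ,
        (∀ i, 0 < τ i ∧ τ i ≤ T * b ^ i ∧ T * b ^ i ≤ 2 * τ i) ∧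
        (∀ n, ∑ i ∈ Finset.range n, (shellEnergy p u (τ i)).toReal ≤
          5 * (Idelta p 1 u).toReal) ∧
        ∀ z : EuclideanSpace ℝ (Fin d), 1 ≤ ‖z‖ → ‖z‖ ≤ 2 → ∀ i, ∀ l : ℝ, 0 < l → l < 1 →
          coneMean p u z (T * b ^ (i + 1)) ≤ (1 - l) ^ (1 - p) * coneMean p u z (T * b ^ i) +
            l ^ (1 - p) * (C * ((τ i) ^ (p - d) * (shellEnergy p u (τ i)).toReal + 1)) := by
  obtain ⟨C, hC, hstep⟩ := exists_coneMean_step d p hp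
  refine ⟨C, hC, fun u hu hfin hI T b hT hb => ?_⟩
  have hsum : ∀ τ : ℕ → ℝ, IsLacunary τ → ∀ n,
      ∑ i ∈ Finset.range n, (shellEnergy p u (τ i)).toReal ≤ 5 * (Idelta p 1 u).toReal := by
    intro τ hτ n
    have hJf : ∀ i, shellEnergy p u (τ i) ≠ ⊤ := fun i =>
      ((shellEnergy_le_Idelta p u _).trans_lt hI.lt_top).ne
    rw [← ENNReal.toReal_sum fun i _ => hJf i]
    have h := ENNReal.toReal_mono (ENNReal.mul_ne_top (by norm_num) hI)
      (sum_shellEnergy_le p u hτ n)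
    simpa using h
  -- `τ i` is the smaller of the scales `T * b ^ i` and `T * b ^ (i + 1)`, so that both lie between
  -- `τ i` and `2 * τ i`.
  rcases hb with rfl | rfl
  · refine ⟨fun i => T * 2 ^ i, fun i => ?_, hsum _ (isLacunary_geometric hT (Or.inl rfl)), ?_⟩
    · have : 0 < T * 2 ^ i := by positivity
      exact ⟨this, le_rfl, by linarith⟩
    · intro z hz1 hz2 i l hl0 hl1
      have h0 : 0 < T * 2 ^ i := by positivity
      exact hstep u hu hfin hI z hz1 hz2 (T * 2 ^ i) _ _ h0 (by rw [pow_succ]; linarith)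
        (by rw [pow_succ]; linarith) le_rfl (by linarith) l hl0 hl1
  · refine ⟨fun i => T / 2 * (1 / 2) ^ i, fun i => ?_,
      hsum _ (isLacunary_geometric (by positivity) (Or.inr rfl)), ?_⟩
    · have : 0 < T * (1 / 2) ^ i := by positivity
      exact ⟨by positivity, by linarith, by linarith⟩
    · intro z hz1 hz2 i l hl0 hl1
      have h0 : 0 < T * (1 / 2) ^ i := by positivity
      exact hstep u hu hfin hI z hz1 hz2 (T / 2 * (1 / 2) ^ i) _ _ (by positivity)
        (by rw [pow_succ]; linarith) (by rw [pow_succ]; linarith) (by linarith) (by linarith)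
        l hl0 hl1

/-- The weight `(T * b ^ i) ^ (d - p)` cancels the factor `τ i ^ (p - d)` in front of the energy up
to `2 ^ |d - p|`, so the energies add up to a multiple of the total one. The unit errors add up to a
geometric series of ratio `b ^ (d - p)`, hence the term `T ^ (d - p)`. -/
lemma exists_subcritical_sum_le (d : ℕ) (p : ℝ) (hp : 1 ≤ p) (b : ℝ) (hb : b = 2 ∨ b = 1 / 2)
    (hρ1 : b ^ ((d : ℝ) - p) < 1) (Z : Finset (EuclideanSpace ℝ (Fin d)))
    (hZ : ∀ z ∈ Z, 1 ≤ ‖z‖ ∧ ‖z‖ ≤ 2) :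
    ∃ C : ℝ, 0 < C ∧ ∀ u : EuclideanSpace ℝ (Fin d) → ℝ, Measurable u →
      ∫⁻ x, ENNReal.ofReal (|u x| ^ p) ≠ ⊤ → Idelta p 1 u ≠ ⊤ →
      ∀ T : ℝ, 0 < T → (∀ z ∈ Z, coneMean p u z T = 0) → ∀ n,
        ∑ i ∈ Finset.range n, (T * b ^ i) ^ ((d : ℝ) - p) *
          ∑ z ∈ Z, coneMean p u z (T * b ^ i) ≤
        C * ((Idelta p 1 u).toReal + T ^ ((d : ℝ) - p)) := by
  have hb0 : 0 < b := by rcases hb with rfl | rfl <;> norm_num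
  set ρ := b ^ ((d : ℝ) - p) with hρ
  have hρ0 : 0 < ρ := by positivity
  obtain ⟨C₁, hC₁, hhardy⟩ := exists_geometric_hardy p ρ hρ0 hρ1
  obtain ⟨C₂, hC₂, hchain⟩ := exists_scale_chain d p hp
  have hr : 0 < 1 / (1 - ρ) := by
    have : 0 < 1 - ρ := by linarith
    positivity
  set A : ℝ := 5 * 2 ^ |(d : ℝ) - p| + 1 / (1 - ρ) with hA
  have hA0 : 0 < A := by positivity
  -- The `+ 1` keeps the constant positive when `Z` is empty.
  refine ⟨(Z.card + 1) * (C₁ * (C₂ * A)), by positivity, ?_⟩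
  intro u hu hfin hI T hT h0 n
  obtain ⟨τ, hτ, hJ, hstep⟩ := hchain u hu hfin hI T b hT hb
  set J : ℕ → ℝ := fun i => (shellEnergy p u (τ i)).toReal with hJdef
  have hJ0 : ∀ i, 0 ≤ J i := fun i => ENNReal.toReal_nonneg
  set I := (Idelta p 1 u).toReal with hIdef
  have hI0 : 0 ≤ I := ENNReal.toReal_nonneg
  have ht : ∀ i : ℕ, (T * b ^ i) ^ ((d : ℝ) - p) = T ^ ((d : ℝ) - p) * ρ ^ i := by
    intro i
    rw [Real.mul_rpow hT.le (by positivity), hρ, ← Real.rpow_natCast, ← Real.rpow_natCast,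
      ← Real.rpow_mul hb0.le, ← Real.rpow_mul hb0.le, mul_comm (i : ℝ)]
  have hgeo : ∑ i ∈ Finset.range n, ρ ^ i ≤ 1 / (1 - ρ) := by
    have h1 := geom_sum_eq hρ1.ne n
    rw [h1, ← neg_div_neg_eq, neg_sub, neg_sub]
    have : 0 < 1 - ρ := by linarith
    gcongr
    linarith [pow_pos hρ0 n]
  have herr : T ^ ((d : ℝ) - p) * ∑ i ∈ Finset.range n,
      ρ ^ i * (C₂ * ((τ i) ^ (p - d) * J i + 1)) ≤ C₂ * A * (I + T ^ ((d : ℝ) - p)) := by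
    have hT0 : 0 < T ^ ((d : ℝ) - p) := by positivity
    have h1 : ∀ i, T ^ ((d : ℝ) - p) * (ρ ^ i * (C₂ * ((τ i) ^ (p - d) * J i + 1))) ≤
        C₂ * (2 ^ |(d : ℝ) - p| * J i + T ^ ((d : ℝ) - p) * ρ ^ i) := by
      intro i
      obtain ⟨h2, h3, h4⟩ := hτ i
      have h5 : (T * b ^ i) ^ ((d : ℝ) - p) * (τ i) ^ (p - d) ≤ 2 ^ |(d : ℝ) - p| := by
        rw [show p - (d : ℝ) = -((d : ℝ) - p) by ring, Real.rpow_neg h2.le, ← div_eq_mul_inv,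
          ← Real.div_rpow (by positivity) h2.le]
        have h6 : 1 ≤ T * b ^ i / τ i := by rwa [le_div_iff₀ h2, one_mul]
        have h7 : T * b ^ i / τ i ≤ 2 := by rwa [div_le_iff₀ h2]
        calc _ ≤ (T * b ^ i / τ i) ^ |(d : ℝ) - p| :=
              Real.rpow_le_rpow_of_exponent_le h6 (le_abs_self _)
          _ ≤ _ := Real.rpow_le_rpow (by linarith) h7 (abs_nonneg _)
      rw [ht i] at h5
      calc _ = C₂ * (T ^ ((d : ℝ) - p) * ρ ^ i * (τ i) ^ (p - d) * J i +
            T ^ ((d : ℝ) - p) * ρ ^ i) := by ring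
        _ ≤ _ := by
          gcongr
    rw [Finset.mul_sum]
    refine (Finset.sum_le_sum fun i _ => h1 i).trans ?_
    rw [← Finset.mul_sum, Finset.sum_add_distrib, ← Finset.mul_sum, ← Finset.mul_sum, mul_assoc]
    refine mul_le_mul_of_nonneg_left ?_ hC₂.le
    have h8 : 0 ≤ (2 : ℝ) ^ |(d : ℝ) - p| := by positivity
    calc _ ≤ 2 ^ |(d : ℝ) - p| * (5 * I) + T ^ ((d : ℝ) - p) * (1 / (1 - ρ)) := by
          gcongr
          exact hJ n
      _ ≤ _ := by
          rw [hA]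
          nlinarith [mul_nonneg h8 hT0.le, mul_nonneg hr.le hI0]
  have hz : ∀ z ∈ Z, ∑ i ∈ Finset.range n, (T * b ^ i) ^ ((d : ℝ) - p) *
      coneMean p u z (T * b ^ i) ≤ C₁ * (C₂ * A) * (I + T ^ ((d : ℝ) - p)) := by
    intro z hzZ
    have h1 := hhardy (fun i => coneMean p u z (T * b ^ i))
      (fun i => C₂ * ((τ i) ^ (p - d) * J i + 1))
      (fun i => coneMean_nonneg p u z (by positivity)) (by simpa using h0 z hzZ)
      (hstep z (hZ z hzZ).1 (hZ z hzZ).2) n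
    have h2 := mul_le_mul_of_nonneg_left h1 (by positivity : 0 ≤ T ^ ((d : ℝ) - p))
    calc _ = T ^ ((d : ℝ) - p) * ∑ i ∈ Finset.range n, ρ ^ i * coneMean p u z (T * b ^ i) := by
          rw [Finset.mul_sum]
          refine Finset.sum_congr rfl fun i _ => ?_
          rw [ht i]; ring
      _ ≤ _ := h2
      _ = C₁ * (T ^ ((d : ℝ) - p) * ∑ i ∈ Finset.range n,
          ρ ^ i * (C₂ * ((τ i) ^ (p - d) * J i + 1))) := by ring
      _ ≤ C₁ * (C₂ * A * (I + T ^ ((d : ℝ) - p))) := by gcongr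
      _ = _ := by ring
  calc _ = ∑ z ∈ Z, ∑ i ∈ Finset.range n, (T * b ^ i) ^ ((d : ℝ) - p) *
        coneMean p u z (T * b ^ i) := by
        rw [Finset.sum_comm]
        exact Finset.sum_congr rfl fun i _ => Finset.mul_sum _ _ _
    _ ≤ ∑ z ∈ Z, C₁ * (C₂ * A) * (I + T ^ ((d : ℝ) - p)) := Finset.sum_le_sum hz
    _ = Z.card * (C₁ * (C₂ * A) * (I + T ^ ((d : ℝ) - p))) := by
        rw [Finset.sum_const, nsmul_eq_mul]
    _ ≤ (Z.card + 1) * (C₁ * (C₂ * A) * (I + T ^ ((d : ℝ) - p))) := by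
        gcongr
        linarith
    _ = _ := by ring

/-- For `p = d` the energy enters with no power of the scale, and each scale contributes a unit
error. These errors no longer form a convergent series: their number `n + 1` becomes the logarithm
of the theorem. -/
lemma exists_critical_sum_le (d : ℕ) (hd : 2 ≤ d) (Z : Finset (EuclideanSpace ℝ (Fin d)))
    (hZ : ∀ z ∈ Z, 1 ≤ ‖z‖ ∧ ‖z‖ ≤ 2) :
    ∃ C : ℝ, 0 < C ∧ ∀ u : EuclideanSpace ℝ (Fin d) → ℝ, Measurable u →
      ∫⁻ x, ENNReal.ofReal (|u x| ^ (d : ℝ)) ≠ ⊤ → Idelta d 1 u ≠ ⊤ →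
      ∀ T b : ℝ, 0 < T → b = 2 ∨ b = 1 / 2 → (∀ z ∈ Z, coneMean d u z T = 0) → ∀ n : ℕ,
        ∑ i ∈ Finset.range (n + 1), ((i : ℝ) + 1) ^ (-(d : ℝ)) *
          ∑ z ∈ Z, coneMean d u z (T * b ^ (i + 1)) ≤
        C * ((Idelta d 1 u).toReal + (n + 1)) := by
  have hd' : (2 : ℝ) ≤ d := by exact_mod_cast hd
  obtain ⟨C₂, hC₂, hchain⟩ := exists_scale_chain d d (by linarith)
  refine ⟨(Z.card + 1) * (3 * 2 ^ ((d : ℝ) - 1) * (5 * C₂)), by positivity, ?_⟩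
  intro u hu hfin hI T b hT hb h0 n
  have hb0 : 0 < b := by rcases hb with rfl | rfl <;> norm_num
  obtain ⟨τ, hτ, hJ, hstep⟩ := hchain u hu hfin hI T b hT hb
  set J : ℕ → ℝ := fun i => (shellEnergy d u (τ i)).toReal with hJdef
  set I := (Idelta d 1 u).toReal with hIdef
  have hI0 : 0 ≤ I := ENNReal.toReal_nonneg
  have hz : ∀ z ∈ Z, ∑ i ∈ Finset.range (n + 1), ((i : ℝ) + 1) ^ (-(d : ℝ)) *
      coneMean d u z (T * b ^ (i + 1)) ≤
      3 * 2 ^ ((d : ℝ) - 1) * (5 * C₂) * (I + (n + 1)) := by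
    intro z hzZ
    have h1 := critical_hardy hd' (m := fun i => coneMean d u z (T * b ^ i))
      (e := fun i => C₂ * (J i + 1))
      (fun i => coneMean_nonneg d u z (by positivity)) (by simpa using h0 z hzZ)
      (by
        have := hstep z (hZ z hzZ).1 (hZ z hzZ).2
        simpa only [sub_self, Real.rpow_zero, one_mul] using this) n
    refine h1.trans ?_
    rw [← Finset.mul_sum, Finset.sum_add_distrib, mul_assoc (3 * 2 ^ ((d : ℝ) - 1))]
    refine mul_le_mul_of_nonneg_left ?_ (by positivity)
    have h2 := hJ (n + 1)
    simp only [Finset.sum_const, Finset.card_range, nsmul_eq_mul, mul_one]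
    push_cast
    have h3 : (0 : ℝ) ≤ n := by positivity
    rw [mul_comm 5 C₂, mul_assoc]
    refine mul_le_mul_of_nonneg_left ?_ hC₂.le
    linarith
  calc _ = ∑ z ∈ Z, ∑ i ∈ Finset.range (n + 1), ((i : ℝ) + 1) ^ (-(d : ℝ)) *
        coneMean d u z (T * b ^ (i + 1)) := by
        rw [Finset.sum_comm]
        exact Finset.sum_congr rfl fun i _ => Finset.mul_sum _ _ _
    _ ≤ ∑ z ∈ Z, 3 * 2 ^ ((d : ℝ) - 1) * (5 * C₂) * (I + (n + 1)) := Finset.sum_le_sum hz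
    _ = Z.card * (3 * 2 ^ ((d : ℝ) - 1) * (5 * C₂) * (I + (n + 1))) := by
        rw [Finset.sum_const, nsmul_eq_mul]
    _ ≤ (Z.card + 1) * (3 * 2 ^ ((d : ℝ) - 1) * (5 * C₂) * (I + (n + 1))) := by
        gcongr
        linarith
    _ = _ := by ring

/-! ### Hardy inequalities at threshold one -/

lemma coneMean_eq_zero {d : ℕ} {p : ℝ} (hp : 1 ≤ p) {u : EuclideanSpace ℝ (Fin d) → ℝ}
    {z : EuclideanSpace ℝ (Fin d)} {t : ℝ}
    (h : ∀ᵐ x, x ∈ Metric.ball (t • z) (t / 8) → u x = 0) : coneMean p u z t = 0 := by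
  have h1 : ∫⁻ x in Metric.ball (t • z) (t / 8), ENNReal.ofReal (|u x| ^ p) = 0 := by
    rw [← ae_restrict_iff' measurableSet_ball] at h
    rw [lintegral_congr_ae (g := fun _ => 0)]
    · simp
    · filter_upwards [h] with x hx
      simp [hx, Real.zero_rpow (by linarith : p ≠ 0)]
  rw [coneMean, h1]
  simp

lemma exists_mem_shell_of_lt {d : ℕ} {x : EuclideanSpace ℝ (Fin d)} {T : ℝ} (hx : 0 < ‖x‖)
    (hxT : ‖x‖ < T) : ∃ i : ℕ, x ∈ shell d (T * (1 / 2) ^ (i + 1)) := by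
  have hT : 0 < T := hx.trans hxT
  have hex : ∃ n : ℕ, T * (1 / 2) ^ n ≤ ‖x‖ := by
    obtain ⟨n, hn⟩ := exists_pow_lt_of_lt_one (div_pos hx hT) (by norm_num : (1 / 2 : ℝ) < 1)
    rw [lt_div_iff₀ hT] at hn
    exact ⟨n, by linarith⟩
  classical
  have h1 := Nat.find_spec hex
  rcases hn : Nat.find hex with _ | i
  · rw [hn] at h1
    simp only [pow_zero, mul_one] at h1
    linarith
  · have h2 := Nat.find_min hex (m := i) (by omega)
    rw [hn] at h1
    refine ⟨i, h1, ?_⟩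
    push Not at h2
    rw [pow_succ]
    linarith

lemma exists_mem_shell_of_le {d : ℕ} {x : EuclideanSpace ℝ (Fin d)} {T : ℝ} (hT : 0 < T)
    (hxT : T ≤ ‖x‖) : ∃ i : ℕ, x ∈ shell d (T * 2 ^ i) := by
  obtain ⟨n, h1, h2⟩ := exists_nat_pow_near (x := ‖x‖ / T) (y := 2)
    (by rwa [le_div_iff₀ hT, one_mul]) (by norm_num)
  rw [le_div_iff₀ hT] at h1
  rw [div_lt_iff₀ hT, pow_succ] at h2
  exact ⟨n, by linarith, by linarith⟩

lemma norm_bounds_of_mem_ball {d : ℕ} {x z : EuclideanSpace ℝ (Fin d)} {t : ℝ} (ht : 0 < t)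
    (hz1 : 1 ≤ ‖z‖) (hz2 : ‖z‖ ≤ 2) (hx : x ∈ Metric.ball (t • z) (t / 8)) :
    t / 2 < ‖x‖ ∧ ‖x‖ < 3 * t := by
  rw [mem_ball_iff_norm] at hx
  have h1 : ‖t • z‖ = t * ‖z‖ := by rw [norm_smul, Real.norm_of_nonneg ht.le]
  have h2 := norm_sub_norm_le (t • z) x
  have h3 := norm_sub_norm_le x (t • z)
  rw [norm_sub_rev] at h2
  rw [h1] at h2 h3
  constructor <;> nlinarith

/-- Balls of scale `T` lie in the annulus `T / 2 < ‖x‖ < 3 * T`, which `S` avoids: this is the zero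
starting value of the discrete Hardy inequality. -/
lemma exists_hardy_of_geometric_cover (d : ℕ) (p : ℝ) (hp : 1 ≤ p) (b : ℝ)
    (hb : b = 2 ∨ b = 1 / 2) (hρ1 : b ^ ((d : ℝ) - p) < 1) :
    ∃ C : ℝ, 0 < C ∧ ∀ u : EuclideanSpace ℝ (Fin d) → ℝ, Measurable u →
      ∫⁻ x, ENNReal.ofReal (|u x| ^ p) ≠ ⊤ →
      ∀ (T : ℝ) (S : Set (EuclideanSpace ℝ (Fin d))), 0 < T → MeasurableSet S →
      S ⊆ ⋃ i : ℕ, shell d (T * b ^ i) → (∀ᵐ x, x ∉ S → u x = 0) →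
      (∀ x ∈ S, ¬ (T / 2 < ‖x‖ ∧ ‖x‖ < 3 * T)) →
      ∫⁻ x, ENNReal.ofReal (|u x| ^ p / ‖x‖ ^ p) ≤
        ENNReal.ofReal C * (Idelta p 1 u + ENNReal.ofReal (T ^ ((d : ℝ) - p))) := by
  obtain ⟨Z, hZ, hcov⟩ := exists_finite_cover_shell d
  obtain ⟨C, hC, hsum⟩ := exists_subcritical_sum_le d p hp b hb hρ1 Z hZ
  have hb0 : 0 < b := by rcases hb with rfl | rfl <;> norm_num
  refine ⟨C, hC, fun u hu hfin T S hT mS hS hu0 hST => ?_⟩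
  by_cases hI : Idelta p 1 u = ⊤
  · rw [hI, top_add, ENNReal.mul_top]
    · exact le_top
    · simpa using hC
  have hp0 : p ≠ 0 := by linarith
  have hF : ∫⁻ x, ENNReal.ofReal (|u x| ^ p / ‖x‖ ^ p) =
      ∫⁻ x in S, ENNReal.ofReal (|u x| ^ p / ‖x‖ ^ p) := by
    rw [← lintegral_indicator mS]
    refine lintegral_congr_ae ?_
    filter_upwards [hu0] with x hx
    by_cases hxS : x ∈ S
    · rw [Set.indicator_of_mem hxS]
    · rw [Set.indicator_of_notMem hxS, hx hxS]
      simp [Real.zero_rpow hp0]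
  have ht : ∀ i : ℕ, 0 < T * b ^ i := fun i => by positivity
  rw [hF]
  refine (lintegral_le_tsum_coneMean hfin hcov ht (w := fun i => (T * b ^ i) ^ (-p))
    (fun i => by positivity) mS hS (fun i x hx => ?_)).trans ?_
  · refine ENNReal.ofReal_le_ofReal ?_
    rw [Real.rpow_neg (ht i).le, div_eq_inv_mul]
    have h1 : T * b ^ i ≤ ‖x‖ := hx.2.1
    have h2 := ht i
    gcongr
  · refine ENNReal.tsum_le_of_sum_range_le fun n => ?_
    have h0 : ∀ z ∈ Z, coneMean p u z T = 0 := by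
      intro z hz
      refine coneMean_eq_zero hp ?_
      filter_upwards [hu0] with x hx hxb
      exact hx fun hxS => hST x hxS (norm_bounds_of_mem_ball hT (hZ z hz).1 (hZ z hz).2 hxb)
    have h1 := hsum u hu hfin hI T hT h0 n
    have h2 : ∀ i : ℕ, (T * b ^ i) ^ (-p) * (T * b ^ i) ^ d = (T * b ^ i) ^ ((d : ℝ) - p) := by
      intro i
      rw [← Real.rpow_natCast (T * b ^ i) d, ← Real.rpow_add (ht i)]
      congr 1; ring
    rw [← ENNReal.ofReal_sum_of_nonneg]
    · simp only [h2]
      refine (ENNReal.ofReal_le_ofReal h1).trans (le_of_eq ?_)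
      rw [ENNReal.ofReal_mul hC.le, ENNReal.ofReal_add ENNReal.toReal_nonneg (by positivity),
        ENNReal.ofReal_toReal hI]
    · intro i _
      have := ht i
      exact mul_nonneg (by positivity) (Finset.sum_nonneg fun z _ => coneMean_nonneg p u z (ht i).le)

lemma exists_hardy_subcritical (d : ℕ) (p : ℝ) (hp : 1 ≤ p) (hpd : p < d) :
    ∃ C : ℝ, 0 < C ∧ ∀ u : EuclideanSpace ℝ (Fin d) → ℝ, Measurable u →
      ∫⁻ x, ENNReal.ofReal (|u x| ^ p) ≠ ⊤ →
      ∀ R : ℝ, 0 < R → (∀ᵐ x, x ∉ Metric.ball (0 : EuclideanSpace ℝ (Fin d)) R → u x = 0) →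
      ∫⁻ x, ENNReal.ofReal (|u x| ^ p / ‖x‖ ^ p) ≤
        ENNReal.ofReal C * (Idelta p 1 u + ENNReal.ofReal (R ^ ((d : ℝ) - p))) := by
  have hd : 0 < d := by
    rcases Nat.eq_zero_or_pos d with rfl | h
    · simp at hpd; linarith
    · exact h
  have : Nonempty (Fin d) := ⟨⟨0, hd⟩⟩
  obtain ⟨C, hC, h⟩ := exists_hardy_of_geometric_cover d p hp (1 / 2) (Or.inr rfl)
    (Real.rpow_lt_one (by norm_num) (by norm_num) (by linarith))
  have hA : (1 : ℝ) ≤ 2 ^ ((d : ℝ) - p) := Real.one_le_rpow (by norm_num) (by linarith)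
  refine ⟨C * 2 ^ ((d : ℝ) - p), by positivity, fun u hu hfin R hR hu0 => ?_⟩
  -- With `T = 2 * R` the annulus `T / 2 < ‖x‖` begins outside `B_R`. The origin is removed because
  -- it lies in no shell.
  refine (h u hu hfin (2 * R) (Metric.ball 0 R \ {0}) (by positivity)
    (measurableSet_ball.diff (measurableSet_singleton 0)) ?_ ?_ ?_).trans ?_
  · rintro x ⟨h1, h2⟩
    rw [mem_ball_zero_iff] at h1
    obtain ⟨i, hi⟩ := exists_mem_shell_of_lt (norm_pos_iff.2 h2) (h1.trans (by linarith : R < 2 * R))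
    exact Set.mem_iUnion.2 ⟨i + 1, hi⟩
  · have h0 : ∀ᵐ x : EuclideanSpace ℝ (Fin d), x ≠ 0 := by
      simp [ae_iff]
    filter_upwards [hu0, h0] with x hx hx0 hxS
    exact hx fun hb => hxS ⟨hb, hx0⟩
  · rintro x ⟨h1, -⟩ ⟨h2, -⟩
    rw [mem_ball_zero_iff] at h1
    linarith
  · rw [ENNReal.ofReal_mul hC.le, mul_assoc]
    gcongr ENNReal.ofReal C * ?_
    rw [mul_add, Real.mul_rpow (by norm_num) hR.le, ENNReal.ofReal_mul (by positivity)]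
    gcongr
    exact le_mul_of_one_le_left zero_le (by rwa [ENNReal.one_le_ofReal])

lemma exists_hardy_supercritical (d : ℕ) (p : ℝ) (hp : 1 ≤ p) (hpd : d < p) :
    ∃ C : ℝ, 0 < C ∧ ∀ u : EuclideanSpace ℝ (Fin d) → ℝ, Measurable u →
      ∫⁻ x, ENNReal.ofReal (|u x| ^ p) ≠ ⊤ →
      ∀ r : ℝ, 0 < r → (∀ᵐ x, x ∉ (Metric.ball (0 : EuclideanSpace ℝ (Fin d)) r)ᶜ → u x = 0) →
      ∫⁻ x, ENNReal.ofReal (|u x| ^ p / ‖x‖ ^ p) ≤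
        ENNReal.ofReal C * (Idelta p 1 u + ENNReal.ofReal (r ^ ((d : ℝ) - p))) := by
  obtain ⟨C, hC, h⟩ := exists_hardy_of_geometric_cover d p hp 2 (Or.inl rfl)
    (Real.rpow_lt_one_of_one_lt_of_neg (by norm_num) (by linarith))
  have hA : (1 : ℝ) ≤ (1 / 4) ^ ((d : ℝ) - p) :=
    Real.one_le_rpow_of_pos_of_le_one_of_nonpos (by norm_num) (by norm_num) (by linarith)
  refine ⟨C * (1 / 4) ^ ((d : ℝ) - p), by positivity, fun u hu hfin r hr hu0 => ?_⟩
  -- With `T = r / 4` the annulus `‖x‖ < 3 * T` stays inside `B_r`.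
  refine (h u hu hfin (1 / 4 * r) (Metric.ball 0 r)ᶜ (by positivity)
    measurableSet_ball.compl ?_ hu0 ?_).trans ?_
  · intro x hx
    simp only [Set.mem_compl_iff, mem_ball_zero_iff, not_lt] at hx
    exact Set.mem_iUnion.2 (exists_mem_shell_of_le (by positivity) (by linarith))
  · rintro x hx ⟨-, h2⟩
    simp only [Set.mem_compl_iff, mem_ball_zero_iff, not_lt] at hx
    linarith
  · rw [ENNReal.ofReal_mul hC.le, mul_assoc]
    gcongr ENNReal.ofReal C * ?_
    rw [mul_add, Real.mul_rpow (by norm_num) hr.le, ENNReal.ofReal_mul (by positivity)]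
    gcongr
    exact le_mul_of_one_le_left zero_le (by rwa [ENNReal.one_le_ofReal])

/-- On the shell of index `i` the logarithmic weight `L` is at least a multiple of `i + 1`, so the
integral is dominated by the critical Hardy sum with weights `(i + 1) ^ (-d)`. -/
lemma exists_hardy_of_critical_cover (d : ℕ) (hd : 2 ≤ d) :
    ∃ C : ℝ, 0 < C ∧ ∀ u : EuclideanSpace ℝ (Fin d) → ℝ, Measurable u →
      ∫⁻ x, ENNReal.ofReal (|u x| ^ (d : ℝ)) ≠ ⊤ →
      ∀ (T b : ℝ) (n : ℕ) (S : Set (EuclideanSpace ℝ (Fin d))) (L : EuclideanSpace ℝ (Fin d) → ℝ),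
      0 < T → b = 2 ∨ b = 1 / 2 → MeasurableSet S →
      (∀ x ∈ S, ∃ i : ℕ, i ≤ n ∧ x ∈ shell d (T * b ^ (i + 1))) →
      (∀ᵐ x, T / 2 < ‖x‖ → ‖x‖ < 3 * T → u x = 0) →
      (∀ i : ℕ, ∀ x ∈ S ∩ shell d (T * b ^ (i + 1)), Real.log 2 / 2 * (i + 1) ≤ L x) →
      ∫⁻ x in S, ENNReal.ofReal (|u x| ^ d / (‖x‖ ^ d * L x ^ d)) ≤
        ENNReal.ofReal C * (Idelta d 1 u + ENNReal.ofReal (n + 1)) := by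
  obtain ⟨Z, hZ, hcov⟩ := exists_finite_cover_shell d
  obtain ⟨C, hC, hsum⟩ := exists_critical_sum_le d hd Z hZ
  have hd' : (2 : ℝ) ≤ d := by exact_mod_cast hd
  have hlog : 0 < Real.log 2 := Real.log_pos (by norm_num)
  set A : ℝ := (Real.log 2 / 2) ^ (-(d : ℝ)) with hA
  have hA0 : 0 < A := by positivity
  refine ⟨A * C, by positivity, fun u hu hfin T b n S L hT hb mS hS hu0 hL => ?_⟩
  have hb0 : 0 < b := by rcases hb with rfl | rfl <;> norm_num
  by_cases hI : Idelta d 1 u = ⊤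
  · rw [hI, top_add, ENNReal.mul_top]
    · exact le_top
    · simpa using mul_pos hA0 hC
  have ht : ∀ i : ℕ, 0 < T * b ^ (i + 1) := fun i => by positivity
  have hS' : S ⊆ ⋃ i : Fin (n + 1), shell d (T * b ^ ((i : ℕ) + 1)) := by
    intro x hx
    obtain ⟨i, hi, hxi⟩ := hS x hx
    exact Set.mem_iUnion.2 ⟨⟨i, by omega⟩, hxi⟩
  set w : ℕ → ℝ := fun i => A * ((i : ℝ) + 1) ^ (-(d : ℝ)) * ((T * b ^ (i + 1)) ^ d)⁻¹ with hw
  have hw0 : ∀ i, 0 ≤ w i := fun i => by have := ht i; positivity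
  refine (lintegral_le_tsum_coneMean hfin hcov (fun i : Fin (n + 1) => ht i)
    (w := fun i : Fin (n + 1) => w i) (fun i => hw0 i) mS hS' (fun i x hx => ?_)).trans ?_
  · refine ENNReal.ofReal_le_ofReal ?_
    have h1 : T * b ^ ((i : ℕ) + 1) ≤ ‖x‖ := hx.2.1
    have h2 := hL i x hx
    have h3 := ht i
    have h4 : 0 < Real.log 2 / 2 * ((i : ℝ) + 1) := by positivity
    have h5 : 0 < L x := h4.trans_le h2
    have h6 : 0 ≤ L x ^ d := by positivity
    rw [Real.rpow_natCast, div_eq_inv_mul]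
    gcongr
    rw [hw, hA]
    dsimp only
    rw [← Real.mul_rpow (by positivity) (by positivity), Real.rpow_neg h4.le, Real.rpow_natCast,
      ← mul_inv, mul_comm (‖x‖ ^ d)]
    gcongr
  · rw [tsum_fintype, Fin.sum_univ_eq_sum_range (fun i => ENNReal.ofReal (w i *
      (T * b ^ (i + 1)) ^ d * ∑ z ∈ Z, coneMean (d : ℝ) u z (T * b ^ (i + 1)))) (n + 1)]
    have h0 : ∀ z ∈ Z, coneMean d u z T = 0 := by
      intro z hz
      refine coneMean_eq_zero (by linarith) ?_
      filter_upwards [hu0] with x hx hxb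
      have := norm_bounds_of_mem_ball hT (hZ z hz).1 (hZ z hz).2 hxb
      exact hx this.1 this.2
    have h1 := hsum u hu hfin hI T b hT hb h0 n
    have h2 : ∀ i : ℕ, w i * (T * b ^ (i + 1)) ^ d = A * ((i : ℝ) + 1) ^ (-(d : ℝ)) := by
      intro i
      rw [hw]
      exact inv_mul_cancel_right₀ (pow_pos (ht i) d).ne' _
    rw [← ENNReal.ofReal_sum_of_nonneg]
    · simp only [h2]
      calc _ = ENNReal.ofReal (A * ∑ i ∈ Finset.range (n + 1), ((i : ℝ) + 1) ^ (-(d : ℝ)) *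
            ∑ z ∈ Z, coneMean d u z (T * b ^ (i + 1))) := by
            rw [Finset.mul_sum]
            simp only [mul_assoc]
        _ ≤ ENNReal.ofReal (A * (C * ((Idelta d 1 u).toReal + (n + 1)))) := by gcongr
        _ = _ := by
            rw [← mul_assoc, ENNReal.ofReal_mul (by positivity),
              ENNReal.ofReal_add ENNReal.toReal_nonneg (by positivity), ENNReal.ofReal_toReal hI]
    · intro i _
      exact mul_nonneg (mul_nonneg (hw0 i) (pow_nonneg (ht i).le d))
        (Finset.sum_nonneg fun z _ => coneMean_nonneg _ u z (ht i).le)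

/-- For `X = 2 * R / r` this bounds the number of dyadic scales between `r` and `R` by a multiple of
the logarithm. -/
lemma exists_pow_two_near {X : ℝ} (hX : 2 ≤ X) :
    ∃ n : ℕ, (∀ i : ℕ, (2 : ℝ) ^ i < X → i ≤ n) ∧ (n : ℝ) + 1 ≤ 2 / Real.log 2 * Real.log X := by
  have hlog : 0 < Real.log 2 := Real.log_pos (by norm_num)
  obtain ⟨n, h1, h2⟩ := exists_nat_pow_near (x := X) (y := 2) (by linarith) (by norm_num)
  refine ⟨n, fun i hi => ?_, ?_⟩
  · have := (pow_lt_pow_iff_right₀ (by norm_num : (1 : ℝ) < 2)).1 (hi.trans h2)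
    omega
  · have h3 : n * Real.log 2 ≤ Real.log X := by
      rw [← Real.log_pow]
      exact Real.log_le_log (by positivity) h1
    have h4 : Real.log 2 ≤ Real.log X := Real.log_le_log (by norm_num) hX
    rw [div_mul_eq_mul_div, le_div_iff₀ hlog]
    linarith

lemma log_two_div_two_mul_le {X : ℝ} {i : ℕ} (h2 : 2 ≤ X) (hi : 2 ^ i ≤ X) :
    Real.log 2 / 2 * (i + 1) ≤ Real.log X := by
  have h3 : i * Real.log 2 ≤ Real.log X := by
    rw [← Real.log_pow]
    exact Real.log_le_log (by positivity) hi
  have h4 : Real.log 2 ≤ Real.log X := Real.log_le_log (by norm_num) h2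
  linarith

lemma setLIntegral_le_of_ae_mem {α : Type*} [MeasurableSpace α] {μ : Measure α} {A S : Set α}
    (mA : MeasurableSet A) (mS : MeasurableSet S) {F : α → ℝ≥0∞}
    (h : ∀ᵐ x ∂μ, x ∈ A → x ∉ S → F x = 0) : ∫⁻ x in A, F x ∂μ ≤ ∫⁻ x in S, F x ∂μ := by
  rw [← lintegral_indicator mA, ← lintegral_indicator mS]
  refine lintegral_mono_ae ?_
  filter_upwards [h] with x hx
  by_cases hA : x ∈ A
  · by_cases hS : x ∈ S
    · rw [Set.indicator_of_mem hA, Set.indicator_of_mem hS]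
    · rw [Set.indicator_of_mem hA, hx hA hS]
      exact zero_le
  · rw [Set.indicator_of_notMem hA]
    exact zero_le

lemma exists_hardy_critical_inner (d : ℕ) (hd : 2 ≤ d) :
    ∃ C : ℝ, 0 < C ∧ ∀ u : EuclideanSpace ℝ (Fin d) → ℝ, Measurable u →
      ∫⁻ x, ENNReal.ofReal (|u x| ^ (d : ℝ)) ≠ ⊤ →
      ∀ r R : ℝ, 0 < r → r < R →
      (∀ᵐ x, x ∉ Metric.ball (0 : EuclideanSpace ℝ (Fin d)) R → u x = 0) →
      ∫⁻ x in (Metric.ball 0 r)ᶜ,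
          ENNReal.ofReal (|u x| ^ d / (‖x‖ ^ d * Real.log (2 * R / ‖x‖) ^ d)) ≤
        ENNReal.ofReal C * (Idelta d 1 u + ENNReal.ofReal (Real.log (2 * R / r))) := by
  obtain ⟨C, hC, h⟩ := exists_hardy_of_critical_cover d hd
  have hlog : 0 < Real.log 2 := Real.log_pos (by norm_num)
  have hlog2 : Real.log 2 < 1 := by linarith [Real.log_two_lt_d9]
  refine ⟨C * (2 / Real.log 2), by positivity, fun u hu hfin r R hr hrR hu0 => ?_⟩
  have hR : 0 < R := hr.trans hrR
  have hX : 2 ≤ 2 * R / r := by rw [le_div_iff₀ hr]; linarith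
  obtain ⟨n, hn, hnX⟩ := exists_pow_two_near hX
  have mS : MeasurableSet {x : EuclideanSpace ℝ (Fin d) | r ≤ ‖x‖ ∧ ‖x‖ < R} :=
    (measurableSet_le measurable_const measurable_norm).inter
      (measurableSet_lt measurable_norm measurable_const)
  have hshell : ∀ i : ℕ, ∀ x ∈ shell d (2 * R * (1 / 2) ^ (i + 1)), 2 ^ i * ‖x‖ < 2 * R := by
    intro i x hx
    have h1 := hx.2
    rw [pow_succ, one_div, inv_pow] at h1
    have h2 : (0 : ℝ) < 2 ^ i := by positivity
    calc 2 ^ i * ‖x‖ < 2 ^ i * (2 * (2 * R * ((2 ^ i)⁻¹ * 2⁻¹))) := by gcongr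
      _ = 2 * R := by field_simp
  calc _ ≤ ∫⁻ x in {x | r ≤ ‖x‖ ∧ ‖x‖ < R},
        ENNReal.ofReal (|u x| ^ d / (‖x‖ ^ d * Real.log (2 * R / ‖x‖) ^ d)) := by
        refine setLIntegral_le_of_ae_mem measurableSet_ball.compl mS ?_
        filter_upwards [hu0] with x hx hxA hxS
        simp only [Set.mem_compl_iff, mem_ball_zero_iff, not_lt] at hxA hx
        rw [hx (by
          by_contra! hc
          exact hxS ⟨hxA, hc⟩)]
        simp [show d ≠ 0 by omega]
    _ ≤ ENNReal.ofReal C * (Idelta d 1 u + ENNReal.ofReal (n + 1)) := by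
        refine h u hu hfin (2 * R) (1 / 2) n _ _ (by positivity) (Or.inr rfl) mS ?_ ?_ ?_
        · rintro x ⟨h1, h2⟩
          obtain ⟨i, hi⟩ := exists_mem_shell_of_lt (hr.trans_le h1)
            (h2.trans (by linarith : R < 2 * R))
          refine ⟨i, hn i ?_, hi⟩
          rw [lt_div_iff₀ hr]
          have h3 := hshell i x hi
          have h4 : (0 : ℝ) < 2 ^ i := by positivity
          nlinarith
        · filter_upwards [hu0] with x hx h1 h2
          refine hx ?_
          rw [mem_ball_zero_iff, not_lt]
          linarith
        · rintro i x ⟨⟨h1, h2⟩, hi⟩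
          have hx0 : 0 < ‖x‖ := hr.trans_le h1
          refine log_two_div_two_mul_le ?_ ?_
          · rw [le_div_iff₀ hx0]; linarith
          · rw [le_div_iff₀ hx0]; exact (hshell i x hi).le
    _ ≤ ENNReal.ofReal C * (ENNReal.ofReal (2 / Real.log 2) * Idelta d 1 u +
          ENNReal.ofReal (2 / Real.log 2 * Real.log (2 * R / r))) := by
        gcongr
        refine le_mul_of_one_le_left zero_le ?_
        rw [ENNReal.one_le_ofReal, le_div_iff₀ hlog]
        linarith
    _ = _ := by
        rw [ENNReal.ofReal_mul (by positivity), ← mul_add, ENNReal.ofReal_mul hC.le, mul_assoc]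

lemma exists_hardy_critical_outer (d : ℕ) (hd : 2 ≤ d) :
    ∃ C : ℝ, 0 < C ∧ ∀ u : EuclideanSpace ℝ (Fin d) → ℝ, Measurable u →
      ∫⁻ x, ENNReal.ofReal (|u x| ^ (d : ℝ)) ≠ ⊤ →
      ∀ r R : ℝ, 0 < r → r < R →
      (∀ᵐ x, x ∉ (Metric.ball (0 : EuclideanSpace ℝ (Fin d)) r)ᶜ → u x = 0) →
      ∫⁻ x in Metric.ball 0 R,
          ENNReal.ofReal (|u x| ^ d / (‖x‖ ^ d * Real.log (2 * ‖x‖ / r) ^ d)) ≤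
        ENNReal.ofReal C * (Idelta d 1 u + ENNReal.ofReal (Real.log (2 * R / r))) := by
  obtain ⟨C, hC, h⟩ := exists_hardy_of_critical_cover d hd
  have hlog : 0 < Real.log 2 := Real.log_pos (by norm_num)
  have hlog2 : Real.log 2 < 1 := by linarith [Real.log_two_lt_d9]
  refine ⟨C * (2 / Real.log 2), by positivity, fun u hu hfin r R hr hrR hu0 => ?_⟩
  have hR : 0 < R := hr.trans hrR
  have hX : 2 ≤ 2 * R / r := by rw [le_div_iff₀ hr]; linarith
  obtain ⟨n, hn, hnX⟩ := exists_pow_two_near hX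
  have mS : MeasurableSet {x : EuclideanSpace ℝ (Fin d) | r ≤ ‖x‖ ∧ ‖x‖ < R} :=
    (measurableSet_le measurable_const measurable_norm).inter
      (measurableSet_lt measurable_norm measurable_const)
  have hshell : ∀ i : ℕ, ∀ x ∈ shell d (r / 4 * 2 ^ (i + 1)), 2 ^ i * r ≤ 2 * ‖x‖ := by
    intro i x hx
    have h1 := hx.1
    rw [pow_succ] at h1
    linarith
  calc _ ≤ ∫⁻ x in {x | r ≤ ‖x‖ ∧ ‖x‖ < R},
        ENNReal.ofReal (|u x| ^ d / (‖x‖ ^ d * Real.log (2 * ‖x‖ / r) ^ d)) := by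
        refine setLIntegral_le_of_ae_mem measurableSet_ball mS ?_
        filter_upwards [hu0] with x hx hxA hxS
        simp only [Set.mem_compl_iff, mem_ball_zero_iff, not_not] at hxA hx
        rw [hx (by
          by_contra! hc
          exact hxS ⟨hc, hxA⟩)]
        simp [show d ≠ 0 by omega]
    _ ≤ ENNReal.ofReal C * (Idelta d 1 u + ENNReal.ofReal (n + 1)) := by
        refine h u hu hfin (r / 4) 2 n _ _ (by positivity) (Or.inl rfl) mS ?_ ?_ ?_
        · rintro x ⟨h1, h2⟩
          obtain ⟨i, hi⟩ := exists_mem_shell_of_le (x := x) (T := r / 2) (by positivity)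
            (by linarith)
          have hi' : x ∈ shell d (r / 4 * 2 ^ (i + 1)) := by
            rwa [show r / 4 * 2 ^ (i + 1) = r / 2 * 2 ^ i by ring]
          refine ⟨i, hn i ?_, hi'⟩
          rw [lt_div_iff₀ hr]
          have h3 := hshell i x hi'
          linarith
        · filter_upwards [hu0] with x hx h1 h2
          refine hx ?_
          rw [Set.mem_compl_iff, not_not, mem_ball_zero_iff]
          linarith
        · rintro i x ⟨⟨h1, h2⟩, hi⟩
          refine log_two_div_two_mul_le ?_ ?_
          · rw [le_div_iff₀ hr]; linarith
          · rw [le_div_iff₀ hr]; exact hshell i x hi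
    _ ≤ ENNReal.ofReal C * (ENNReal.ofReal (2 / Real.log 2) * Idelta d 1 u +
          ENNReal.ofReal (2 / Real.log 2 * Real.log (2 * R / r))) := by
        gcongr
        refine le_mul_of_one_le_left zero_le ?_
        rw [ENNReal.one_le_ofReal, le_div_iff₀ hlog]
        linarith
    _ = _ := by
        rw [ENNReal.ofReal_mul (by positivity), ← mul_add, ENNReal.ofReal_mul hC.le, mul_assoc]

/-! ### Reduction to threshold one and conclusion -/

lemma ae_eq_zero_of_essSupport_subset {d : ℕ} {u : EuclideanSpace ℝ (Fin d) → ℝ}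
    {S : Set (EuclideanSpace ℝ (Fin d))} (h : essSupport u ⊆ S) : ∀ᵐ x, x ∉ S → u x = 0 := by
  rw [ae_iff]
  refine measure_null_of_locally_null _ fun x hx => ?_
  have hxS : x ∉ essSupport u := fun hc => by
    simp only [Set.mem_ofPred_eq, Classical.not_imp] at hx
    exact hx.1 (h hc)
  simp only [essSupport, Set.mem_ofPred_eq] at hxS
  push Not at hxS
  obtain ⟨U, hU, hU0⟩ := hxS
  obtain ⟨V, hVU, hVo, hxV⟩ := mem_nhds_iff.1 hU
  have hV0 := ae_restrict_of_ae_restrict_of_subset hVU hU0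
  rw [ae_restrict_iff' hVo.measurableSet, ae_iff] at hV0
  refine ⟨_, inter_mem_nhdsWithin _ (hVo.mem_nhds hxV), measure_mono_null ?_ hV0⟩
  rintro y ⟨hy, hyV⟩
  simp only [Set.mem_ofPred_eq, Classical.not_imp] at hy ⊢
  exact ⟨hyV, hy.2⟩

lemma Idelta_congr_ae {d : ℕ} {p δ : ℝ} {u v : EuclideanSpace ℝ (Fin d) → ℝ}
    (h : ∀ᵐ x, u x = v x) : Idelta p δ u = Idelta p δ v := by
  refine lintegral_congr_ae ?_
  filter_upwards [h] with x hx
  refine setLIntegral_congr ?_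
  filter_upwards [h] with y hy
  change (δ < |u x - u y|) = (δ < |v x - v y|)
  rw [hx, hy]

lemma Idelta_const_mul {d : ℕ} {p δ : ℝ} (hδ : 0 < δ) (v : EuclideanSpace ℝ (Fin d) → ℝ) :
    Idelta p δ (fun x => δ * v x) = ENNReal.ofReal (δ ^ p) * Idelta p 1 v := by
  have hset : ∀ x, {y | δ < |δ * v x - δ * v y|} = {y | 1 < |v x - v y|} := by
    intro x
    ext y
    simp only [Set.mem_ofPred_eq]
    rw [← mul_sub, abs_mul, abs_of_pos hδ]
    exact lt_mul_iff_one_lt_right hδ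
  have hk : ∀ x y : EuclideanSpace ℝ (Fin d), ENNReal.ofReal (δ ^ p / ‖x - y‖ ^ ((d : ℝ) + p)) =
      ENNReal.ofReal (δ ^ p) * ENNReal.ofReal (1 ^ p / ‖x - y‖ ^ ((d : ℝ) + p)) := by
    intro x y
    rw [← ENNReal.ofReal_mul (by positivity), Real.one_rpow, mul_one_div]
  simp only [Idelta, hset, hk]
  simp only [lintegral_const_mul' _ _ ENNReal.ofReal_ne_top]

/-- Restricting to segments requires a genuinely measurable function, so an almost everywhere equal
representative is chosen before dividing by `δ`; the energy does not see the change. -/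
lemma exists_measurable_rescaling {d : ℕ} {p δ : ℝ} (hp : 1 ≤ p) (hδ : 0 < δ)
    {u : EuclideanSpace ℝ (Fin d) → ℝ} (hu : MemLp u (ENNReal.ofReal p) volume) :
    ∃ v : EuclideanSpace ℝ (Fin d) → ℝ, Measurable v ∧
      ∫⁻ x, ENNReal.ofReal (|v x| ^ p) ≠ ⊤ ∧ (∀ᵐ x, u x = δ * v x) ∧
      Idelta p δ u = ENNReal.ofReal (δ ^ p) * Idelta p 1 v := by
  have hp0 : 0 < p := by linarith
  obtain ⟨g, hg, hug⟩ := hu.1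
  have hae : ∀ᵐ x, u x = δ * (g x / δ) := by
    filter_upwards [hug] with x hx
    rw [hx, mul_div_cancel₀ _ hδ.ne']
  have hgm := hg.measurable
  refine ⟨fun x => g x / δ, hgm.div_const δ, ?_, hae, ?_⟩
  · have h1 : MemLp (fun x => g x / δ) (ENNReal.ofReal p) volume := by
      have := (hu.ae_eq hug).const_mul δ⁻¹
      simpa only [div_eq_inv_mul] using this
    have h2 := lintegral_rpow_enorm_lt_top_of_eLpNorm_lt_top (by simpa using hp0)
      ENNReal.ofReal_ne_top h1.2
    rw [ENNReal.toReal_ofReal hp0.le] at h2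
    refine (lt_of_le_of_lt (le_of_eq (lintegral_congr fun x => ?_)) h2).ne
    rw [← ofReal_norm, Real.norm_eq_abs, ENNReal.ofReal_rpow_of_nonneg (abs_nonneg _) hp0.le]
  · rw [Idelta_congr_ae hae, Idelta_const_mul hδ]

/-- Passage from threshold one to an arbitrary threshold. -/
lemma lintegral_weighted_le_of_rescaling {d : ℕ} {p δ C Q : ℝ} (hδ : 0 < δ)
    {u v : EuclideanSpace ℝ (Fin d) → ℝ} (huv : ∀ᵐ x, u x = δ * v x)
    (hI : Idelta p δ u = ENNReal.ofReal (δ ^ p) * Idelta p 1 v)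
    {A : Set (EuclideanSpace ℝ (Fin d))} {W : EuclideanSpace ℝ (Fin d) → ℝ}
    (h : ∫⁻ x in A, ENNReal.ofReal (|v x| ^ p / W x) ≤
      ENNReal.ofReal C * (Idelta p 1 v + ENNReal.ofReal Q)) :
    ∫⁻ x in A, ENNReal.ofReal (|u x| ^ p / W x) ≤
      ENNReal.ofReal C * (Idelta p δ u + ENNReal.ofReal (Q * δ ^ p)) := by
  have hδp : 0 ≤ δ ^ p := by positivity
  calc _ = ∫⁻ x in A, ENNReal.ofReal (δ ^ p) * ENNReal.ofReal (|v x| ^ p / W x) := by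
        refine lintegral_congr_ae (ae_restrict_of_ae ?_)
        filter_upwards [huv] with x hx
        rw [hx, abs_mul, abs_of_pos hδ, Real.mul_rpow hδ.le (abs_nonneg _), mul_div_assoc,
          ENNReal.ofReal_mul hδp]
    _ = ENNReal.ofReal (δ ^ p) * ∫⁻ x in A, ENNReal.ofReal (|v x| ^ p / W x) :=
        lintegral_const_mul' _ _ ENNReal.ofReal_ne_top
    _ ≤ ENNReal.ofReal (δ ^ p) * (ENNReal.ofReal C * (Idelta p 1 v + ENNReal.ofReal Q)) := by
        gcongr
    _ = _ := by
        rw [hI, mul_comm Q, ENNReal.ofReal_mul hδp]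
        ring

theorem theorem1 (d : ℕ) (hd : 1 ≤ d) (p : ℝ) (hp : 1 ≤ p) :
    ∃ C : ℝ, 0 < C ∧
      ∀ (r R δ : ℝ) (u : EuclideanSpace ℝ (Fin d) → ℝ),
        0 < r → r < R → 0 < δ → MemLp u (ENNReal.ofReal p) volume →
        (p < d → essSupport u ⊆ Metric.ball 0 R →
          ∫⁻ x, ENNReal.ofReal (|u x| ^ p / ‖x‖ ^ p) ≤
            ENNReal.ofReal C *
              (Idelta p δ u + ENNReal.ofReal (R ^ ((d : ℝ) - p) * δ ^ p))) ∧
        ((d : ℝ) < p → essSupport u ⊆ (Metric.ball 0 r)ᶜ →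
          ∫⁻ x, ENNReal.ofReal (|u x| ^ p / ‖x‖ ^ p) ≤
            ENNReal.ofReal C *
              (Idelta p δ u + ENNReal.ofReal (r ^ ((d : ℝ) - p) * δ ^ p))) ∧
        (p = d → 2 ≤ d → essSupport u ⊆ Metric.ball 0 R →
          ∫⁻ x in (Metric.ball 0 r)ᶜ,
              ENNReal.ofReal (|u x| ^ d / (‖x‖ ^ d * Real.log (2 * R / ‖x‖) ^ d)) ≤
            ENNReal.ofReal C *
              (Idelta p δ u + ENNReal.ofReal (Real.log (2 * R / r) * δ ^ d))) ∧
        (p = d → 2 ≤ d → essSupport u ⊆ (Metric.ball 0 r)ᶜ →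
          ∫⁻ x in Metric.ball 0 R,
              ENNReal.ofReal (|u x| ^ d / (‖x‖ ^ d * Real.log (2 * ‖x‖ / r) ^ d)) ≤
            ENNReal.ofReal C *
              (Idelta p δ u + ENNReal.ofReal (Real.log (2 * R / r) * δ ^ d))) := by
  have hzero : ∀ {δ : ℝ} {u v : EuclideanSpace ℝ (Fin d) → ℝ}
      {S : Set (EuclideanSpace ℝ (Fin d))}, 0 < δ → (∀ᵐ x, u x = δ * v x) → essSupport u ⊆ S →
      ∀ᵐ x, x ∉ S → v x = 0 := by
    intro δ u v S hδ huv hS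
    filter_upwards [huv, ae_eq_zero_of_essSupport_subset hS] with x hx hx0 hxS
    have := hx0 hxS
    rw [hx] at this
    exact (mul_eq_zero.1 this).resolve_left hδ.ne'
  rcases lt_trichotomy p d with hpd | hpd | hpd
  · obtain ⟨C, hC, h⟩ := exists_hardy_subcritical d p hp hpd
    refine ⟨C, hC, fun r R δ u hr hrR hδ hu => ⟨fun _ hS => ?_, fun h' => by linarith,
      fun h' => by linarith, fun h' => by linarith⟩⟩
    obtain ⟨v, mv, hfin, huv, hI⟩ := exists_measurable_rescaling hp hδ hu
    have h1 := h v mv hfin R (hr.trans hrR) (hzero hδ huv hS)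
    rw [← setLIntegral_univ] at h1 ⊢
    exact lintegral_weighted_le_of_rescaling hδ huv hI h1
  · subst hpd
    by_cases hd2 : 2 ≤ d
    · obtain ⟨C₁, hC₁, h₁⟩ := exists_hardy_critical_inner d hd2
      obtain ⟨C₂, hC₂, h₂⟩ := exists_hardy_critical_outer d hd2
      refine ⟨max C₁ C₂, by positivity, fun r R δ u hr hrR hδ hu =>
        ⟨fun h' => by linarith, fun h' => by linarith, fun _ _ hS => ?_, fun _ _ hS => ?_⟩⟩
      · obtain ⟨v, mv, hfin, huv, hI⟩ := exists_measurable_rescaling hp hδ hu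
        have h3 := h₁ v mv hfin r R hr hrR (hzero hδ huv hS)
        -- The critical statements use natural powers, the rescaling lemma real ones.
        simp only [← Real.rpow_natCast |_| d] at h3 ⊢
        rw [← Real.rpow_natCast δ d]
        refine (lintegral_weighted_le_of_rescaling hδ huv hI h3).trans ?_
        gcongr
        exact le_max_left _ _
      · obtain ⟨v, mv, hfin, huv, hI⟩ := exists_measurable_rescaling hp hδ hu
        have h3 := h₂ v mv hfin r R hr hrR (hzero hδ huv hS)
        simp only [← Real.rpow_natCast |_| d] at h3 ⊢
        rw [← Real.rpow_natCast δ d]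
        refine (lintegral_weighted_le_of_rescaling hδ huv hI h3).trans ?_
        gcongr
        exact le_max_right _ _
    · exact ⟨1, one_pos, fun r R δ u _ _ _ _ => ⟨fun h' => by linarith, fun h' => by linarith,
        fun _ h' => absurd h' hd2, fun _ h' => absurd h' hd2⟩⟩
  · obtain ⟨C, hC, h⟩ := exists_hardy_supercritical d p hp hpd
    refine ⟨C, hC, fun r R δ u hr hrR hδ hu => ⟨fun h' => by linarith, fun _ hS => ?_,
      fun h' => by linarith, fun h' => by linarith⟩⟩
    obtain ⟨v, mv, hfin, huv, hI⟩ := exists_measurable_rescaling hp hδ hu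
    have h1 := h v mv hfin r hr (hzero hδ huv hS)
    rw [← setLIntegral_univ] at h1 ⊢
    exact lintegral_weighted_le_of_rescaling hδ huv hI h1
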